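/- Let $X$ be a compact smooth manifold with nonempty boundary $\partial X$, of dimension $n\ge 1$, and let $g$ be a scattering metric on $X$: a smooth Riemannian metric on the interior of $X$ for which there is a product decomposition $p\mapsto(x,y)\in[0,\varepsilon)\times\partial X$ near the boundary in which $$g=\frac{dx^2}{x^4}+\frac{h(x,y,dy)}{x^2},$$ with $h$ smooth up to $x=0$ and $h|_{x=0}$ a Riemannian metric on $\partial X$; extend $x$ to a smooth function on $X$ that is positive in the interior. Let $\Delta\ge 0$ be the Laplacian of $g$ and $L^2(X)$ the space of functions square integrable for the Riemannian volume of $g$. A Schwartz function on $X$ is a smooth function on $X$ that vanishes to infinite order at $\partial X$. Let $\mathrm{Diff}^m_{\mathrm{sc}}(X)$ be the span, with coefficients in $C^\infty(X)$, of the products of at most $m$ vector fields that are smooth on $X$ and of bounded $g$-length. A (differential) short-range perturbation of $\Delta^k$ is a differential operator $V\in x^2\,\mathrm{Diff}^{2k-1}_{\mathrm{sc}}(X)$ that is symmetric with respect to the Riemannian volume. Then for every even integer $k>1$ there exists a (differential) short-range perturbation $V$ of $\Delta^k$, which can even be taken to be multiplication by a real-valued Schwartz function, such that $\Delta^k+V$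 has a positive, embedded eigenvalue. That is, there is $E>0$ that is an eigenvalue of the closure in $L^2(X)$ of $\Delta^k+V$ defined on the Schwartz functions, and $E$ also belongs to the essential spectrum: there is an orthonormal sequence $(a_m)$ in the domain of the closure with $(\Delta^k+V-E)a_m\to 0$. -/

import Mathlib

open Set Filter Topology MeasureTheory
open scoped Manifold ContDiff InnerProductSpace ENNReal

noncomputable section

namespace ScatteringGeometry

/-! Throughout, `X` is a compact manifold with boundary of dimension `n = d + 1`, and `M` is a closed
manifold of dimension `d`, which a product decomposition identifies with the boundary of `X`. -/

/-- A product decomposition `p ↦ (x, y)` of a manifold with boundary near its boundary: the smooth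
function `x` is defined and nonnegative on all of `X`, it vanishes exactly on the boundary, and
`(x, y)` is a diffeomorphism, with inverse `ψ`, from the neighbourhood `{x < ε}` of the boundary
onto `[0, ε) × M`. In particular `m ↦ ψ (0, m)` identifies `M` with the boundary. -/
structure ProductDecomposition (d : ℕ)
    (X : Type*) [TopologicalSpace X] [ChartedSpace (EuclideanHalfSpace (d + 1)) X]
    (M : Type*) [TopologicalSpace M] [ChartedSpace (EuclideanSpace ℝ (Fin d)) M] where
  /-- the boundary defining function -/
  x : X → ℝ
  /-- the projection to the boundary (only its values on `{x < ε}` matter) -/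
  y : X → M
  /-- the width of the collar -/
  ε : ℝ
  /-- the inverse of `(x, y)` (only its values on `[0, ε) × M` matter) -/
  ψ : ℝ × M → X
  ε_pos : 0 < ε
  x_smooth : ContMDiff (𝓡∂ (d + 1)) 𝓘(ℝ, ℝ) ∞ x
  x_nonneg : ∀ p, 0 ≤ x p
  x_eq_zero_iff : ∀ p, x p = 0 ↔ p ∈ (𝓡∂ (d + 1)).boundary X
  y_smooth : ContMDiffOn (𝓡∂ (d + 1)) (𝓡 d) ∞ y {p | x p < ε}
  ψ_smooth : ContMDiffOn (𝓘(ℝ, ℝ).prod (𝓡 d)) (𝓡∂ (d + 1)) ∞ ψ (Ico 0 ε ×ˢ univ)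
  ψ_left : ∀ p, x p < ε → ψ (x p, y p) = p
  x_ψ : ∀ t ∈ Ico 0 ε, ∀ m, x (ψ (t, m)) = t
  y_ψ : ∀ t ∈ Ico 0 ε, ∀ m, y (ψ (t, m)) = m

/-- The differential of the boundary defining function. -/
def ProductDecomposition.dx {d : ℕ}
    {X : Type*} [TopologicalSpace X] [ChartedSpace (EuclideanHalfSpace (d + 1)) X]
    {M : Type*} [TopologicalSpace M] [ChartedSpace (EuclideanSpace ℝ (Fin d)) M]
    (D : ProductDecomposition d X M) (p : X) : TangentSpace (𝓡∂ (d + 1)) p →L[ℝ] ℝ :=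
  mfderiv (𝓡∂ (d + 1)) 𝓘(ℝ, ℝ) D.x p

section Metric

variable {d : ℕ}
  {X : Type*} [TopologicalSpace X] [ChartedSpace (EuclideanHalfSpace (d + 1)) X]
  [IsManifold (𝓡∂ (d + 1)) ∞ X]
  {M : Type*} [TopologicalSpace M] [ChartedSpace (EuclideanSpace ℝ (Fin d)) M]
  [IsManifold (𝓡 d) ∞ M]

/-- A scattering metric with respect to a product decomposition: a smooth Riemannian metric `g` on
the interior of `X` of the form `g = dx² / x⁴ + h(x, y, dy) / x²` near the boundary, with
`h` smooth up to `x = 0` and `h(0, y, dy)` a Riemannian metric on the boundary. -/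
structure ScatteringMetric (D : ProductDecomposition d X M) where
  /-- the metric (only its values at interior points matter) -/
  g : ∀ p : X, TangentSpace (𝓡∂ (d + 1)) p →L[ℝ] TangentSpace (𝓡∂ (d + 1)) p →L[ℝ] ℝ
  /-- the family of bilinear forms `h(t, m, ·)` on the boundary, for `0 ≤ t < ε` -/
  h : ℝ → ∀ m : M, TangentSpace (𝓡 d) m →L[ℝ] TangentSpace (𝓡 d) m →L[ℝ] ℝ
  g_symm : ∀ p ∈ (𝓡∂ (d + 1)).interior X, ∀ v w, g p v w = g p w v
  g_pos : ∀ p ∈ (𝓡∂ (d + 1)).interior X, ∀ v, v ≠ 0 → 0 < g p v v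
  g_smooth : ContMDiffOn (𝓡∂ (d + 1))
    ((𝓡∂ (d + 1)).prod
      𝓘(ℝ, EuclideanSpace ℝ (Fin (d + 1)) →L[ℝ] EuclideanSpace ℝ (Fin (d + 1)) →L[ℝ] ℝ)) ∞
    (fun p : X => Bundle.TotalSpace.mk'
      (EuclideanSpace ℝ (Fin (d + 1)) →L[ℝ] EuclideanSpace ℝ (Fin (d + 1)) →L[ℝ] ℝ)
      (E := fun p : X =>
        TangentSpace (𝓡∂ (d + 1)) p →L[ℝ] TangentSpace (𝓡∂ (d + 1)) p →L[ℝ] ℝ) p (g p))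
    ((𝓡∂ (d + 1)).interior X)
  h_smooth : ContMDiffOn (𝓘(ℝ, ℝ).prod (𝓡 d))
    ((𝓡 d).prod 𝓘(ℝ, EuclideanSpace ℝ (Fin d) →L[ℝ] EuclideanSpace ℝ (Fin d) →L[ℝ] ℝ)) ∞
    (fun q : ℝ × M => Bundle.TotalSpace.mk'
      (EuclideanSpace ℝ (Fin d) →L[ℝ] EuclideanSpace ℝ (Fin d) →L[ℝ] ℝ)
      (E := fun m : M => TangentSpace (𝓡 d) m →L[ℝ] TangentSpace (𝓡 d) m →L[ℝ] ℝ) q.2 (h q.1 q.2))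
    (Ico 0 D.ε ×ˢ univ)
  h_zero_symm : ∀ m v w, h 0 m v w = h 0 m w v
  h_zero_pos : ∀ m v, v ≠ 0 → 0 < h 0 m v v
  g_eq : ∀ p, 0 < D.x p → D.x p < D.ε → ∀ v w,
    g p v w =
      D.dx p v * D.dx p w / D.x p ^ 4
        + h (D.x p) (D.y p) (mfderiv (𝓡∂ (d + 1)) (𝓡 d) D.y p v)
            (mfderiv (𝓡∂ (d + 1)) (𝓡 d) D.y p w) / D.x p ^ 2

namespace ScatteringMetric

variable {D : ProductDecomposition d X M} (G : ScatteringMetric D)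

/-- The coordinate vector field `∂ᵢ` of the preferred chart at `p`, at the point with
coordinates `z`. -/
def coordVec (p : X) (z : EuclideanSpace ℝ (Fin (d + 1))) (i : Fin (d + 1)) :
    TangentSpace (𝓡∂ (d + 1)) ((extChartAt (𝓡∂ (d + 1)) p).symm z) :=
  mfderivWithin 𝓘(ℝ, EuclideanSpace ℝ (Fin (d + 1))) (𝓡∂ (d + 1))
    (extChartAt (𝓡∂ (d + 1)) p).symm (range (𝓡∂ (d + 1))) z (EuclideanSpace.single i (1 : ℝ))

/-- The matrix `gᵢⱼ` of the metric in the preferred chart at `p`, as a function of the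
coordinates. -/
def gram (p : X) (z : EuclideanSpace ℝ (Fin (d + 1))) :
    Matrix (Fin (d + 1)) (Fin (d + 1)) ℝ :=
  Matrix.of fun i j =>
    G.g ((extChartAt (𝓡∂ (d + 1)) p).symm z) (coordVec p z i) (coordVec p z j)

/-- The nonnegative Laplacian `Δ f = - (det g)^(-1/2) ∑ᵢ ∂ᵢ ((det g)^(1/2) ∑ⱼ gⁱʲ ∂ⱼ f)` of the
metric, in the preferred chart at each interior point (the values at boundary points, which form a
null set, are irrelevant). -/
def laplacian (f : X → ℂ) (p : X) : ℂ :=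
  -((1 / √(G.gram p (extChartAt (𝓡∂ (d + 1)) p p)).det : ℝ) : ℂ) *
    ∑ i, fderiv ℝ
      (fun z => ((√(G.gram p z).det : ℝ) : ℂ) *
        ∑ j, (((G.gram p z)⁻¹ i j : ℝ) : ℂ) *
          fderiv ℝ (fun w => f ((extChartAt (𝓡∂ (d + 1)) p).symm w)) z
            (EuclideanSpace.single j (1 : ℝ)))
      (extChartAt (𝓡∂ (d + 1)) p p) (EuclideanSpace.single i (1 : ℝ))

section Volume

variable [MeasurableSpace X]

/-- The measure `(det g)^(1/2) dz` in the domain of the preferred chart at `p`. -/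
def chartVolume (p : X) : Measure X :=
  (((volume : Measure (EuclideanSpace ℝ (Fin (d + 1)))).restrict
      (extChartAt (𝓡∂ (d + 1)) p).target).withDensity
    fun z => ENNReal.ofReal √(G.gram p z).det).map (extChartAt (𝓡∂ (d + 1)) p).symm

/-- The Riemannian volume measure. The chart measures agree wherever two charts overlap, and
their supremum is the measure that restricts to each of them. -/
def vol : Measure X := ⨆ p : X, G.chartVolume p

end Volume

/-- The algebra `C^∞(X)` of complex-valued functions that are smooth up to the boundary. -/
abbrev Smooth (d : ℕ) (X : Type*) [TopologicalSpace X]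
    [ChartedSpace (EuclideanHalfSpace (d + 1)) X] :=
  ContMDiffMap (𝓡∂ (d + 1)) 𝓘(ℝ, ℂ) X ℂ ∞

/-- A scattering vector field: a real vector field that is smooth on `X` up to the boundary and of
bounded length with respect to the scattering metric. -/
structure IsScVectorField (v : ∀ p : X, TangentSpace (𝓡∂ (d + 1)) p) : Prop where
  smooth : ContMDiff (𝓡∂ (d + 1)) (𝓡∂ (d + 1)).tangent ∞
    (fun p => (⟨p, v p⟩ : TangentBundle (𝓡∂ (d + 1)) X))
  bounded : ∃ C : ℝ, ∀ p ∈ (𝓡∂ (d + 1)).interior X, G.g p (v p) (v p) ≤ C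

/-- The operators `f ↦ v f` on `C^∞(X)`, for scattering vector fields `v`. -/
def scVectorFieldOps : Set (Module.End ℝ (Smooth d X)) :=
  {T | ∃ v : ∀ p : X, TangentSpace (𝓡∂ (d + 1)) p, G.IsScVectorField v ∧
    ∀ f p, T f p = mfderiv (𝓡∂ (d + 1)) 𝓘(ℝ, ℂ) f p (v p)}

theorem smooth_mul (a f : Smooth d X) :
    ContMDiff (𝓡∂ (d + 1)) 𝓘(ℝ, ℂ) ∞ (fun p => a p * f p) := by
  have hm : ContDiff ℝ ∞ (fun q : ℂ × ℂ => q.1 * q.2) := contDiff_fst.mul contDiff_snd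
  exact hm.contMDiff.comp (a.contMDiff.prodMk_space f.contMDiff)

/-- The operator of multiplication by `a` on `C^∞(X)`. -/
def mulOp (a : Smooth d X) : Module.End ℝ (Smooth d X) where
  toFun f := ⟨fun p => a p * f p, smooth_mul a f⟩
  map_add' f₁ f₂ := by
    ext p
    exact mul_add (a p) (f₁ p) (f₂ p)
  map_smul' c f := by
    ext p
    exact mul_smul_comm c (a p) (f p)

/-- `Diff_sc^m(X)`: sums of products of at most `m` scattering vector fields, with complex-valued
coefficients in `C^∞(X)`. -/
def scDiffOps (m : ℕ) : Submodule ℝ (Module.End ℝ (Smooth d X)) :=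
  Submodule.span ℝ {T | ∃ (a : Smooth d X) (L : List (Module.End ℝ (Smooth d X))),
    L.length ≤ m ∧ (∀ S ∈ L, S ∈ G.scVectorFieldOps) ∧ T = mulOp a * L.prod}

/-- Schwartz functions on `X`: smooth functions vanishing to infinite order at the boundary, that
is, elements of `x^N C^∞(X)` for every `N`. -/
def IsSchwartz (D : ProductDecomposition d X M) (f : Smooth d X) : Prop :=
  ∀ N : ℕ, ∃ w : Smooth d X, ∀ p, f p = (D.x p : ℂ) ^ N * w p

section Operators

variable [MeasurableSpace X]

/-- A (differential) short-range perturbation of `Δ^k`: an element of `x² Diff_sc^(2k-1)(X)` that is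
symmetric on Schwartz functions with respect to the Riemannian volume. -/
structure IsShortRange (k : ℕ) (V : Module.End ℝ (Smooth d X)) : Prop where
  mem : ∃ P ∈ G.scDiffOps (2 * k - 1), ∀ f p, V f p = (D.x p : ℂ) ^ 2 * P f p
  symm : ∀ f₁ f₂ : Smooth d X, IsSchwartz D f₁ → IsSchwartz D f₂ →
    ∫ p, star (V f₁ p) * f₂ p ∂G.vol = ∫ p, star (f₁ p) * V f₂ p ∂G.vol

/-- The graph, in `L² × L²`, of `Δ^k + V` with the Schwartz functions as its domain. -/
def opGraph (k : ℕ) (V : Module.End ℝ (Smooth d X)) :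
    Set (Lp ℂ 2 G.vol × Lp ℂ 2 G.vol) :=
  {ab | ∃ f : Smooth d X, IsSchwartz D f ∧ ab.1 =ᵐ[G.vol] f ∧
    ab.2 =ᵐ[G.vol] fun p => G.laplacian^[k] f p + V f p}

end Operators

end ScatteringMetric

end Metric

section Spectrum

variable {H : Type*} [NormedAddCommGroup H] [InnerProductSpace ℂ H]

/-- `E` is an eigenvalue of the closure of the operator with graph `A`. -/
def IsClosureEigenvalue (A : Set (H × H)) (E : ℝ) : Prop :=
  ∃ u : H, u ≠ 0 ∧ (u, (E : ℂ) • u) ∈ closure A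

/-- `E` is in the essential spectrum of the closure of the operator with graph `A` (by Weyl's
criterion, for an essentially self-adjoint operator): there is an orthonormal sequence of
approximate eigenvectors. -/
def IsClosureEssential (A : Set (H × H)) (E : ℝ) : Prop :=
  ∃ a b : ℕ → H, Orthonormal ℂ a ∧ (∀ n, (a n, b n) ∈ closure A) ∧
    Tendsto (fun n => b n - (E : ℂ) • a n) atTop (𝓝 0)

end Spectrum

end ScatteringGeometry

end

open Set Filter Topology MeasureTheory
open scoped Manifold ContDiff InnerProductSpace ENNReal

noncomputable section

set_option linter.unusedSectionVars false

namespace ScatteringGeometry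

section

/-! ### Divergence-form operators on Euclidean space -/

section Euclidean

/-! The eigenfunction is built first and the potential is read off from it. Near the boundary
consider the weight w = e^(-γ/x) x^(d/2). The exponent d/2 compensates the volume growth: in w⁻¹ Δ w
the terms of order x cancel, so that w⁻¹ Δ w = -γ² + x² Q, where Q maps smooth functions on X to
smooth functions (`exists_conj_laplacian`). On powers of x the leading part of Q is the transport
operator x^(j+1) a ↦ -2γ(j+1) x^j a (`exists_conj_pow`). For γ ≠ 0 these coefficients never vanish,
so the transport equations can be solved order by order starting from the constant 1, and Borel's
lemma (`exists_borel_sum`) sums the solution to a smooth a with |a - 1| ≤ 1/2 and Δ(w a) = w(-γ² a +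
x² r), with r Schwartz (`exists_conj_eigen`).

For γ = 1 the function u = w a decays exponentially and satisfies Δu = -u up to w times a Schwartz
function. The number -1 is of no use for Δ itself, which is nonnegative, but an even power k turns
it into (-1)^k = 1: one gets Δ^k u = w(a + s) with s Schwartz. The error is measured relative to w
and a has no zeros, so v = -s/a is again Schwartz and (Δ^k + v) u = u exactly. Taking real parts
makes a, and hence v, real (`exists_potential`). Thus E = 1, and u is itself Schwartz, so it lies in
the initial domain.

For the essential spectrum take γ = i, where -γ² = 1 and w oscillates without decaying. Cut w off by
a bump in 1/(xR), supported where x is comparable with 1/R. The volume density is comparable with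
x^(-d-2), so the squared norm is at least of order R. Each derivative of the cut-off, the factor x²,
and the decay of v gain a factor 1/R, so the squared norm of the error is at most of order 1/R
(`exists_quasimode_bounds`). Letting R run through a geometric progression makes the supports
disjoint, and normalization gives a Weyl sequence (`isClosureEssential_one`).

The remaining work makes the chartwise definitions usable. Piola's identity gives coordinate
invariance of the Laplacian (`lapE_comp`, `laplacian_param`), change of variables identifies the
supremum of the chart measures (`vol_restrict_param`), and the collar form of g (`gramOf_collar`)
shows that Δ is x² times an operator with coefficients smooth up to x = 0 (`lapE_collarGram`). -/

/-- The partial derivative in the `i`-th coordinate direction. -/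
def pd {n : ℕ} {F : Type*} [NormedAddCommGroup F] [NormedSpace ℝ F] (i : Fin n)
    (f : EuclideanSpace ℝ (Fin n) → F) (z : EuclideanSpace ℝ (Fin n)) : F :=
  fderiv ℝ f z (EuclideanSpace.single i (1 : ℝ))

theorem differentiable_det {n : ℕ} :
    Differentiable ℝ (fun M : Fin n → Fin n → ℂ => (Matrix.of M).det) := by
  simp only [Matrix.det_apply, Matrix.of_apply, Units.smul_def]
  refine Differentiable.fun_sum fun σ _ => Differentiable.const_smul ?_ _
  fun_prop

/-- Factor out det A and expand det(1 + tM) = 1 + t tr M + O(t²) with M = A⁻¹B; the remainder is t²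
times a polynomial in t. -/
theorem hasDerivAt_det_line {n : ℕ} (A B : Matrix (Fin n) (Fin n) ℂ) (hA : A.det ≠ 0) :
    HasDerivAt (fun t : ℝ => (A + (t : ℂ) • B).det) (A.det * (A⁻¹ * B).trace) 0 := by
  have hu : IsUnit A.det := isUnit_iff_ne_zero.mpr hA
  have h1 : ∀ t : ℝ, (A + (t : ℂ) • B).det = A.det * (1 + (A⁻¹ * B).trace * (t : ℂ) +
      (Matrix.det (1 + (Polynomial.X : Polynomial ℂ) •
        (A⁻¹ * B).map Polynomial.C)).divX.divX.eval (t : ℂ) * (t : ℂ) ^ 2) := by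
    intro t
    rw [← Matrix.det_one_add_smul, ← Matrix.det_mul, mul_add, mul_one, Matrix.mul_smul,
      ← mul_assoc, Matrix.mul_nonsing_inv _ hu, one_mul]
  simp_rw [h1]
  generalize (Matrix.det (1 + (Polynomial.X : Polynomial ℂ) •
        (A⁻¹ * B).map Polynomial.C)).divX.divX = P
  have h0 : HasDerivAt (fun t : ℝ => (t : ℂ)) 1 0 := Complex.ofRealCLM.hasDerivAt
  have hP : HasDerivAt (fun t : ℝ => P.eval (t : ℂ)) (P.derivative.eval ((0 : ℝ) : ℂ) * 1) 0 :=
    (P.hasDerivAt ((0 : ℝ) : ℂ)).comp (0 : ℝ) h0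
  have := (((h0.const_mul (A⁻¹ * B).trace).const_add 1).add (hP.mul (h0.pow 2))).const_mul A.det
  convert! this using 1
  simp

/-- Jacobi's formula for the derivative of a determinant. -/
theorem fderiv_det_apply {n : ℕ} {H : Type*} [NormedAddCommGroup H] [NormedSpace ℝ H]
    {A : H → Matrix (Fin n) (Fin n) ℂ} {z : H}
    (hA : ∀ i j, DifferentiableAt ℝ (fun w => A w i j) z) (hdet : (A z).det ≠ 0) (e : H) :
    DifferentiableAt ℝ (fun w => (A w).det) z ∧
    fderiv ℝ (fun w => (A w).det) z e =
      (A z).det * ∑ i, ∑ k, (A z)⁻¹ i k * fderiv ℝ (fun w => A w k i) z e := by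
  have hA' : HasFDerivAt (fun w => (fun i j => A w i j : Fin n → Fin n → ℂ))
      (ContinuousLinearMap.pi fun i => ContinuousLinearMap.pi fun j =>
        fderiv ℝ (fun w => A w i j) z) z :=
    hasFDerivAt_pi.2 fun i => hasFDerivAt_pi.2 fun j => (hA i j).hasFDerivAt
  have hD := (differentiable_det (n := n) (fun i j => A z i j)).hasFDerivAt
  have hcomp := hD.comp z hA'
  refine ⟨hcomp.differentiableAt, ?_⟩
  have h1 : fderiv ℝ (fun w => (A w).det) z e =
      fderiv ℝ (fun M : Fin n → Fin n → ℂ => (Matrix.of M).det) (fun i j => A z i j)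
        (fun i j => fderiv ℝ (fun w => A w i j) z e) := by
    have := hcomp.fderiv
    change fderiv ℝ (fun w => (A w).det) z = _ at this
    rw [this]
    rfl
  -- The determinant is already known to be differentiable, so its derivative in the required
  -- direction can be read off along a straight line in matrix space.
  have hline : HasDerivAt (fun t : ℝ => (fun i j => A z i j : Fin n → Fin n → ℂ) +
      t • (fun i j => fderiv ℝ (fun w => A w i j) z e : Fin n → Fin n → ℂ))
      (fun i j => fderiv ℝ (fun w => A w i j) z e : Fin n → Fin n → ℂ) 0 := by
    have h := ((hasDerivAt_id (0 : ℝ)).smul_const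
      (fun i j => fderiv ℝ (fun w => A w i j) z e : Fin n → Fin n → ℂ)).const_add
      (fun i j => A z i j : Fin n → Fin n → ℂ)
    simpa using h
  have h2 := HasFDerivAt.comp_hasDerivAt_of_eq (0 : ℝ) hD hline (by simp)
  have h3 := hasDerivAt_det_line (A z) (Matrix.of fun i j => fderiv ℝ (fun w => A w i j) z e) hdet
  have h4 := h2.unique (h3.congr_of_eventuallyEq (Eventually.of_forall fun t => by
    simp only [Function.comp]
    congr 1))
  rw [h1, h4]
  simp [Matrix.trace, Matrix.mul_apply]

theorem euclidean_sum_single {n : ℕ} (v : EuclideanSpace ℝ (Fin n)) :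
    v = ∑ k, v k • EuclideanSpace.single k (1 : ℝ) := by
  ext i
  simp [Finset.sum_apply, Pi.single_apply]

theorem pd_comp {n m : ℕ} {F : Type*} [NormedAddCommGroup F] [NormedSpace ℝ F]
    {τ : EuclideanSpace ℝ (Fin m) → EuclideanSpace ℝ (Fin n)} {z : EuclideanSpace ℝ (Fin m)}
    {f : EuclideanSpace ℝ (Fin n) → F}
    (hf : DifferentiableAt ℝ f (τ z)) (hτ : DifferentiableAt ℝ τ z) (i : Fin m) :
    pd i (fun w => f (τ w)) z =
      ∑ k, (fderiv ℝ τ z (EuclideanSpace.single i (1 : ℝ)) k) • pd k f (τ z) := by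
  have := fderiv_comp (f := τ) (g := f) z hf hτ
  simp only [pd]
  change fderiv ℝ (f ∘ τ) z _ = _
  rw [this, ContinuousLinearMap.comp_apply]
  conv_lhs => rw [euclidean_sum_single (fderiv ℝ τ z (EuclideanSpace.single i (1 : ℝ)))]
  simp

/-- The Jacobian matrix, with columns indexed by the source coordinates. -/
def jac {n : ℕ} (τ : EuclideanSpace ℝ (Fin n) → EuclideanSpace ℝ (Fin n))
    (z : EuclideanSpace ℝ (Fin n)) : Matrix (Fin n) (Fin n) ℝ :=
  Matrix.of fun k j => fderiv ℝ τ z (EuclideanSpace.single j (1 : ℝ)) k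

theorem contDiffAt_jac {n : ℕ} {τ : EuclideanSpace ℝ (Fin n) → EuclideanSpace ℝ (Fin n)}
    {z : EuclideanSpace ℝ (Fin n)} (hτ : ContDiffAt ℝ ∞ τ z) (k j : Fin n) :
    ContDiffAt ℝ ∞ (fun w => jac τ w k j) z := by
  have h := (hτ.fderiv_right (m := ∞) (by norm_cast)).clm_apply
    (contDiffAt_const (c := EuclideanSpace.single j (1 : ℝ)))
  exact (EuclideanSpace.proj k).contDiff.contDiffAt.comp z h

/-- Piola's identity: the divergence of a vector field pulled back as a density. -/
theorem piola {n : ℕ} {τ : EuclideanSpace ℝ (Fin n) → EuclideanSpace ℝ (Fin n)}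
    {z : EuclideanSpace ℝ (Fin n)} (hτ : ContDiffAt ℝ ∞ τ z) (hdet : (jac τ z).det ≠ 0)
    {V W : Fin n → EuclideanSpace ℝ (Fin n) → ℂ}
    (hV : ∀ k, DifferentiableAt ℝ (V k) (τ z)) (hW : ∀ k, DifferentiableAt ℝ (W k) z)
    (hVW : ∀ᶠ w in 𝓝 z, ∀ k, ∑ j, ((jac τ w k j : ℝ) : ℂ) * W j w = V k (τ w)) :
    ∑ i, pd i (fun w => (((jac τ w).det : ℝ) : ℂ) * W i w) z =
      (((jac τ z).det : ℝ) : ℂ) * ∑ k, pd k (V k) (τ z) := by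
  have hτd : DifferentiableAt ℝ τ z := hτ.differentiableAt (by simp)
  set A : EuclideanSpace ℝ (Fin n) → Matrix (Fin n) (Fin n) ℂ :=
    fun w => (jac τ w).map Complex.ofReal with hAdef
  have hAdet : ∀ w, (A w).det = (((jac τ w).det : ℝ) : ℂ) := fun w =>
    (RingHom.map_det Complex.ofRealHom (jac τ w)).symm
  have hJ : ∀ k j, DifferentiableAt ℝ (fun w => jac τ w k j) z := fun k j =>
    (contDiffAt_jac hτ k j).differentiableAt (by simp)
  have hA : ∀ k j, DifferentiableAt ℝ (fun w => A w k j) z := fun k j =>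
    Complex.ofRealCLM.differentiableAt.comp z (hJ k j)
  have hAz : (A z).det ≠ 0 := by rw [hAdet]; exact_mod_cast hdet
  have hunit : IsUnit (A z).det := isUnit_iff_ne_zero.mpr hAz
  -- symmetry of the second derivative
  have hsymm : ∀ k i j, pd i (fun w => A w k j) z = pd j (fun w => A w k i) z := by
    intro k i j
    have hs : IsSymmSndFDerivAt ℝ τ z := hτ.isSymmSndFDerivAt (by simp; norm_cast)
    have hd : DifferentiableAt ℝ (fderiv ℝ τ) z :=
      (hτ.fderiv_right (m := ∞) (by norm_cast)).differentiableAt (by simp)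
    have key : ∀ i j : Fin n, pd i (fun w => A w k j) z =
        ((fderiv ℝ (fderiv ℝ τ) z (EuclideanSpace.single i (1 : ℝ))
          (EuclideanSpace.single j (1 : ℝ)) k : ℝ) : ℂ) := by
      intro i j
      have h1 : HasFDerivAt (fun w => fderiv ℝ τ w (EuclideanSpace.single j (1 : ℝ)))
          ((fderiv ℝ (fderiv ℝ τ) z).flip (EuclideanSpace.single j (1 : ℝ))) z := by
        have := hd.hasFDerivAt.clm_apply
          (hasFDerivAt_const (EuclideanSpace.single j (1 : ℝ)) z)
        simpa using this
      have h2 := ((Complex.ofRealCLM.comp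
        (EuclideanSpace.proj (𝕜 := ℝ) k : EuclideanSpace ℝ (Fin n) →L[ℝ] ℝ)).hasFDerivAt
          (x := fderiv ℝ τ z (EuclideanSpace.single j (1 : ℝ)))).comp z h1
      have h3 := h2.fderiv
      simp only [pd]
      change fderiv ℝ (fun w => A w k j) z = _ at h3
      rw [h3]
      simp
    rw [key, key, hs.eq]
  -- differentiate the relation between `V` and `W`
  have hdiff : ∀ i k, ∑ j, (pd i (fun w => A w k j) z * W j z + A z k j * pd i (W j) z) =
      ∑ l, A z l i * pd l (V k) (τ z) := by
    intro i k
    have h1 : pd i (fun w => ∑ j, A w k j * W j w) z = pd i (fun w => V k (τ w)) z := by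
      simp only [pd]
      rw [Filter.EventuallyEq.fderiv_eq]
      filter_upwards [hVW] with w hw using hw k
    rw [pd_comp (hV k) hτd] at h1
    simp only [pd] at h1 ⊢
    rw [fderiv_fun_sum (A := fun j w => A w k j * W j w) (fun j _ => (hA k j).fun_mul (hW j))] at h1
    simp only [sum_apply] at h1
    have h2 : ∀ j, fderiv ℝ (fun w => A w k j * W j w) z (EuclideanSpace.single i (1 : ℝ)) =
        fderiv ℝ (fun w => A w k j) z (EuclideanSpace.single i (1 : ℝ)) * W j z +
          A z k j * fderiv ℝ (W j) z (EuclideanSpace.single i (1 : ℝ)) := by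
      intro j
      rw [fderiv_fun_mul (hA k j) (hW j)]
      simp only [add_apply, smul_apply, smul_eq_mul]
      ring
    simp_rw [h2] at h1
    rw [h1]
    exact Finset.sum_congr rfl fun l _ => by
      simp [A, jac]
  have hBA : ∀ i j, ∑ k, (A z)⁻¹ i k * A z k j = if i = j then 1 else 0 := fun i j => by
    rw [← Matrix.mul_apply, Matrix.nonsing_inv_mul _ hunit, Matrix.one_apply]
  have hAB : ∀ i j, ∑ k, A z i k * (A z)⁻¹ k j = if i = j then 1 else 0 := fun i j => by
    rw [← Matrix.mul_apply, Matrix.mul_nonsing_inv _ hunit, Matrix.one_apply]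
  -- Contracting the differentiated relation with the inverse Jacobian turns its right side into the
  -- divergence of `V`.
  have hsum : ∑ i, ∑ k, (A z)⁻¹ i k * ∑ j, (pd i (fun w => A w k j) z * W j z +
      A z k j * pd i (W j) z) = ∑ k, pd k (V k) (τ z) := by
    simp_rw [hdiff, Finset.mul_sum]
    rw [Finset.sum_comm]
    refine Finset.sum_congr rfl fun k _ => ?_
    rw [Finset.sum_comm]
    calc ∑ l, ∑ i, (A z)⁻¹ i k * (A z l i * pd l (V k) (τ z))
        = ∑ l, (if l = k then 1 else 0) * pd l (V k) (τ z) := by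
          refine Finset.sum_congr rfl fun l _ => ?_
          rw [← hAB, Finset.sum_mul]
          exact Finset.sum_congr rfl fun i _ => by ring
      _ = _ := by simp
  -- On the left side the symmetry of second derivatives produces tr(J⁻¹ ∂ⱼJ), which Jacobi's
  -- formula recognizes as the logarithmic derivative of det J.
  have hsplit : ∑ i, ∑ k, (A z)⁻¹ i k * ∑ j, (pd i (fun w => A w k j) z * W j z +
      A z k j * pd i (W j) z) =
      ∑ j, W j z * (∑ i, ∑ k, (A z)⁻¹ i k * pd j (fun w => A w k i) z) + ∑ i, pd i (W i) z := by
    simp_rw [Finset.sum_add_distrib, mul_add, Finset.sum_add_distrib]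
    congr 1
    · simp_rw [Finset.mul_sum]
      have : ∀ i k, ∑ j, (A z)⁻¹ i k * (pd i (fun w => A w k j) z * W j z) =
        ∑ j, W j z * ((A z)⁻¹ i k * pd j (fun w => A w k i) z) := fun i k =>
          Finset.sum_congr rfl fun j _ => by rw [hsymm k i j]; ring
      simp_rw [this]
      rw [Finset.sum_congr rfl fun i _ => Finset.sum_comm, Finset.sum_comm]
    · refine Finset.sum_congr rfl fun i _ => ?_
      simp_rw [Finset.mul_sum]
      rw [Finset.sum_comm]
      calc ∑ j, ∑ k, (A z)⁻¹ i k * (A z k j * pd i (W j) z)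
          = ∑ j, (if i = j then 1 else 0) * pd i (W j) z := by
            refine Finset.sum_congr rfl fun j _ => ?_
            rw [← hBA, Finset.sum_mul]
            exact Finset.sum_congr rfl fun k _ => by ring
        _ = _ := by simp
  have hjac := fun j : Fin n => fderiv_det_apply hA hAz (EuclideanSpace.single j (1 : ℝ))
  have hprod : ∀ i, pd i (fun w => (((jac τ w).det : ℝ) : ℂ) * W i w) z =
      (A z).det * (W i z * (∑ l, ∑ k, (A z)⁻¹ l k * pd i (fun w => A w k l) z) +
        pd i (W i) z) := by
    intro i
    simp_rw [← hAdet]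
    simp only [pd]
    rw [fderiv_fun_mul (hjac i).1 (hW i)]
    simp only [add_apply, smul_apply, smul_eq_mul,
      (hjac i).2]
    ring
  simp_rw [hprod, ← Finset.mul_sum, Finset.sum_add_distrib, ← hsplit, hsum, hAdet]

end Euclidean

end

section

/-! ### Smooth dependence of determinants and inverse matrices on parameters. -/

section MatrixSmooth

variable {n : ℕ} {H : Type*} [NormedAddCommGroup H] [NormedSpace ℝ H]
  {A : H → Matrix (Fin n) (Fin n) ℝ} {s : Set H} {z : H}

/-- The version within a set is needed because the boundary metrics `collarH` are smooth only up to
the face x = 0, not across it. -/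
theorem contDiffWithinAt_det (hA : ∀ i j, ContDiffWithinAt ℝ ∞ (fun w => A w i j) s z) :
    ContDiffWithinAt ℝ ∞ (fun w => (A w).det) s z := by
  simp only [Matrix.det_apply, Units.smul_def]
  refine ContDiffWithinAt.sum fun σ _ => ContDiffWithinAt.const_smul _ ?_
  exact contDiffWithinAt_prod fun i _ => hA _ _

/-- Cramer's rule: an entry of the inverse is a quotient of two determinants in the entries. -/
theorem contDiffWithinAt_inv (hA : ∀ i j, ContDiffWithinAt ℝ ∞ (fun w => A w i j) s z)
    (hdet : (A z).det ≠ 0) (i j : Fin n) :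
    ContDiffWithinAt ℝ ∞ (fun w => (A w)⁻¹ i j) s z := by
  have h : (fun w => (A w)⁻¹ i j) =
      fun w => ((A w).det)⁻¹ * ((A w).updateRow j (Pi.single i 1)).det := by
    funext w
    rw [Matrix.inv_def, Matrix.smul_apply, Matrix.adjugate_apply, Ring.inverse_eq_inv', smul_eq_mul]
  rw [h]
  refine ((contDiffWithinAt_det hA).inv hdet).mul (contDiffWithinAt_det fun k l => ?_)
  by_cases hk : k = j
  · subst hk
    simp only [Matrix.updateRow_self]
    exact contDiffWithinAt_const
  · simp only [Matrix.updateRow_ne hk]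
    exact hA k l

theorem contDiffWithinAt_sqrt_det (hA : ∀ i j, ContDiffWithinAt ℝ ∞ (fun w => A w i j) s z)
    (hdet : 0 < (A z).det) : ContDiffWithinAt ℝ ∞ (fun w => √(A w).det) s z :=
  (contDiffWithinAt_det hA).sqrt hdet.ne'

theorem contDiffWithinAt_complex_ofReal {f : H → ℝ} (hf : ContDiffWithinAt ℝ ∞ f s z) :
    ContDiffWithinAt ℝ ∞ (fun w => ((f w : ℝ) : ℂ)) s z :=
  Complex.ofRealCLM.contDiff.contDiffAt.comp_contDiffWithinAt z hf

theorem contDiffAt_complex_ofReal {f : H → ℝ} (hf : ContDiffAt ℝ ∞ f z) :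
    ContDiffAt ℝ ∞ (fun w => ((f w : ℝ) : ℂ)) z :=
  Complex.ofRealCLM.contDiff.contDiffAt.comp z hf

end MatrixSmooth

/-! ### The coordinate Laplacian of a metric on Euclidean space. -/

section LapE

variable {n : ℕ}

theorem contDiffAt_pd {F : Type*} [NormedAddCommGroup F] [NormedSpace ℝ F]
    {f : EuclideanSpace ℝ (Fin n) → F} {z : EuclideanSpace ℝ (Fin n)}
    (hf : ContDiffAt ℝ ∞ f z) (i : Fin n) : ContDiffAt ℝ ∞ (pd i f) z :=
  (hf.fderiv_right (m := ∞) (by norm_cast)).clm_apply contDiffAt_const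

theorem pd_congr {F : Type*} [NormedAddCommGroup F] [NormedSpace ℝ F]
    {f g : EuclideanSpace ℝ (Fin n) → F} {z : EuclideanSpace ℝ (Fin n)}
    (h : f =ᶠ[𝓝 z] g) (i : Fin n) : pd i f z = pd i g z := by
  simp only [pd, h.fderiv_eq]

theorem pd_congr_eventually {F : Type*} [NormedAddCommGroup F] [NormedSpace ℝ F]
    {f g : EuclideanSpace ℝ (Fin n) → F} {z : EuclideanSpace ℝ (Fin n)}
    (h : f =ᶠ[𝓝 z] g) (i : Fin n) : pd i f =ᶠ[𝓝 z] pd i g :=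
  h.eventually_nhds.mono fun _ hw => pd_congr hw i

theorem pd_mul {f g : EuclideanSpace ℝ (Fin n) → ℂ} {z : EuclideanSpace ℝ (Fin n)}
    (hf : DifferentiableAt ℝ f z) (hg : DifferentiableAt ℝ g z) (i : Fin n) :
    pd i (fun w => f w * g w) z = f z * pd i g z + g z * pd i f z := by
  simp [pd, fderiv_fun_mul hf hg]

/-- The flux `(det g)^(1/2) ∑ⱼ gⁱʲ ∂ⱼ f`. -/
def flux (Gm : EuclideanSpace ℝ (Fin n) → Matrix (Fin n) (Fin n) ℝ)
    (f : EuclideanSpace ℝ (Fin n) → ℂ) (i : Fin n) (z : EuclideanSpace ℝ (Fin n)) : ℂ :=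
  ((√(Gm z).det : ℝ) : ℂ) * ∑ j, (((Gm z)⁻¹ i j : ℝ) : ℂ) * pd j f z

/-- The Laplacian of the metric `Gm` on Euclidean space. -/
def lapE (Gm : EuclideanSpace ℝ (Fin n) → Matrix (Fin n) (Fin n) ℝ)
    (f : EuclideanSpace ℝ (Fin n) → ℂ) (z : EuclideanSpace ℝ (Fin n)) : ℂ :=
  -((1 / √(Gm z).det : ℝ) : ℂ) * ∑ i, pd i (flux Gm f i) z

/-- A metric that is smooth at a point. -/
structure SmoothMetricAt (Gm : EuclideanSpace ℝ (Fin n) → Matrix (Fin n) (Fin n) ℝ)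
    (z : EuclideanSpace ℝ (Fin n)) : Prop where
  smooth : ∀ i j, ContDiffAt ℝ ∞ (fun w => Gm w i j) z
  det_pos : 0 < (Gm z).det

variable {Gm Gm' : EuclideanSpace ℝ (Fin n) → Matrix (Fin n) (Fin n) ℝ}
  {f g : EuclideanSpace ℝ (Fin n) → ℂ} {z : EuclideanSpace ℝ (Fin n)}

theorem SmoothMetricAt.sqrt_det (h : SmoothMetricAt Gm z) :
    ContDiffAt ℝ ∞ (fun w => √(Gm w).det) z :=
  contDiffWithinAt_univ.1 <| contDiffWithinAt_sqrt_det
    (fun i j => contDiffWithinAt_univ.2 (h.smooth i j)) h.det_pos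

theorem SmoothMetricAt.inv (h : SmoothMetricAt Gm z) (i j : Fin n) :
    ContDiffAt ℝ ∞ (fun w => (Gm w)⁻¹ i j) z :=
  contDiffWithinAt_univ.1 <| contDiffWithinAt_inv
    (fun i j => contDiffWithinAt_univ.2 (h.smooth i j)) h.det_pos.ne' i j

theorem SmoothMetricAt.eventually_det_pos (h : SmoothMetricAt Gm z) :
    ∀ᶠ w in 𝓝 z, 0 < (Gm w).det := by
  have : ContDiffAt ℝ ∞ (fun w => (Gm w).det) z := contDiffWithinAt_univ.1 <|
    contDiffWithinAt_det fun i j => contDiffWithinAt_univ.2 (h.smooth i j)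
  exact this.continuousAt.eventually (lt_mem_nhds h.det_pos)

theorem contDiffAt_flux (h : SmoothMetricAt Gm z) (hf : ContDiffAt ℝ ∞ f z) (i : Fin n) :
    ContDiffAt ℝ ∞ (flux Gm f i) z :=
  (contDiffAt_complex_ofReal h.sqrt_det).mul <| ContDiffAt.sum fun j _ =>
    (contDiffAt_complex_ofReal (h.inv i j)).mul (contDiffAt_pd hf j)

theorem contDiffAt_lapE (h : SmoothMetricAt Gm z) (hf : ContDiffAt ℝ ∞ f z) :
    ContDiffAt ℝ ∞ (lapE Gm f) z := by
  refine ContDiffAt.mul (ContDiffAt.neg (contDiffAt_complex_ofReal ?_))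
    (ContDiffAt.sum fun i _ => contDiffAt_pd (contDiffAt_flux h hf i) i)
  exact contDiffAt_const.div h.sqrt_det (Real.sqrt_pos.2 h.det_pos).ne'

theorem flux_congr (hf : f =ᶠ[𝓝 z] g) (i : Fin n) : flux Gm f i =ᶠ[𝓝 z] flux Gm g i := by
  have : ∀ᶠ w in 𝓝 z, ∀ j, pd j f w = pd j g w :=
    eventually_all.2 fun j => pd_congr_eventually hf j
  filter_upwards [this] with w hw
  simp only [flux, hw]

theorem lapE_congr (hG : Gm =ᶠ[𝓝 z] Gm') (hf : f =ᶠ[𝓝 z] g) : lapE Gm f z = lapE Gm' g z := by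
  have : ∀ i, flux Gm f i =ᶠ[𝓝 z] flux Gm' g i := fun i => by
    filter_upwards [hG, flux_congr (Gm := Gm) hf i] with w h1 h2
    rw [h2]
    simp only [flux, h1]
  simp only [lapE, fun i => pd_congr (this i) i, hG.eq_of_nhds]

/-- The carré du champ of the metric. -/
def gradE (Gm : EuclideanSpace ℝ (Fin n) → Matrix (Fin n) (Fin n) ℝ)
    (f g : EuclideanSpace ℝ (Fin n) → ℂ) (z : EuclideanSpace ℝ (Fin n)) : ℂ :=
  ∑ i, ∑ j, (((Gm z)⁻¹ i j : ℝ) : ℂ) * (pd i f z * pd j g z)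

/-- The product rule for the Laplacian. -/
theorem lapE_mul (h : SmoothMetricAt Gm z) (hf : ContDiffAt ℝ ∞ f z) (hg : ContDiffAt ℝ ∞ g z) :
    lapE Gm (fun w => f w * g w) z =
      f z * lapE Gm g z + g z * lapE Gm f z - gradE Gm f g z - gradE Gm g f z := by
  have hsm : ∀ {u : EuclideanSpace ℝ (Fin n) → ℂ}, ContDiffAt ℝ ∞ u z →
      ∀ᶠ w in 𝓝 z, DifferentiableAt ℝ u w := fun hu =>
    ((hu.of_le (m := 1) (by norm_cast)).eventually (by simp)).mono
      fun w hw => hw.differentiableAt (by simp)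
  have h1 : ∀ i, flux Gm (fun w => f w * g w) i =ᶠ[𝓝 z]
      fun w => f w * flux Gm g i w + g w * flux Gm f i w := fun i => by
    filter_upwards [hsm hf, hsm hg] with w hfw hgw
    simp only [flux, pd_mul hfw hgw, mul_add, Finset.sum_add_distrib, Finset.mul_sum]
    congr 1 <;> exact Finset.sum_congr rfl fun j _ => by ring
  have hfd := hf.differentiableAt (by simp)
  have hgd := hg.differentiableAt (by simp)
  have hF := fun i => (contDiffAt_flux h hf i).differentiableAt (by simp)
  have hG := fun i => (contDiffAt_flux h hg i).differentiableAt (by simp)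
  have h2 : ∀ i, pd i (flux Gm (fun w => f w * g w) i) z =
      (f z * pd i (flux Gm g i) z + flux Gm g i z * pd i f z) +
      (g z * pd i (flux Gm f i) z + flux Gm f i z * pd i g z) := fun i => by
    rw [pd_congr (h1 i) i, ← pd_mul hfd (hG i), ← pd_mul hgd (hF i)]
    simp only [pd]
    rw [fderiv_fun_add (hfd.fun_mul (hG i)) (hgd.fun_mul (hF i))]
    rfl
  have hs : ((√(Gm z).det : ℝ) : ℂ) ≠ 0 := by exact_mod_cast (Real.sqrt_pos.2 h.det_pos).ne'
  -- Pairing the flux of one function with the gradient of the other gives `gradE`. Both orders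
  -- survive because symmetry of `Gm` is not assumed.
  have h3 : ∀ u v : EuclideanSpace ℝ (Fin n) → ℂ, gradE Gm u v z =
      ((1 / √(Gm z).det : ℝ) : ℂ) * ∑ i, flux Gm v i z * pd i u z := fun u v => by
    simp only [gradE, flux, Finset.mul_sum, Finset.sum_mul]
    push_cast
    exact Finset.sum_congr rfl fun i _ => Finset.sum_congr rfl fun j _ => by field_simp
  simp only [lapE, h2, h3, Finset.sum_add_distrib, ← Finset.mul_sum]
  ring

/-- Invariance of the Laplacian under a change of coordinates. -/
theorem lapE_comp {τ : EuclideanSpace ℝ (Fin n) → EuclideanSpace ℝ (Fin n)}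
    (hτ : ContDiffAt ℝ ∞ τ z) (hdet : (jac τ z).det ≠ 0)
    (hG : SmoothMetricAt Gm (τ z)) (hf : ContDiffAt ℝ ∞ f (τ z))
    (hG' : ∀ᶠ w in 𝓝 z, Gm' w = (jac τ w).transpose * Gm (τ w) * jac τ w)
    (hfg : ∀ᶠ w in 𝓝 z, g w = f (τ w)) :
    SmoothMetricAt Gm' z ∧ lapE Gm' g z = lapE Gm f (τ z) := by
  have hdG' : ∀ᶠ w in 𝓝 z, (Gm' w).det = (jac τ w).det ^ 2 * (Gm (τ w)).det := by
    filter_upwards [hG'] with w hw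
    rw [hw, Matrix.det_mul, Matrix.det_mul, Matrix.det_transpose]
    ring
  have hsG' : SmoothMetricAt Gm' z := by
    refine ⟨fun i j => ?_, ?_⟩
    · have : (fun w => Gm' w i j) =ᶠ[𝓝 z] fun w =>
          ∑ k, (∑ l, jac τ w l i * Gm (τ w) l k) * jac τ w k j := by
        filter_upwards [hG'] with w hw
        rw [hw]
        simp [Matrix.mul_apply]
      refine ContDiffAt.congr_of_eventuallyEq ?_ this
      exact ContDiffAt.sum fun k _ => (ContDiffAt.sum fun l _ => (contDiffAt_jac hτ l i).mul
        ((hG.smooth l k).comp z hτ)).mul (contDiffAt_jac hτ k j)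
    · rw [hdG'.self_of_nhds]
      have := hG.det_pos
      positivity
  have hg : ContDiffAt ℝ ∞ g z := (hf.comp z hτ).congr_of_eventuallyEq hfg
  refine ⟨hsG', ?_⟩
  have hτd : ∀ᶠ w in 𝓝 z, DifferentiableAt ℝ τ w :=
    ((hτ.of_le (m := 1) (by norm_cast)).eventually (by simp)).mono
      fun w hw => hw.differentiableAt (by simp)
  have hfd : ∀ᶠ w in 𝓝 z, DifferentiableAt ℝ f (τ w) := hτ.continuousAt.eventually <|
    ((hf.of_le (m := 1) (by norm_cast)).eventually (by simp)).mono
      fun w hw => hw.differentiableAt (by simp)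
  have hjc : ContinuousAt (fun w => (jac τ w).det) z :=
    (contDiffWithinAt_univ.1 (contDiffWithinAt_det fun i j =>
      contDiffWithinAt_univ.2 (contDiffAt_jac hτ i j))).continuousAt
  have hdetn : ∀ᶠ w in 𝓝 z, (jac τ w).det ≠ 0 := hjc.eventually_ne hdet
  -- The sign of the Jacobian determinant is locally constant; it replaces the absolute value in
  -- √det and cancels at the end.
  obtain ⟨σ, hσ, hσ'⟩ : ∃ σ : ℝ, σ ≠ 0 ∧ ∀ᶠ w in 𝓝 z, |(jac τ w).det| = σ * (jac τ w).det := by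
    rcases hdet.lt_or_gt with h | h
    · exact ⟨-1, by norm_num, (hjc.eventually (gt_mem_nhds h)).mono fun w hw => by
        rw [abs_of_neg hw]; ring⟩
    · exact ⟨1, by norm_num, (hjc.eventually (lt_mem_nhds h)).mono fun w hw => by
        rw [abs_of_pos hw]; ring⟩
  have hGτ : ∀ᶠ w in 𝓝 z, 0 < (Gm (τ w)).det := hτ.continuousAt.eventually hG.eventually_det_pos
  have hsq : ∀ᶠ w in 𝓝 z, √(Gm' w).det = σ * (jac τ w).det * √(Gm (τ w)).det := by
    filter_upwards [hdG', hσ'] with w h1 h2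
    rw [h1, Real.sqrt_mul (sq_nonneg _), Real.sqrt_sq_eq_abs, h2]
  -- the vector field to which Piola's identity applies
  let W : Fin n → EuclideanSpace ℝ (Fin n) → ℂ := fun i w =>
    ((√(Gm (τ w)).det : ℝ) : ℂ) * ∑ j, (((Gm' w)⁻¹ i j : ℝ) : ℂ) * pd j g w
  have hW : ∀ i, DifferentiableAt ℝ (W i) z := fun i =>
    ((contDiffAt_complex_ofReal (hG.sqrt_det.comp z hτ)).mul (ContDiffAt.sum fun j _ =>
      (contDiffAt_complex_ofReal (hsG'.inv i j)).mul (contDiffAt_pd hg j))).differentiableAt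
        (by simp)
  have hVW : ∀ᶠ w in 𝓝 z, ∀ k, ∑ j, ((jac τ w k j : ℝ) : ℂ) * W j w = flux Gm f k (τ w) := by
    filter_upwards [hG', hτd, hfd, hdetn, hGτ, hfg.eventually_nhds] with w h1 h2 h3 h4 h5 h6 k
    have hpd : ∀ m, pd m g w = ∑ l, ((jac τ w l m : ℝ) : ℂ) * pd l f (τ w) := fun m => by
      rw [pd_congr h6, pd_comp h3 h2]
      simp [jac]
    have hu : IsUnit (jac τ w).det := isUnit_iff_ne_zero.2 h4
    have hut : IsUnit (jac τ w).transpose.det := by rwa [Matrix.det_transpose]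
    -- The inverse metric transforms contravariantly, so the Jacobian carries the pulled-back
    -- gradient field to the original one. This is the hypothesis of Piola's identity.
    have hM : jac τ w * (Gm' w)⁻¹ * (jac τ w).transpose = (Gm (τ w))⁻¹ := by
      rw [h1, Matrix.mul_inv_rev, Matrix.mul_inv_rev, ← mul_assoc, ← mul_assoc,
        Matrix.mul_nonsing_inv _ hu, one_mul, mul_assoc, Matrix.nonsing_inv_mul _ hut, mul_one]
    have hMe : ∀ l, (((Gm (τ w))⁻¹ k l : ℝ) : ℂ) = ∑ m, (∑ j, ((jac τ w k j : ℝ) : ℂ) *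
        (((Gm' w)⁻¹ j m : ℝ) : ℂ)) * ((jac τ w l m : ℝ) : ℂ) := fun l => by
      rw [← hM]
      simp [Matrix.mul_apply]
    simp only [W, flux, hpd, hMe, Finset.mul_sum, Finset.sum_mul]
    rw [Finset.sum_congr rfl fun j _ => Finset.sum_comm, Finset.sum_comm]
    refine Finset.sum_congr rfl fun l _ => ?_
    rw [Finset.sum_comm]
    exact Finset.sum_congr rfl fun m _ => Finset.sum_congr rfl fun j _ => by ring
  have hpiola := piola hτ hdet
    (fun k => (contDiffAt_flux hG hf k).differentiableAt (by simp)) hW hVW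
  have hflux : ∀ i, flux Gm' g i =ᶠ[𝓝 z] fun w =>
      (σ : ℂ) * ((((jac τ w).det : ℝ) : ℂ) * W i w) := fun i => by
    filter_upwards [hsq] with w hw
    simp only [flux, hw, W]
    push_cast
    ring
  have hdc : DifferentiableAt ℝ (fun w => (((jac τ w).det : ℝ) : ℂ)) z :=
    (contDiffAt_complex_ofReal (contDiffWithinAt_univ.1 (contDiffWithinAt_det fun i j =>
      contDiffWithinAt_univ.2 (contDiffAt_jac hτ i j)))).differentiableAt (by simp)
  have hpdf : ∀ i, pd i (flux Gm' g i) z =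
      (σ : ℂ) * pd i (fun w => (((jac τ w).det : ℝ) : ℂ) * W i w) z := fun i => by
    rw [pd_congr (hflux i)]
    simp only [pd]
    rw [fderiv_const_mul (hdc.fun_mul (hW i))]
    rfl
  simp only [lapE, hpdf, ← Finset.mul_sum, hpiola, hsq.self_of_nhds]
  have h1 : ((√(Gm (τ z)).det : ℝ) : ℂ) ≠ 0 := by
    exact_mod_cast (Real.sqrt_pos.2 hG.det_pos).ne'
  have h2 : (((jac τ z).det : ℝ) : ℂ) ≠ 0 := by exact_mod_cast hdet
  have h3 : (σ : ℂ) ≠ 0 := by exact_mod_cast hσ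
  push_cast
  field_simp

end LapE

end

section

/-! ### The Laplacian of a scattering metric in collar coordinates -/

section CollarE

variable {d : ℕ}

/-- The Gram matrix of `dx² / x⁴ + H / x²`, where `x` is the coordinate of index zero. -/
def collarGram (H : EuclideanSpace ℝ (Fin (d + 1)) → Matrix (Fin d) (Fin d) ℝ)
    (z : EuclideanSpace ℝ (Fin (d + 1))) : Matrix (Fin (d + 1)) (Fin (d + 1)) ℝ :=
  Matrix.of fun i j => Fin.cases (Fin.cases (1 / z 0 ^ 4) (fun _ => 0) j)
    (fun i' => Fin.cases 0 (fun j' => H z i' j' / z 0 ^ 2) j) i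

variable {H : EuclideanSpace ℝ (Fin (d + 1)) → Matrix (Fin d) (Fin d) ℝ}
  {z : EuclideanSpace ℝ (Fin (d + 1))}

/-- The matrix is block diagonal, with x⁻⁴ in one block and x⁻²H in the other, so the power of x is
-4 - 2d = -2(d+2). Writing it as a square prepares for the square root. -/
theorem collarGram_det (hz : 0 < z 0) :
    (collarGram H z).det = ((z 0 ^ (d + 2))⁻¹) ^ 2 * (H z).det := by
  rw [Matrix.det_succ_row_zero, Fin.sum_univ_succ]
  simp only [collarGram, Matrix.of_apply, Fin.cases_zero, Fin.cases_succ, mul_zero, zero_mul,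
    Finset.sum_const_zero, add_zero]
  have : (Matrix.submatrix (Matrix.of fun i j : Fin (d + 1) =>
      (Fin.cases (Fin.cases (1 / z 0 ^ 4) (fun _ => 0) j)
        (fun i' => Fin.cases 0 (fun j' => H z i' j' / z 0 ^ 2) j) i : ℝ)) Fin.succ
          (Fin.succAbove 0)) = (z 0 ^ 2)⁻¹ • H z := by
    ext i j
    simp [div_eq_inv_mul]
  rw [this, Matrix.det_smul]
  simp only [Fin.val_zero, pow_zero, Fintype.card_fin]
  rw [inv_pow, inv_pow, ← pow_mul, ← pow_mul, show (d + 2) * 2 = 2 * d + 4 by ring, pow_add]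
  field_simp

theorem collarGram_sqrt_det (hz : 0 < z 0) :
    √(collarGram H z).det = (z 0 ^ (d + 2))⁻¹ * √(H z).det := by
  rw [collarGram_det hz, Real.sqrt_mul (sq_nonneg _), Real.sqrt_sq (by positivity)]

theorem collarGram_inv (hz : 0 < z 0) (hH : (H z).det ≠ 0) :
    (collarGram H z)⁻¹ = Matrix.of fun i j => Fin.cases (Fin.cases (z 0 ^ 4) (fun _ => 0) j)
    (fun i' => Fin.cases 0 (fun j' => z 0 ^ 2 * (H z)⁻¹ i' j') j) i := by
  apply Matrix.inv_eq_right_inv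
  ext i j
  rw [Matrix.mul_apply, Fin.sum_univ_succ]
  refine Fin.cases ?_ (fun i => ?_) i <;> refine Fin.cases ?_ (fun j => ?_) j
  · simp [collarGram]; field_simp
  · simp [collarGram, (Fin.succ_ne_zero _).symm]
  · simp [collarGram, (Fin.succ_ne_zero _)]
  · have h1 : ∑ k, H z i k * (H z)⁻¹ k j = (1 : Matrix (Fin d) (Fin d) ℝ) i j := by
      rw [← Matrix.mul_apply, Matrix.mul_nonsing_inv _ (isUnit_iff_ne_zero.2 hH)]
    simp only [collarGram, Matrix.of_apply, Fin.cases_zero, Fin.cases_succ, mul_zero, zero_add]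
    have h2 : (1 : Matrix (Fin (d + 1)) (Fin (d + 1)) ℝ) i.succ j.succ =
        (1 : Matrix (Fin d) (Fin d) ℝ) i j := by simp [Matrix.one_apply]
    rw [h2, ← h1]
    exact Finset.sum_congr rfl fun k _ => by field_simp

/-- The flux with respect to `collarGram`, up to the factor `x⁻ᵈ`, as a function of the
gradient. -/
def collarFlux (Hz : Matrix (Fin d) (Fin d) ℝ) (x : ℝ) (D : Fin (d + 1) → ℂ) (i : Fin (d + 1)) :
    ℂ :=
  ((√Hz.det : ℝ) : ℂ) * Fin.cases ((x : ℂ) ^ 2 * D 0)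
    (fun i' => ∑ j, ((Hz⁻¹ i' j : ℝ) : ℂ) * D j.succ) i

theorem flux_collarGram (hz : 0 < z 0) (hH : (H z).det ≠ 0)
    (f : EuclideanSpace ℝ (Fin (d + 1)) → ℂ) (i : Fin (d + 1)) :
    flux (collarGram H) f i z =
      ((z 0 : ℂ) ^ d)⁻¹ * collarFlux (H z) (z 0) (fun j => pd j f z) i := by
  have h0 : (z 0 : ℂ) ≠ 0 := by exact_mod_cast hz.ne'
  simp only [flux, collarFlux, collarGram_sqrt_det hz, collarGram_inv hz hH]
  rw [Fin.sum_univ_succ]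
  refine Fin.cases ?_ (fun i => ?_) i
  · simp
    field_simp
    ring
  · simp only [Matrix.of_apply, Fin.cases_zero, Fin.cases_succ]
    push_cast
    simp only [mul_assoc, ← Finset.mul_sum]
    field_simp
    ring

/-- Partial derivatives within a set. -/
def pdW (S : Set (EuclideanSpace ℝ (Fin (d + 1)))) (i : Fin (d + 1))
    (f : EuclideanSpace ℝ (Fin (d + 1)) → ℂ) (z : EuclideanSpace ℝ (Fin (d + 1))) : ℂ :=
  fderivWithin ℝ f S z (EuclideanSpace.single i (1 : ℝ))

theorem pdW_eq_pd {S : Set (EuclideanSpace ℝ (Fin (d + 1)))} (hz : S ∈ 𝓝 z)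
    (f : EuclideanSpace ℝ (Fin (d + 1)) → ℂ) (i : Fin (d + 1)) : pdW S i f z = pd i f z := by
  simp only [pdW, pd, fderivWithin_of_mem_nhds hz]

theorem contDiffOn_pdW {S : Set (EuclideanSpace ℝ (Fin (d + 1)))} (hS : UniqueDiffOn ℝ S)
    {f : EuclideanSpace ℝ (Fin (d + 1)) → ℂ} (hf : ContDiffOn ℝ ∞ f S) (i : Fin (d + 1)) :
    ContDiffOn ℝ ∞ (pdW S i f) S :=
  (hf.fderivWithin hS (m := ∞) (by norm_cast)).clm_apply contDiffOn_const

/-- The function `x⁻² Δ f`, which is smooth up to `x = 0`. -/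
def collarLap (H : EuclideanSpace ℝ (Fin (d + 1)) → Matrix (Fin d) (Fin d) ℝ)
    (S : Set (EuclideanSpace ℝ (Fin (d + 1)))) (f : EuclideanSpace ℝ (Fin (d + 1)) → ℂ)
    (z : EuclideanSpace ℝ (Fin (d + 1))) : ℂ :=
  -((1 / √(H z).det : ℝ) : ℂ) *
      ∑ i, pdW S i (fun w => collarFlux (H w) (w 0) (fun j => pdW S j f w) i) z
    + d * (z 0 : ℂ) * pdW S 0 f z

variable {S : Set (EuclideanSpace ℝ (Fin (d + 1)))}

theorem contDiff_coord (i : Fin (d + 1)) :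
    ContDiff ℝ ∞ (fun w : EuclideanSpace ℝ (Fin (d + 1)) => (w i : ℝ)) :=
  (EuclideanSpace.proj (𝕜 := ℝ) i).contDiff

theorem contDiff_coord_complex (i : Fin (d + 1)) :
    ContDiff ℝ ∞ (fun w : EuclideanSpace ℝ (Fin (d + 1)) => ((w i : ℝ) : ℂ)) :=
  Complex.ofRealCLM.contDiff.comp (contDiff_coord i)

theorem contDiffOn_collarFlux (hH : ∀ i j, ContDiffOn ℝ ∞ (fun w => H w i j) S)
    (hdet : ∀ w ∈ S, 0 < (H w).det) {D : Fin (d + 1) → EuclideanSpace ℝ (Fin (d + 1)) → ℂ}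
    (hD : ∀ j, ContDiffOn ℝ ∞ (D j) S) (i : Fin (d + 1)) :
    ContDiffOn ℝ ∞ (fun w => collarFlux (H w) (w 0) (fun j => D j w) i) S := by
  intro w hw
  have hs := contDiffWithinAt_sqrt_det (fun i j => hH i j w hw) (hdet w hw)
  refine (contDiffWithinAt_complex_ofReal hs).mul ?_
  refine Fin.cases ?_ (fun i => ?_) i
  · simp only [Fin.cases_zero]
    exact ((contDiff_coord_complex 0).contDiffWithinAt.pow 2).mul (hD 0 w hw)
  · simp only [Fin.cases_succ]
    exact ContDiffWithinAt.sum fun j _ =>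
      (contDiffWithinAt_complex_ofReal
        (contDiffWithinAt_inv (fun i j => hH i j w hw) (hdet w hw).ne' i j)).mul
        (hD _ w hw)

theorem contDiffOn_collarLap (hS : UniqueDiffOn ℝ S)
    (hH : ∀ i j, ContDiffOn ℝ ∞ (fun w => H w i j) S) (hdet : ∀ w ∈ S, 0 < (H w).det)
    {f : EuclideanSpace ℝ (Fin (d + 1)) → ℂ} (hf : ContDiffOn ℝ ∞ f S) :
    ContDiffOn ℝ ∞ (collarLap H S f) S := by
  refine ContDiffOn.add (ContDiffOn.mul (ContDiffOn.neg fun w hw => ?_)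
    (ContDiffOn.sum fun i _ => contDiffOn_pdW hS
      (contDiffOn_collarFlux hH hdet (fun j => contDiffOn_pdW hS hf j) i) i))
    ((contDiffOn_const.mul (contDiff_coord_complex 0).contDiffOn).mul (contDiffOn_pdW hS hf 0))
  exact contDiffWithinAt_complex_ofReal (contDiffWithinAt_const.div (contDiffWithinAt_sqrt_det
    (fun i j => hH i j w hw) (hdet w hw)) (Real.sqrt_pos.2 (hdet w hw)).ne')

theorem smoothMetricAt_collarGram (hS : S ∈ 𝓝 z) (hz : 0 < z 0)
    (hH : ∀ i j, ContDiffOn ℝ ∞ (fun w => H w i j) S) (hdet : ∀ w ∈ S, 0 < (H w).det) :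
    SmoothMetricAt (collarGram H) z := by
  refine ⟨fun i j => ?_, ?_⟩
  · have hx : ContDiffAt ℝ ∞ (fun w : EuclideanSpace ℝ (Fin (d + 1)) => w 0) z :=
      (contDiff_coord 0).contDiffAt
    refine Fin.cases ?_ (fun i => ?_) i <;> refine Fin.cases ?_ (fun j => ?_) j
    · simp only [collarGram, Matrix.of_apply, Fin.cases_zero]
      exact contDiffAt_const.div (hx.pow 4) (by positivity)
    · exact contDiffAt_const
    · exact contDiffAt_const
    · simp only [collarGram, Matrix.of_apply, Fin.cases_succ]
      exact ((hH i j).contDiffAt hS).div (hx.pow 2) (by positivity)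
  · rw [collarGram_det hz]
    have := hdet z (mem_of_mem_nhds hS)
    positivity

theorem pd_coord (φ : ℝ → ℂ) (hφ : DifferentiableAt ℝ φ (z 0)) (i : Fin (d + 1)) :
    pd i (fun w : EuclideanSpace ℝ (Fin (d + 1)) => φ (w 0)) z =
      if i = 0 then deriv φ (z 0) else 0 := by
  have h1 : HasFDerivAt (fun w : EuclideanSpace ℝ (Fin (d + 1)) => w 0)
      (EuclideanSpace.proj (𝕜 := ℝ) (0 : Fin (d + 1)) : EuclideanSpace ℝ (Fin (d + 1)) →L[ℝ] ℝ) z :=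
    (EuclideanSpace.proj (𝕜 := ℝ) (0 : Fin (d + 1)) :
      EuclideanSpace ℝ (Fin (d + 1)) →L[ℝ] ℝ).hasFDerivAt
  have h2 := (hφ.hasDerivAt.hasFDerivAt.comp z h1).fderiv
  simp only [pd]
  change fderiv ℝ (fun w : EuclideanSpace ℝ (Fin (d + 1)) => φ (w 0)) z = _ at h2
  rw [h2]
  by_cases h : i = 0
  · subst h; simp
  · simp [h, Ne.symm h]

/-- The density contributes x^(d+2) outside the divergence and the flux contributes x^(-d) inside
it. Together they leave x², and differentiating x^(-d) gives the extra term d x ∂ₓf. -/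
theorem lapE_collarGram (hS : S ∈ 𝓝 z) (hz : 0 < z 0)
    (hH : ∀ i j, ContDiffOn ℝ ∞ (fun w => H w i j) S) (hdet : ∀ w ∈ S, 0 < (H w).det)
    {f : EuclideanSpace ℝ (Fin (d + 1)) → ℂ} (hf : ContDiffAt ℝ ∞ f z) :
    lapE (collarGram H) f z = (z 0 : ℂ) ^ 2 * collarLap H S f z := by
  have hSe : ∀ᶠ w in 𝓝 z, S ∈ 𝓝 w := eventually_mem_nhds_iff.2 hS
  have hze : ∀ᶠ w : EuclideanSpace ℝ (Fin (d + 1)) in 𝓝 z, 0 < w 0 :=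
    (contDiff_coord 0).continuous.continuousAt.eventually (lt_mem_nhds hz)
  have h0 : (z 0 : ℂ) ≠ 0 := by exact_mod_cast hz.ne'
  have hω : ((√(H z).det : ℝ) : ℂ) ≠ 0 := by
    exact_mod_cast (Real.sqrt_pos.2 (hdet z (mem_of_mem_nhds hS))).ne'
  set Y : Fin (d + 1) → EuclideanSpace ℝ (Fin (d + 1)) → ℂ := fun i w =>
    collarFlux (H w) (w 0) (fun j => pdW S j f w) i with hY
  have hflux : ∀ i, flux (collarGram H) f i =ᶠ[𝓝 z] fun w => ((w 0 : ℂ) ^ d)⁻¹ * Y i w := by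
    intro i
    filter_upwards [hSe, hze] with w h1 h2
    rw [flux_collarGram h2 (hdet w (mem_of_mem_nhds h1)).ne']
    simp only [hY, pdW_eq_pd h1]
  have hYd : ∀ i, DifferentiableAt ℝ (Y i) z := by
    intro i
    have h1 : (fun w => (w 0 : ℂ) ^ d * flux (collarGram H) f i w) =ᶠ[𝓝 z] Y i := by
      filter_upwards [hflux i, hze] with w h1 h2
      have : (w 0 : ℂ) ≠ 0 := by exact_mod_cast h2.ne'
      rw [h1]
      field_simp
    refine DifferentiableAt.congr_of_eventuallyEq ?_ h1.symm
    exact (((contDiff_coord_complex 0).contDiffAt.pow d).mul (contDiffAt_flux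
      (smoothMetricAt_collarGram hS hz hH hdet) hf i)).differentiableAt (by simp)
  have hφ : HasDerivAt (fun t : ℝ => ((t : ℂ) ^ d)⁻¹) (-(d * (z 0 : ℂ) ^ d / z 0) /
      ((z 0 : ℂ) ^ d) ^ 2) (z 0) := by
    have h1 : HasDerivAt (fun t : ℝ => (t : ℂ)) 1 (z 0) := Complex.ofRealCLM.hasDerivAt
    have := (h1.pow d).inv (pow_ne_zero d h0)
    convert! this using 1
    rcases Nat.eq_zero_or_pos d with h | h
    · simp [h]
    · obtain ⟨m, rfl⟩ := Nat.exists_eq_succ_of_ne_zero h.ne'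
      simp
      field_simp
      ring
  have hφd : DifferentiableAt ℝ (fun w : EuclideanSpace ℝ (Fin (d + 1)) => ((w 0 : ℂ) ^ d)⁻¹) z :=
    DifferentiableAt.comp (g := fun t : ℝ => ((t : ℂ) ^ d)⁻¹) z hφ.differentiableAt
      ((contDiff_coord 0).contDiffAt.differentiableAt (by simp))
  have hpd : ∀ i, pd i (flux (collarGram H) f i) z = ((z 0 : ℂ) ^ d)⁻¹ * pdW S i (Y i) z +
      Y i z * (if i = 0 then -(d * (z 0 : ℂ) ^ d / z 0) / ((z 0 : ℂ) ^ d) ^ 2 else 0) := by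
    intro i
    rw [pd_congr (hflux i), pd_mul hφd (hYd i), pdW_eq_pd hS, ← hφ.deriv,
      ← pd_coord (fun t => ((t : ℂ) ^ d)⁻¹) hφ.differentiableAt]
  have hY0 : Y 0 z = ((√(H z).det : ℝ) : ℂ) * ((z 0 : ℂ) ^ 2 * pdW S 0 f z) := by
    simp [hY, collarFlux]
  simp only [lapE, hpd, Finset.sum_add_distrib, ← Finset.mul_sum, collarLap]
  simp only [mul_ite, mul_zero, Finset.sum_ite_eq', Finset.mem_univ, if_true, hY0,
    collarGram_sqrt_det hz]
  change _ = (z 0 : ℂ) ^ 2 * (_ * ∑ i, pdW S i (Y i) z + _)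
  generalize ∑ i, pdW S i (Y i) z = T
  push_cast
  field_simp
  ring

theorem gradE_coord_left (hz : 0 < z 0) (hH : (H z).det ≠ 0) {φ : ℝ → ℂ}
    (hφ : DifferentiableAt ℝ φ (z 0)) (f : EuclideanSpace ℝ (Fin (d + 1)) → ℂ) :
    gradE (collarGram H) (fun w => φ (w 0)) f z = (z 0 : ℂ) ^ 4 * deriv φ (z 0) * pd 0 f z := by
  simp only [gradE, pd_coord φ hφ, collarGram_inv hz hH]
  rw [Fin.sum_univ_succ, Fin.sum_univ_succ]
  simp [Fin.succ_ne_zero, mul_assoc]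

theorem gradE_coord_right (hz : 0 < z 0) (hH : (H z).det ≠ 0) {φ : ℝ → ℂ}
    (hφ : DifferentiableAt ℝ φ (z 0)) (f : EuclideanSpace ℝ (Fin (d + 1)) → ℂ) :
    gradE (collarGram H) f (fun w => φ (w 0)) z = (z 0 : ℂ) ^ 4 * deriv φ (z 0) * pd 0 f z := by
  simp only [gradE, pd_coord φ hφ, collarGram_inv hz hH]
  rw [Fin.sum_univ_succ, Fin.sum_univ_succ]
  simp [Fin.succ_ne_zero]
  ring

/-- The logarithmic derivative in `x` of the density of `H`. -/
def collarLogDeriv (H : EuclideanSpace ℝ (Fin (d + 1)) → Matrix (Fin d) (Fin d) ℝ)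
    (S : Set (EuclideanSpace ℝ (Fin (d + 1)))) (z : EuclideanSpace ℝ (Fin (d + 1))) : ℂ :=
  ((1 / √(H z).det : ℝ) : ℂ) * pdW S 0 (fun w => ((√(H w).det : ℝ) : ℂ)) z

theorem contDiffOn_collarLogDeriv (hS : UniqueDiffOn ℝ S)
    (hH : ∀ i j, ContDiffOn ℝ ∞ (fun w => H w i j) S) (hdet : ∀ w ∈ S, 0 < (H w).det) :
    ContDiffOn ℝ ∞ (collarLogDeriv H S) S := by
  have h := fun w (hw : w ∈ S) => contDiffWithinAt_sqrt_det (fun i j => hH i j w hw) (hdet w hw)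
  exact ContDiffOn.mul (fun w hw => contDiffWithinAt_complex_ofReal
    (contDiffWithinAt_const.div (h w hw) (Real.sqrt_pos.2 (hdet w hw)).ne'))
    (contDiffOn_pdW hS (fun w hw => contDiffWithinAt_complex_ofReal (h w hw)) 0)

/-- Here Δx = -x^(d+2) ω⁻¹ ∂ₓ(x^(2-d) ω) with ω = √det H. The (d-2)x³ term is what the power x^(d/2)
of the weight later balances. -/
theorem lapE_collarGram_coord (hS : S ∈ 𝓝 z) (hz : 0 < z 0)
    (hH : ∀ i j, ContDiffOn ℝ ∞ (fun w => H w i j) S) (hdet : ∀ w ∈ S, 0 < (H w).det) :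
    lapE (collarGram H) (fun w => ((w 0 : ℝ) : ℂ)) z =
      (d - 2) * (z 0 : ℂ) ^ 3 - (z 0 : ℂ) ^ 4 * collarLogDeriv H S z := by
  have hSe : ∀ᶠ w in 𝓝 z, S ∈ 𝓝 w := eventually_mem_nhds_iff.2 hS
  have hω : ((√(H z).det : ℝ) : ℂ) ≠ 0 := by
    exact_mod_cast (Real.sqrt_pos.2 (hdet z (mem_of_mem_nhds hS))).ne'
  have hid : ∀ t : ℝ, HasDerivAt (fun t : ℝ => (t : ℂ)) 1 t := fun t =>
    Complex.ofRealCLM.hasDerivAt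
  have hpdx : ∀ w : EuclideanSpace ℝ (Fin (d + 1)), ∀ j,
      pd j (fun w : EuclideanSpace ℝ (Fin (d + 1)) => ((w 0 : ℝ) : ℂ)) w = if j = 0 then 1 else 0 :=
    fun w j => by
      rw [pd_coord (fun t : ℝ => (t : ℂ)) (hid _).differentiableAt, (hid _).deriv]
  have hY : ∀ i, (fun w => collarFlux (H w) (w 0) (fun j => pdW S j
      (fun w : EuclideanSpace ℝ (Fin (d + 1)) => ((w 0 : ℝ) : ℂ)) w) i) =ᶠ[𝓝 z]
      fun w => if i = 0 then (w 0 : ℂ) ^ 2 * ((√(H w).det : ℝ) : ℂ) else 0 := fun i => by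
    filter_upwards [hSe] with w hw
    simp only [pdW_eq_pd hw, hpdx, collarFlux]
    refine Fin.cases ?_ (fun i => ?_) i
    · simp [mul_comm]
    · simp [Fin.succ_ne_zero]
  rw [lapE_collarGram hS hz hH hdet (contDiff_coord_complex 0).contDiffAt]
  simp only [collarLap, pdW_eq_pd hS, hpdx, collarLogDeriv, pd_congr (hY _)]
  rw [Fin.sum_univ_succ]
  have hωd : DifferentiableAt ℝ (fun w => ((√(H w).det : ℝ) : ℂ)) z :=
    (contDiffAt_complex_ofReal (ContDiffWithinAt.contDiffAt (contDiffWithinAt_sqrt_det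
      (fun i j => hH i j z (mem_of_mem_nhds hS)) (hdet z (mem_of_mem_nhds hS))) hS)).differentiableAt
        (by simp)
  have hsq : HasDerivAt (fun t : ℝ => (t : ℂ) ^ 2) (2 * (z 0 : ℂ)) (z 0) := by
    have := (hid (z 0)).fun_pow 2
    convert! this using 1
    simp
  have h2 : pd 0 (fun w : EuclideanSpace ℝ (Fin (d + 1)) =>
      (w 0 : ℂ) ^ 2 * ((√(H w).det : ℝ) : ℂ)) z =
      (z 0 : ℂ) ^ 2 * pd 0 (fun w => ((√(H w).det : ℝ) : ℂ)) z +
        ((√(H z).det : ℝ) : ℂ) * (2 * (z 0 : ℂ)) := by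
    rw [pd_mul ((contDiff_coord_complex 0).contDiffAt.pow 2 |>.differentiableAt (by simp)) hωd,
      pd_coord (fun t : ℝ => (t : ℂ) ^ 2) hsq.differentiableAt, hsq.deriv]
    simp
  have h3 : ∀ i : Fin d, pd i.succ (fun w : EuclideanSpace ℝ (Fin (d + 1)) => (0 : ℂ)) z = 0 :=
    fun i => by simp [pd]
  simp only [Fin.succ_ne_zero, if_true, if_false, h2, h3]
  simp only [Finset.sum_const_zero, add_zero]
  push_cast
  field_simp
  ring

/-- The Laplacian of a product with a function of `x`. -/
theorem lapE_collarGram_mul (hS : S ∈ 𝓝 z) (hz : 0 < z 0)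
    (hH : ∀ i j, ContDiffOn ℝ ∞ (fun w => H w i j) S) (hdet : ∀ w ∈ S, 0 < (H w).det)
    {f : EuclideanSpace ℝ (Fin (d + 1)) → ℂ} (hf : ContDiffAt ℝ ∞ f z)
    {φ : ℝ → ℂ} (hφ : ContDiffOn ℝ ∞ φ (Ioi 0)) :
    lapE (collarGram H) (fun w => φ (w 0) * f w) z =
      φ (z 0) * lapE (collarGram H) f z - 2 * (z 0 : ℂ) ^ 4 * deriv φ (z 0) * pd 0 f z
        - (z 0 : ℂ) ^ 4 * deriv (deriv φ) (z 0) * f z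
        + deriv φ (z 0) * ((d - 2) * (z 0 : ℂ) ^ 3 - (z 0 : ℂ) ^ 4 * collarLogDeriv H S z) *
          f z := by
  have hG := smoothMetricAt_collarGram hS hz hH hdet
  have hHz := (hdet z (mem_of_mem_nhds hS)).ne'
  have hφ' : ContDiffOn ℝ ∞ (deriv φ) (Ioi 0) := hφ.deriv_of_isOpen isOpen_Ioi (by norm_cast)
  have hat : ∀ {χ : ℝ → ℂ}, ContDiffOn ℝ ∞ χ (Ioi 0) → ∀ t : ℝ, 0 < t → DifferentiableAt ℝ χ t :=
    fun hχ t ht => (hχ.contDiffAt (Ioi_mem_nhds ht)).differentiableAt (by simp)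
  have hze : ∀ᶠ w : EuclideanSpace ℝ (Fin (d + 1)) in 𝓝 z, 0 < w 0 :=
    (contDiff_coord 0).continuous.continuousAt.eventually (lt_mem_nhds hz)
  have hφz : ContDiffAt ℝ ∞ (fun w : EuclideanSpace ℝ (Fin (d + 1)) => φ (w 0)) z :=
    (hφ.contDiffAt (Ioi_mem_nhds hz)).comp z (contDiff_coord 0).contDiffAt
  have hφ'z : ContDiffAt ℝ ∞ (fun w : EuclideanSpace ℝ (Fin (d + 1)) => deriv φ (w 0)) z :=
    ContDiffAt.comp (g := deriv φ) z (hφ'.contDiffAt (Ioi_mem_nhds hz)) (contDiff_coord 0).contDiffAt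
  have hx : ContDiffAt ℝ ∞ (fun w : EuclideanSpace ℝ (Fin (d + 1)) => ((w 0 : ℝ) : ℂ)) z :=
    (contDiff_coord_complex 0).contDiffAt
  have hid : ∀ t : ℝ, HasDerivAt (fun t : ℝ => (t : ℂ)) 1 t := fun t =>
    Complex.ofRealCLM.hasDerivAt
  have hpdx : ∀ w : EuclideanSpace ℝ (Fin (d + 1)), ∀ j,
      pd j (fun w : EuclideanSpace ℝ (Fin (d + 1)) => ((w 0 : ℝ) : ℂ)) w = if j = 0 then 1 else 0 :=
    fun w j => by
      rw [pd_coord (fun t : ℝ => (t : ℂ)) (hid _).differentiableAt, (hid _).deriv]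
  have hfl : ∀ i, flux (collarGram H) (fun w => φ (w 0)) i =ᶠ[𝓝 z]
      fun w => deriv φ (w 0) * flux (collarGram H) (fun w => ((w 0 : ℝ) : ℂ)) i w := fun i => by
    filter_upwards [hze] with w hw
    simp only [flux, hpdx, pd_coord φ (hat hφ _ hw)]
    simp
    ring
  have hpd : ∀ i, pd i (flux (collarGram H) (fun w => φ (w 0)) i) z =
      deriv φ (z 0) * pd i (flux (collarGram H) (fun w => ((w 0 : ℝ) : ℂ)) i) z +
      flux (collarGram H) (fun w => ((w 0 : ℝ) : ℂ)) i z *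
        (if i = 0 then deriv (deriv φ) (z 0) else 0) := fun i => by
    rw [pd_congr (hfl i), pd_mul (hφ'z.differentiableAt (by simp))
      ((contDiffAt_flux hG hx i).differentiableAt (by simp)), pd_coord _ (hat hφ' _ hz)]
  have h0 : (z 0 : ℂ) ≠ 0 := by exact_mod_cast hz.ne'
  have hω : ((√(H z).det : ℝ) : ℂ) ≠ 0 := by
    exact_mod_cast (Real.sqrt_pos.2 (hdet z (mem_of_mem_nhds hS))).ne'
  -- Second-order chain rule, with g⁰⁰ = x⁴ as the square of the length of dx.
  have hlapφ : lapE (collarGram H) (fun w => φ (w 0)) z =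
      deriv φ (z 0) * lapE (collarGram H) (fun w => ((w 0 : ℝ) : ℂ)) z -
        (z 0 : ℂ) ^ 4 * deriv (deriv φ) (z 0) := by
    simp only [lapE, hpd, Finset.sum_add_distrib, ← Finset.mul_sum]
    simp only [mul_ite, mul_zero, Finset.sum_ite_eq', Finset.mem_univ, if_true]
    have : flux (collarGram H) (fun w => ((w 0 : ℝ) : ℂ)) 0 z =
        ((√(collarGram H z).det : ℝ) : ℂ) * (z 0 : ℂ) ^ 4 := by
      simp only [flux, hpdx, collarGram_inv hz hHz]
      simp
    rw [this]
    have hs : ((√(collarGram H z).det : ℝ) : ℂ) ≠ 0 := by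
      exact_mod_cast (Real.sqrt_pos.2 hG.det_pos).ne'
    push_cast
    field_simp
    ring
  rw [lapE_mul hG hφz hf, gradE_coord_left hz hHz (hat hφ _ hz),
    gradE_coord_right hz hHz (hat hφ _ hz), hlapφ, lapE_collarGram_coord hS hz hH hdet]
  ring

end CollarE

end

section

/-! ### Parametrizations of the interior -/

/-- The coordinate space of a manifold with boundary of dimension `d + 1`. -/
abbrev Coord (d : ℕ) := EuclideanSpace ℝ (Fin (d + 1))

section Param

variable {d : ℕ}
  {X : Type*} [TopologicalSpace X] [ChartedSpace (EuclideanHalfSpace (d + 1)) X]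

/-- A parametrization `κ`, with inverse `ι`, of an open subset of the interior of `X` by an open
subset `W` of Euclidean space. -/
structure Param (d : ℕ) (X : Type*) [TopologicalSpace X]
    [ChartedSpace (EuclideanHalfSpace (d + 1)) X] where
  /-- the parametrization -/
  κ : Coord d → X
  /-- the coordinates -/
  ι : X → Coord d
  /-- the parameter domain -/
  W : Set (Coord d)
  isOpen_W : IsOpen W
  κ_smooth : ContMDiffOn 𝓘(ℝ, Coord d) (𝓡∂ (d + 1)) ∞ κ W
  ι_smooth : ContMDiffOn (𝓡∂ (d + 1)) 𝓘(ℝ, Coord d) ∞ ι (κ '' W)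
  κ_int : ∀ z ∈ W, κ z ∈ (𝓡∂ (d + 1)).interior X
  ι_κ : ∀ z ∈ W, ι (κ z) = z
  isOpen_image : IsOpen (κ '' W)

namespace Param

theorem κ_ι (P : Param d X) {p : X} (hp : p ∈ P.κ '' P.W) : P.κ (P.ι p) = p := by
  obtain ⟨z, hz, rfl⟩ := hp
  rw [P.ι_κ z hz]

theorem ι_mem (P : Param d X) {p : X} (hp : p ∈ P.κ '' P.W) : P.ι p ∈ P.W := by
  obtain ⟨z, hz, rfl⟩ := hp
  rwa [P.ι_κ z hz]

theorem κ_smoothAt (P : Param d X) {z : Coord d} (hz : z ∈ P.W) :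
    ContMDiffAt 𝓘(ℝ, Coord d) (𝓡∂ (d + 1)) ∞ P.κ z :=
  P.κ_smooth.contMDiffAt (P.isOpen_W.mem_nhds hz)

theorem ι_smoothAt (P : Param d X) {p : X} (hp : p ∈ P.κ '' P.W) :
    ContMDiffAt (𝓡∂ (d + 1)) 𝓘(ℝ, Coord d) ∞ P.ι p :=
  P.ι_smooth.contMDiffAt (P.isOpen_image.mem_nhds hp)

/-- The interior part of the preferred chart at a point. -/
def chart [IsManifold (𝓡∂ (d + 1)) ∞ X] (p : X) : Param d X where
  κ := (extChartAt (𝓡∂ (d + 1)) p).symm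
  ι := extChartAt (𝓡∂ (d + 1)) p
  W := interior (extChartAt (𝓡∂ (d + 1)) p).target
  isOpen_W := isOpen_interior
  κ_smooth := (contMDiffOn_extChartAt_symm p).mono interior_subset
  ι_smooth := (contMDiffOn_extChartAt (x := p)).mono <| by
    rintro _ ⟨z, hz, rfl⟩
    rw [← extChartAt_source (𝓡∂ (d + 1))]
    exact (extChartAt (𝓡∂ (d + 1)) p).map_target (interior_subset hz)
  κ_int z hz := by
    have hs := (extChartAt (𝓡∂ (d + 1)) p).map_target (interior_subset hz)
    rw [extChartAt_source] at hs
    have h := ((𝓡∂ (d + 1)).isInteriorPoint_iff_of_mem_atlas (n := ∞) (by simp)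
      (chart_mem_atlas _ p) hs).2
    refine h ?_
    change (extChartAt (𝓡∂ (d + 1)) p) ((extChartAt (𝓡∂ (d + 1)) p).symm z) ∈
      interior (extChartAt (𝓡∂ (d + 1)) p).target
    rwa [(extChartAt (𝓡∂ (d + 1)) p).right_inv (interior_subset hz)]
  ι_κ z hz := (extChartAt (𝓡∂ (d + 1)) p).right_inv (interior_subset hz)
  isOpen_image := by
    have : (extChartAt (𝓡∂ (d + 1)) p).symm '' interior (extChartAt (𝓡∂ (d + 1)) p).target =
        (extChartAt (𝓡∂ (d + 1)) p).source ∩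
          extChartAt (𝓡∂ (d + 1)) p ⁻¹' interior (extChartAt (𝓡∂ (d + 1)) p).target := by
      rw [(extChartAt (𝓡∂ (d + 1)) p).symm_image_eq_source_inter_preimage interior_subset]
    rw [this, extChartAt_source]
    exact isOpen_extChartAt_preimage (I := 𝓡∂ (d + 1)) p isOpen_interior

theorem chart_image [IsManifold (𝓡∂ (d + 1)) ∞ X] (p : X) :
    (chart (d := d) p).κ '' (chart (d := d) p).W = (chartAt (EuclideanHalfSpace (d + 1)) p).source ∩
      (𝓡∂ (d + 1)).interior X := by
  apply Subset.antisymm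
  · rintro _ ⟨z, hz, rfl⟩
    refine ⟨?_, (chart (d := d) p).κ_int z hz⟩
    rw [← extChartAt_source (𝓡∂ (d + 1))]
    exact (extChartAt (𝓡∂ (d + 1)) p).map_target (interior_subset hz)
  · rintro q ⟨hq, hqi⟩
    have h := ((𝓡∂ (d + 1)).isInteriorPoint_iff_of_mem_atlas (n := ∞) (by simp)
      (chart_mem_atlas _ p) hq).1 hqi
    refine ⟨extChartAt (𝓡∂ (d + 1)) p q, h, ?_⟩
    exact (extChartAt (𝓡∂ (d + 1)) p).left_inv (by rwa [extChartAt_source])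

theorem mem_chart_image [IsManifold (𝓡∂ (d + 1)) ∞ X] {p : X}
    (hp : p ∈ (𝓡∂ (d + 1)).interior X) : p ∈ (chart (d := d) p).κ '' (chart (d := d) p).W := by
  rw [chart_image]
  exact ⟨mem_chart_source _ p, hp⟩

end Param

/-- The differential of a map from Euclidean space to `X`, as a linear map between the model
spaces. -/
def dPlain (κ : Coord d → X) (z : Coord d) : Coord d →L[ℝ] Coord d :=
  mfderiv 𝓘(ℝ, Coord d) (𝓡∂ (d + 1)) κ z

theorem dPlain_congr {κ κ' : Coord d → X} {z : Coord d} (h : κ =ᶠ[𝓝 z] κ') :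
    dPlain κ z = dPlain κ' z := h.mfderiv_eq

theorem dPlain_comp {κ : Coord d → X} {τ : Coord d → Coord d} {z : Coord d}
    (hκ : ContMDiffAt 𝓘(ℝ, Coord d) (𝓡∂ (d + 1)) ∞ κ (τ z)) (hτ : ContDiffAt ℝ ∞ τ z) :
    dPlain (fun w => κ (τ w)) z = (dPlain κ (τ z)).comp (fderiv ℝ τ z) := by
  have h := mfderiv_comp z (hκ.mdifferentiableAt (by simp))
    (hτ.contMDiffAt.mdifferentiableAt (by simp))
  rw [mfderiv_eq_fderiv] at h
  exact h

namespace Param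

variable (P Q : Param d X)

/-- The transition map between two parametrizations. -/
def trans (z : Coord d) : Coord d := Q.ι (P.κ z)

variable {P Q}

theorem overlap_nhds {z : Coord d} (hz : z ∈ P.W) (hQ : P.κ z ∈ Q.κ '' Q.W) :
    ∀ᶠ w in 𝓝 z, w ∈ P.W ∧ P.κ w ∈ Q.κ '' Q.W :=
  (P.isOpen_W.eventually_mem hz).and <|
    (P.κ_smoothAt hz).continuousAt.eventually (Q.isOpen_image.mem_nhds hQ)

theorem trans_mem {z : Coord d} (hQ : P.κ z ∈ Q.κ '' Q.W) : P.trans Q z ∈ Q.W := Q.ι_mem hQ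

theorem κ_trans {z : Coord d} (hQ : P.κ z ∈ Q.κ '' Q.W) : Q.κ (P.trans Q z) = P.κ z := Q.κ_ι hQ

theorem trans_trans {z : Coord d} (hz : z ∈ P.W) (hQ : P.κ z ∈ Q.κ '' Q.W) :
    Q.trans P (P.trans Q z) = z := by
  rw [trans, κ_trans hQ, P.ι_κ z hz]

theorem contDiffAt_trans {z : Coord d} (hz : z ∈ P.W) (hQ : P.κ z ∈ Q.κ '' Q.W) :
    ContDiffAt ℝ ∞ (P.trans Q) z :=
  (ContMDiffAt.comp z (Q.ι_smoothAt hQ) (P.κ_smoothAt hz)).contDiffAt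

theorem jac_comp {n : ℕ} {σ τ : EuclideanSpace ℝ (Fin n) → EuclideanSpace ℝ (Fin n)}
    {z : EuclideanSpace ℝ (Fin n)} (hσ : DifferentiableAt ℝ σ (τ z))
    (hτ : DifferentiableAt ℝ τ z) :
    jac (fun w => σ (τ w)) z = jac σ (τ z) * jac τ z := by
  ext i j
  have h := pd_comp (f := fun w => σ w) hσ hτ j
  simp only [pd] at h
  rw [Matrix.mul_apply]
  simp only [jac, Matrix.of_apply, h]
  simp [mul_comm]

/-- By the chain rule, the Jacobians of the two mutually inverse transition maps multiply to the
identity. -/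
theorem jac_trans_det_ne_zero {z : Coord d} (hz : z ∈ P.W) (hQ : P.κ z ∈ Q.κ '' Q.W) :
    (jac (P.trans Q) z).det ≠ 0 := by
  have hP : Q.κ (P.trans Q z) ∈ P.κ '' P.W := by
    rw [κ_trans hQ]
    exact mem_image_of_mem _ hz
  have h1 := jac_comp (σ := Q.trans P) (τ := P.trans Q) (z := z)
    ((contDiffAt_trans (trans_mem hQ) hP).differentiableAt (by simp))
    ((contDiffAt_trans hz hQ).differentiableAt (by simp))
  have h2 : jac (fun w => Q.trans P (P.trans Q w)) z = 1 := by
    have : (fun w => Q.trans P (P.trans Q w)) =ᶠ[𝓝 z] id := by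
      filter_upwards [overlap_nhds hz hQ] with w hw using trans_trans hw.1 hw.2
    ext i j
    simp only [jac, Matrix.of_apply, this.fderiv_eq, fderiv_id]
    simp [Matrix.one_apply]
  intro h3
  have h4 := congrArg Matrix.det h1
  rw [h2, Matrix.det_mul, h3] at h4
  simp at h4

end Param

end Param

/-! ### The metric and the Laplacian in arbitrary parametrizations. -/

section Gram

variable {d : ℕ}
  {X : Type*} [TopologicalSpace X] [ChartedSpace (EuclideanHalfSpace (d + 1)) X]
  [IsManifold (𝓡∂ (d + 1)) ∞ X]
  {M : Type*} [TopologicalSpace M] [ChartedSpace (EuclideanSpace ℝ (Fin d)) M]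
  [IsManifold (𝓡 d) ∞ M]
  {D : ProductDecomposition d X M} (G : ScatteringMetric D)

/-- The metric, as a bilinear form on the model space. -/
def gPlain (p : X) : Coord d →L[ℝ] Coord d →L[ℝ] ℝ := G.g p

/-- The Gram matrix of the metric with respect to a map from Euclidean space. -/
def gramOf (κ : Coord d → X) (z : Coord d) : Matrix (Fin (d + 1)) (Fin (d + 1)) ℝ :=
  Matrix.of fun i j => gPlain G (κ z) (dPlain κ z (EuclideanSpace.single i (1 : ℝ)))
    (dPlain κ z (EuclideanSpace.single j (1 : ℝ)))

theorem gramOf_congr {κ κ' : Coord d → X} {z : Coord d} (h : κ =ᶠ[𝓝 z] κ') :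
    gramOf G κ z = gramOf G κ' z := by
  simp only [gramOf, dPlain_congr h, h.eq_of_nhds]

theorem gramOf_comp {κ : Coord d → X} {τ : Coord d → Coord d} {z : Coord d}
    (hκ : ContMDiffAt 𝓘(ℝ, Coord d) (𝓡∂ (d + 1)) ∞ κ (τ z)) (hτ : ContDiffAt ℝ ∞ τ z) :
    gramOf G (fun w => κ (τ w)) z = (jac τ z).transpose * gramOf G κ (τ z) * jac τ z := by
  have hcol : ∀ i, fderiv ℝ τ z (EuclideanSpace.single i (1 : ℝ)) =
      ∑ k, jac τ z k i • EuclideanSpace.single k (1 : ℝ) := fun i =>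
    euclidean_sum_single _
  ext i j
  simp only [gramOf, Matrix.of_apply, dPlain_comp hκ hτ, ContinuousLinearMap.comp_apply, hcol,
    map_sum, map_smul, sum_apply, smul_apply, smul_eq_mul, Matrix.mul_apply,
    Matrix.transpose_apply, Finset.sum_mul, Finset.mul_sum]
  exact Finset.sum_congr rfl fun k _ => Finset.sum_congr rfl fun l _ => by ring

theorem gramOf_trans {P Q : Param d X} {z : Coord d} (hz : z ∈ P.W)
    (hQ : P.κ z ∈ Q.κ '' Q.W) :
    gramOf G P.κ z =
      (jac (P.trans Q) z).transpose * gramOf G Q.κ (P.trans Q z) * jac (P.trans Q) z := by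
  rw [← gramOf_comp G (Q.κ_smoothAt (P.trans_mem hQ)) (P.contDiffAt_trans hz hQ)]
  refine gramOf_congr G ?_
  filter_upwards [P.overlap_nhds hz hQ] with w hw using (P.κ_trans hw.2).symm

theorem dPlain_injective (P : Param d X) {z : Coord d} (hz : z ∈ P.W) :
    Function.Injective (dPlain P.κ z) := by
  have h := mfderiv_comp z
    ((P.ι_smoothAt (mem_image_of_mem _ hz)).mdifferentiableAt (by simp))
    ((P.κ_smoothAt hz).mdifferentiableAt (by simp))
  have h2 : P.ι ∘ P.κ =ᶠ[𝓝 z] id := by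
    filter_upwards [P.isOpen_W.eventually_mem hz] with w hw using P.ι_κ w hw
  rw [h2.mfderiv_eq, mfderiv_id] at h
  intro v w hvw
  have hv := congrArg (fun L : Coord d →L[ℝ] Coord d => L v) h
  have hw := congrArg (fun L : Coord d →L[ℝ] Coord d => L w) h
  change v = mfderiv (𝓡∂ (d + 1)) 𝓘(ℝ, Coord d) P.ι (P.κ z) (dPlain P.κ z v) at hv
  change w = mfderiv (𝓡∂ (d + 1)) 𝓘(ℝ, Coord d) P.ι (P.κ z) (dPlain P.κ z w) at hw
  rw [hv, hw, hvw]

theorem gramOf_posDef (P : Param d X) {z : Coord d} (hz : z ∈ P.W) :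
    (gramOf G P.κ z).PosDef := by
  refine Matrix.PosDef.of_dotProduct_mulVec_pos ?_ fun x hx => ?_
  · ext i j
    simp only [gramOf, Matrix.conjTranspose_apply, Matrix.of_apply, star_trivial]
    exact G.g_symm _ (P.κ_int z hz) _ _
  · have h1 : star x ⬝ᵥ (gramOf G P.κ z).mulVec x =
        gPlain G (P.κ z) (dPlain P.κ z (WithLp.toLp 2 x)) (dPlain P.κ z (WithLp.toLp 2 x)) := by
      have hx : (WithLp.toLp 2 x : Coord d) = ∑ k, x k • EuclideanSpace.single k (1 : ℝ) :=
        euclidean_sum_single _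
      rw [hx]
      simp only [map_sum, map_smul, sum_apply, smul_apply, smul_eq_mul, dotProduct, Matrix.mulVec,
        star_trivial, gramOf, Matrix.of_apply, Finset.mul_sum]
      rw [Finset.sum_comm]
      exact Finset.sum_congr rfl fun k _ => Finset.sum_congr rfl fun l _ => by ring
    rw [h1]
    refine G.g_pos _ (P.κ_int z hz) _ fun h => hx ?_
    have h2 : dPlain P.κ z (WithLp.toLp 2 x) = dPlain P.κ z 0 := by
      rw [map_zero]; exact h
    have h3 := dPlain_injective P hz h2
    simpa using congrArg WithLp.ofLp h3

/-- The vector field along κ is the image of a constant section under the tangent map, which is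
smooth. -/
theorem contMDiffOn_dPlain {κ : Coord d → X} {W : Set (Coord d)} (hW : IsOpen W)
    (hκ : ContMDiffOn 𝓘(ℝ, Coord d) (𝓡∂ (d + 1)) ∞ κ W) (e : Coord d) :
    ContMDiffOn 𝓘(ℝ, Coord d) ((𝓡∂ (d + 1)).prod 𝓘(ℝ, Coord d)) ∞
      (fun z => Bundle.TotalSpace.mk' (Coord d) (E := TangentSpace (𝓡∂ (d + 1)))
        (κ z) (dPlain κ z e)) W := by
  have h1 := hκ.contMDiffOn_tangentMapWithin (m := ∞) (by norm_cast) hW.uniqueMDiffOn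
  have h2 : ContMDiffOn 𝓘(ℝ, Coord d) 𝓘(ℝ, Coord d).tangent ∞
      (fun z => (⟨z, e⟩ : TangentBundle 𝓘(ℝ, Coord d) (Coord d))) W := by
    intro z hz
    refine (Bundle.contMDiffWithinAt_section (F := Coord d)
      (E := TangentSpace 𝓘(ℝ, Coord d)) (s := fun _ => e)).2 ?_
    simp only [trivializationAt_model_space_apply]
    exact contMDiffWithinAt_const
  have h3 := h1.comp h2 (fun z hz => hz)
  refine h3.congr fun z hz => ?_
  simp only [Function.comp, tangentMapWithin, mfderivWithin_of_mem_nhds (hW.mem_nhds hz)]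
  rfl

theorem contDiffOn_gramOf (P : Param d X) (i j : Fin (d + 1)) :
    ContDiffOn ℝ ∞ (fun z => gramOf G P.κ z i j) P.W := by
  have hg := G.g_smooth.comp P.κ_smooth P.κ_int
  have h := ContMDiffOn.clm_bundle_apply₂ (F₁ := Coord d) (F₂ := Coord d) (F₃ := ℝ)
    (E₁ := TangentSpace (𝓡∂ (d + 1))) (E₂ := TangentSpace (𝓡∂ (d + 1)))
    (E₃ := Bundle.Trivial X ℝ) (b := P.κ) (ψ := fun z => G.g (P.κ z)) hg
    (contMDiffOn_dPlain P.isOpen_W P.κ_smooth (EuclideanSpace.single i (1 : ℝ)))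
    (contMDiffOn_dPlain P.isOpen_W P.κ_smooth (EuclideanSpace.single j (1 : ℝ)))
  intro z hz
  have h2 := (Bundle.contMDiffWithinAt_totalSpace.1 (h z hz)).2
  exact h2.contDiffWithinAt

theorem smoothMetricAt_gramOf (P : Param d X) {z : Coord d} (hz : z ∈ P.W) :
    SmoothMetricAt (gramOf G P.κ) z :=
  ⟨fun i j => (contDiffOn_gramOf G P i j).contDiffAt (P.isOpen_W.mem_nhds hz),
    (gramOf_posDef G P hz).det_pos⟩

theorem gram_eq_gramOf (p : X) {z : Coord d} (hz : z ∈ (Param.chart (d := d) p).W) :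
    G.gram p z = gramOf G (Param.chart (d := d) p).κ z := by
  have hr : range (𝓡∂ (d + 1)) ∈ 𝓝 z := mem_of_superset
    (mem_interior_iff_mem_nhds.1 hz) (extChartAt_target_subset_range p)
  ext i j
  simp only [ScatteringMetric.gram, gramOf, Matrix.of_apply, ScatteringMetric.coordVec,
    mfderivWithin_of_mem_nhds hr]
  rfl

/-- The Laplacian in an arbitrary parametrization. -/
theorem laplacian_param (P : Param d X) {f : X → ℂ} {z : Coord d} (hz : z ∈ P.W)
    (hf : ContMDiffAt (𝓡∂ (d + 1)) 𝓘(ℝ, ℂ) ∞ f (P.κ z)) :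
    G.laplacian f (P.κ z) = lapE (gramOf G P.κ) (fun w => f (P.κ w)) z := by
  set Q := Param.chart (d := d) (P.κ z) with hQdef
  have hQ : P.κ z ∈ Q.κ '' Q.W := Param.mem_chart_image (P.κ_int z hz)
  -- The value of the Laplacian at a point is defined by the preferred chart at that same point, so
  -- it is literally `lapE` at the image under the transition map.
  have h1 : G.laplacian f (P.κ z) = lapE (G.gram (P.κ z)) (fun w => f (Q.κ w)) (P.trans Q z) := rfl
  have hτ := P.trans_mem hQ
  have h2 : G.gram (P.κ z) =ᶠ[𝓝 (P.trans Q z)] gramOf G Q.κ := by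
    filter_upwards [Q.isOpen_W.mem_nhds hτ] with w hw using gram_eq_gramOf G _ hw
  rw [h1, lapE_congr h2 EventuallyEq.rfl]
  refine (lapE_comp (P.contDiffAt_trans hz hQ) (P.jac_trans_det_ne_zero hz hQ)
    (smoothMetricAt_gramOf G Q hτ) ?_ ?_ ?_).2.symm
  · have h3 : ContMDiffAt (𝓡∂ (d + 1)) 𝓘(ℝ, ℂ) ∞ f (Q.κ (P.trans Q z)) := by
      rwa [P.κ_trans hQ]
    exact (h3.comp _ (Q.κ_smoothAt hτ)).contDiffAt
  · filter_upwards [P.overlap_nhds hz hQ] with w hw using gramOf_trans G hw.1 hw.2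
  · filter_upwards [P.overlap_nhds hz hQ] with w hw
    rw [P.κ_trans hw.2]

/-- The definition changes chart from point to point. Smoothness becomes visible once
`laplacian_param` rewrites all nearby values in one fixed chart. -/
theorem contMDiffOn_laplacian {f : X → ℂ}
    (hf : ContMDiffOn (𝓡∂ (d + 1)) 𝓘(ℝ, ℂ) ∞ f ((𝓡∂ (d + 1)).interior X)) :
    ContMDiffOn (𝓡∂ (d + 1)) 𝓘(ℝ, ℂ) ∞ (G.laplacian f) ((𝓡∂ (d + 1)).interior X) := by
  have ho : IsOpen ((𝓡∂ (d + 1)).interior X) :=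
    (𝓡∂ (d + 1)).isOpen_interior (n := ∞) (by simp)
  intro q hq
  set P := Param.chart (d := d) q
  have hqP : q ∈ P.κ '' P.W := Param.mem_chart_image hq
  have h1 : ContDiffAt ℝ ∞ (lapE (gramOf G P.κ) (fun w => f (P.κ w))) (P.ι q) := by
    refine contDiffAt_lapE (smoothMetricAt_gramOf G P (P.ι_mem hqP)) ?_
    have h2 : ContMDiffAt (𝓡∂ (d + 1)) 𝓘(ℝ, ℂ) ∞ f (P.κ (P.ι q)) := by
      rw [P.κ_ι hqP]
      exact hf.contMDiffAt (ho.mem_nhds hq)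
    exact (h2.comp _ (P.κ_smoothAt (P.ι_mem hqP))).contDiffAt
  have h3 : ContMDiffAt (𝓡∂ (d + 1)) 𝓘(ℝ, ℂ) ∞
      (fun p => lapE (gramOf G P.κ) (fun w => f (P.κ w)) (P.ι p)) q :=
    ContMDiffAt.comp q h1.contMDiffAt (P.ι_smoothAt hqP)
  refine (h3.congr_of_eventuallyEq ?_).contMDiffWithinAt
  filter_upwards [P.isOpen_image.mem_nhds hqP] with p hp
  have hp' : p ∈ (𝓡∂ (d + 1)).interior X := by
    obtain ⟨z, hz, rfl⟩ := hp
    exact P.κ_int z hz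
  have h4 := laplacian_param G P (P.ι_mem hp) (f := f) (by
    rw [P.κ_ι hp]; exact hf.contMDiffAt (ho.mem_nhds hp'))
  rwa [P.κ_ι hp] at h4

theorem laplacian_congr {f f' : X → ℂ} {p : X} (h : f =ᶠ[𝓝 p] f') :
    G.laplacian f p = G.laplacian f' p := by
  refine lapE_congr (Gm := G.gram p) EventuallyEq.rfl ?_
  have h1 := continuousAt_extChartAt_symm (I := 𝓡∂ (d + 1)) p
  have h2 : f =ᶠ[𝓝 ((extChartAt (𝓡∂ (d + 1)) p).symm (extChartAt (𝓡∂ (d + 1)) p p))] f' := by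
    rwa [extChartAt_to_inv]
  exact h1.eventually h2

end Gram

end

section

/-! ### Collar coordinates -/

section TailCons

variable {d : ℕ}

/-- Forget the coordinate of index zero. -/
def tailL : Coord d →L[ℝ] EuclideanSpace ℝ (Fin d) :=
  LinearMap.toContinuousLinearMap
    { toFun := fun z => WithLp.toLp 2 fun i => z i.succ
      map_add' := fun _ _ => rfl
      map_smul' := fun _ _ => rfl }

/-- Insert a zero as the coordinate of index zero. -/
def injL : EuclideanSpace ℝ (Fin d) →L[ℝ] Coord d :=
  LinearMap.toContinuousLinearMap
    { toFun := fun y => WithLp.toLp 2 (Fin.cons 0 fun i => y i : Fin (d + 1) → ℝ)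
      map_add' := fun a b => by
        ext i
        refine Fin.cases ?_ (fun i => ?_) i <;> simp
      map_smul' := fun c a => by
        ext i
        refine Fin.cases ?_ (fun i => ?_) i <;> simp }

@[simp] theorem tailL_apply (z : Coord d) (i : Fin d) : tailL z i = z i.succ := rfl

@[simp] theorem injL_zero (y : EuclideanSpace ℝ (Fin d)) : injL y 0 = 0 := rfl

@[simp] theorem injL_succ (y : EuclideanSpace ℝ (Fin d)) (i : Fin d) : injL y i.succ = y i := rfl

/-- The point with coordinate `t` of index zero and other coordinates `y`. -/
def consE (t : ℝ) (y : EuclideanSpace ℝ (Fin d)) : Coord d :=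
  t • EuclideanSpace.single (0 : Fin (d + 1)) (1 : ℝ) + injL y

@[simp] theorem consE_zero (t : ℝ) (y : EuclideanSpace ℝ (Fin d)) : consE t y 0 = t := by
  simp [consE]

@[simp] theorem tailL_consE (t : ℝ) (y : EuclideanSpace ℝ (Fin d)) : tailL (consE t y) = y := by
  ext i
  simp [consE]

theorem consE_tailL (z : Coord d) : consE (z 0) (tailL z) = z := by
  ext i
  refine Fin.cases ?_ (fun i => ?_) i <;> simp [consE]

theorem tailL_single_zero : tailL (EuclideanSpace.single (0 : Fin (d + 1)) (1 : ℝ)) = 0 := by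
  ext i
  simp

theorem tailL_single_succ (i : Fin d) :
    tailL (EuclideanSpace.single i.succ (1 : ℝ)) = EuclideanSpace.single i (1 : ℝ) := by
  ext j
  simp

end TailCons

variable {d : ℕ}
  {X : Type*} [TopologicalSpace X] [ChartedSpace (EuclideanHalfSpace (d + 1)) X]
  [IsManifold (𝓡∂ (d + 1)) ∞ X]
  {M : Type*} [TopologicalSpace M] [ChartedSpace (EuclideanSpace ℝ (Fin d)) M]
  [IsManifold (𝓡 d) ∞ M]

namespace ProductDecomposition

variable (D : ProductDecomposition d X M)

theorem mem_interior_iff (p : X) : p ∈ (𝓡∂ (d + 1)).interior X ↔ 0 < D.x p := by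
  rw [← (𝓡∂ (d + 1)).compl_boundary, mem_compl_iff, ← D.x_eq_zero_iff]
  exact ⟨fun h => lt_of_le_of_ne (D.x_nonneg p) (Ne.symm h), fun h => h.ne'⟩

theorem x_continuous : Continuous D.x := D.x_smooth.continuous

theorem isOpen_collar (δ : ℝ) : IsOpen {p | D.x p < δ} := isOpen_Iio.preimage D.x_continuous

/-- The collar coordinate domain up to the boundary. -/
def S (m : M) : Set (Coord d) :=
  {z | 0 ≤ z 0 ∧ z 0 < D.ε ∧ tailL z ∈ (extChartAt (𝓡 d) m).target}

/-- The collar coordinate domain in the interior. -/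
def W (m : M) : Set (Coord d) :=
  {z | 0 < z 0 ∧ z 0 < D.ε ∧ tailL z ∈ (extChartAt (𝓡 d) m).target}

/-- The domain of the collar coordinates in `X`. -/
def N (m : M) : Set X :=
  {p | D.x p < D.ε ∧ D.y p ∈ (extChartAt (𝓡 d) m).source}

/-- The collar parametrization. -/
def κ (m : M) (z : Coord d) : X := D.ψ (z 0, (extChartAt (𝓡 d) m).symm (tailL z))

/-- The collar coordinates. -/
def ι (m : M) (p : X) : Coord d := consE (D.x p) (extChartAt (𝓡 d) m (D.y p))

theorem coord_continuous (i : Fin (d + 1)) : Continuous fun z : Coord d => z i :=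
  (contDiff_coord i).continuous

theorem W_subset_S (m : M) : D.W m ⊆ D.S m := fun _ h => ⟨h.1.le, h.2⟩

theorem isOpen_W (m : M) : IsOpen (D.W m) :=
  (isOpen_Ioi.preimage (coord_continuous 0)).inter <|
    (isOpen_Iio.preimage (coord_continuous 0)).inter <|
      (isOpen_extChartAt_target m).preimage tailL.continuous

theorem S_mem_nhds {m : M} {z : Coord d} (hz : z ∈ D.W m) : D.S m ∈ 𝓝 z :=
  mem_of_superset ((D.isOpen_W m).mem_nhds hz) (D.W_subset_S m)

theorem uniqueDiffOn_S (m : M) : UniqueDiffOn ℝ (D.S m) := by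
  have h1 : UniqueDiffOn ℝ {z : Coord d | 0 ≤ z 0} := by
    refine uniqueDiffOn_convex ?_ ⟨EuclideanSpace.single 0 1, ?_⟩
    · intro a ha b hb s t hs ht _
      simp only [mem_ofPred_eq, PiLp.add_apply, PiLp.smul_apply, smul_eq_mul] at *
      positivity
    · refine mem_interior.2 ⟨{z : Coord d | 0 < z 0}, fun z hz =>
        show (0 : ℝ) ≤ z 0 from le_of_lt (show (0 : ℝ) < z 0 from hz),
        isOpen_Ioi.preimage (coord_continuous 0), by simp⟩
  exact h1.inter ((isOpen_Iio.preimage (coord_continuous 0)).inter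
      ((isOpen_extChartAt_target m).preimage tailL.continuous))

theorem isOpen_N (m : M) : IsOpen (D.N m) :=
  D.y_smooth.continuousOn.isOpen_inter_preimage (D.isOpen_collar _) (isOpen_extChartAt_source m)

theorem base_smooth (m : M) : ContMDiffOn 𝓘(ℝ, Coord d) (𝓡 d) ∞
    (fun z => (extChartAt (𝓡 d) m).symm (tailL z)) (D.S m) :=
  (contMDiffOn_extChartAt_symm m).comp (tailL.contDiff.contMDiff.contMDiffOn) fun _ hz => hz.2.2

theorem pair_smooth (m : M) : ContMDiffOn 𝓘(ℝ, Coord d) (𝓘(ℝ, ℝ).prod (𝓡 d)) ∞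
    (fun z => (z 0, (extChartAt (𝓡 d) m).symm (tailL z))) (D.S m) :=
  (contDiff_coord 0).contMDiff.contMDiffOn.prodMk (D.base_smooth m)

theorem pair_mapsTo (m : M) :
    MapsTo (fun z : Coord d => (z 0, (extChartAt (𝓡 d) m).symm (tailL z))) (D.S m)
      (Ico 0 D.ε ×ˢ univ) := fun _ hz => ⟨⟨hz.1, hz.2.1⟩, mem_univ _⟩

theorem κ_smooth (m : M) : ContMDiffOn 𝓘(ℝ, Coord d) (𝓡∂ (d + 1)) ∞ (D.κ m) (D.S m) :=
  D.ψ_smooth.comp (D.pair_smooth m) (D.pair_mapsTo m)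

theorem x_κ {m : M} {z : Coord d} (hz : z ∈ D.S m) : D.x (D.κ m z) = z 0 :=
  D.x_ψ _ ⟨hz.1, hz.2.1⟩ _

theorem y_κ {m : M} {z : Coord d} (hz : z ∈ D.S m) :
    D.y (D.κ m z) = (extChartAt (𝓡 d) m).symm (tailL z) :=
  D.y_ψ _ ⟨hz.1, hz.2.1⟩ _

theorem ι_smooth (m : M) : ContMDiffOn (𝓡∂ (d + 1)) 𝓘(ℝ, Coord d) ∞ (D.ι m) (D.N m) := by
  have h1 : ContMDiffOn (𝓡∂ (d + 1)) 𝓘(ℝ, EuclideanSpace ℝ (Fin d)) ∞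
      (fun p => extChartAt (𝓡 d) m (D.y p)) (D.N m) := by
    refine (contMDiffOn_extChartAt (x := m)).comp (D.y_smooth.mono fun p hp => hp.1) fun p hp => ?_
    rw [← extChartAt_source (𝓡 d)]
    exact hp.2
  have h2 : ContMDiffOn (𝓡∂ (d + 1)) 𝓘(ℝ, Coord d) ∞
      (fun p => injL (extChartAt (𝓡 d) m (D.y p))) (D.N m) :=
    injL.contDiff.contMDiff.comp_contMDiffOn h1
  have h3 : ContMDiffOn (𝓡∂ (d + 1)) 𝓘(ℝ, Coord d) ∞
      (fun p => D.x p • EuclideanSpace.single (0 : Fin (d + 1)) (1 : ℝ)) (D.N m) :=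
    D.x_smooth.contMDiffOn.smul contMDiffOn_const
  exact h3.add h2

theorem ι_mem_S {m : M} {p : X} (hp : p ∈ D.N m) : D.ι m p ∈ D.S m := by
  refine ⟨?_, ?_, ?_⟩
  · simp [ι, D.x_nonneg]
  · simpa [ι] using hp.1
  · simpa [ι] using (extChartAt (𝓡 d) m).map_source hp.2

theorem ι_mem_W {m : M} {p : X} (hp : p ∈ D.N m) (h : 0 < D.x p) : D.ι m p ∈ D.W m :=
  ⟨by simpa [ι] using h, (D.ι_mem_S hp).2⟩

theorem κ_ι {m : M} {p : X} (hp : p ∈ D.N m) : D.κ m (D.ι m p) = p := by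
  simp only [κ, ι, consE_zero, tailL_consE]
  rw [(extChartAt (𝓡 d) m).left_inv hp.2, D.ψ_left p hp.1]

theorem ι_κ {m : M} {z : Coord d} (hz : z ∈ D.S m) : D.ι m (D.κ m z) = z := by
  rw [ι, D.x_κ hz, D.y_κ hz, (extChartAt (𝓡 d) m).right_inv hz.2.2, consE_tailL]

theorem κ_mem_N {m : M} {z : Coord d} (hz : z ∈ D.S m) : D.κ m z ∈ D.N m := by
  refine ⟨by rw [D.x_κ hz]; exact hz.2.1, ?_⟩
  rw [D.y_κ hz]
  exact (extChartAt (𝓡 d) m).map_target hz.2.2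

theorem κ_image (m : M) : D.κ m '' D.W m = D.N m ∩ {p | 0 < D.x p} := by
  apply Subset.antisymm
  · rintro _ ⟨z, hz, rfl⟩
    refine ⟨D.κ_mem_N (D.W_subset_S m hz), ?_⟩
    rw [mem_ofPred_eq, D.x_κ (D.W_subset_S m hz)]
    exact hz.1
  · rintro p ⟨hp, h⟩
    exact ⟨_, D.ι_mem_W hp h, D.κ_ι hp⟩

/-- The collar coordinates as a parametrization of the interior. -/
def param (m : M) : Param d X where
  κ := D.κ m
  ι := D.ι m
  W := D.W m
  isOpen_W := D.isOpen_W m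
  κ_smooth := (D.κ_smooth m).mono (D.W_subset_S m)
  ι_smooth := (D.ι_smooth m).mono <| by
    rw [D.κ_image]
    exact inter_subset_left
  κ_int z hz := by
    rw [D.mem_interior_iff, D.x_κ (D.W_subset_S m hz)]
    exact hz.1
  ι_κ z hz := D.ι_κ (D.W_subset_S m hz)
  isOpen_image := by
    rw [D.κ_image]
    exact (D.isOpen_N m).inter (isOpen_Ioi.preimage D.x_continuous)

theorem mem_N_self {p : X} (hp : D.x p < D.ε) : p ∈ D.N (D.y p) := ⟨hp, mem_extChartAt_source _⟩

/-- A function on the interior that is smooth in the interior, and smooth up to the boundary in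
all collar coordinates, extends to a smooth function. -/
theorem exists_smooth_extension [T2Space X] [CompactSpace X] {F : X → ℂ}
    (hF : ContMDiffOn (𝓡∂ (d + 1)) 𝓘(ℝ, ℂ) ∞ F {p | 0 < D.x p})
    (hS : ∀ m : M, ∃ Φ : Coord d → ℂ, ContDiffOn ℝ ∞ Φ (D.S m) ∧
      ∀ z ∈ D.W m, F (D.κ m z) = Φ z) :
    ∃ b : ScatteringMetric.Smooth d X, ∀ p, 0 < D.x p → F p = b p := by
  have ho : IsOpen {p | 0 < D.x p} := isOpen_Ioi.preimage D.x_continuous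
  -- Prescribing `F` in the interior and nothing on the boundary is a convex condition on the value
  -- at each point, so local extensions can be averaged by a partition of unity.
  obtain ⟨b, hb⟩ := exists_contMDiffMap_forall_mem_convex_of_local (𝓡∂ (d + 1)) (n := (⊤ : ℕ∞))
    (t := fun p => {c : ℂ | 0 < D.x p → F p = c}) (fun p => by
      by_cases h : 0 < D.x p
      · simp only [h, true_imp_iff]
        have : {c : ℂ | F p = c} = {F p} := by ext c; simp [eq_comm]
        rw [this]
        exact convex_singleton _
      · simp only [h, false_imp_iff]
        exact convex_univ) (fun p => by
      by_cases h : 0 < D.x p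
      · exact ⟨_, ho.mem_nhds h, F, hF, fun _ _ _ => rfl⟩
      · have hx : D.x p < D.ε := lt_of_le_of_lt (not_lt.1 h) D.ε_pos
        obtain ⟨Φ, hΦ, hFΦ⟩ := hS (D.y p)
        refine ⟨_, (D.isOpen_N _).mem_nhds (D.mem_N_self hx), fun q => Φ (D.ι (D.y p) q), ?_, ?_⟩
        · exact hΦ.contMDiffOn.comp (D.ι_smooth _) fun q hq => D.ι_mem_S hq
        · intro q hq hqx
          have := hFΦ _ (D.ι_mem_W hq hqx)
          rwa [D.κ_ι hq] at this)
  exact ⟨b, hb⟩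

end ProductDecomposition

variable {D : ProductDecomposition d X M} (G : ScatteringMetric D)

/-- The boundary metrics, as bilinear forms on the model space. -/
def hPlain (t : ℝ) (m : M) :
    EuclideanSpace ℝ (Fin d) →L[ℝ] EuclideanSpace ℝ (Fin d) →L[ℝ] ℝ := G.h t m

/-- The differential of the inverse of a chart of `M`, on the model space. -/
def dBase (m : M) (y : EuclideanSpace ℝ (Fin d)) :
    EuclideanSpace ℝ (Fin d) →L[ℝ] EuclideanSpace ℝ (Fin d) :=
  mfderiv 𝓘(ℝ, EuclideanSpace ℝ (Fin d)) (𝓡 d) (extChartAt (𝓡 d) m).symm y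

/-- The Gram matrix of the boundary metrics in a chart of `M`. -/
def collarH (m : M) (z : Coord d) : Matrix (Fin d) (Fin d) ℝ :=
  Matrix.of fun i j => hPlain G (z 0) ((extChartAt (𝓡 d) m).symm (tailL z))
    (dBase m (tailL z) (EuclideanSpace.single i (1 : ℝ)))
    (dBase m (tailL z) (EuclideanSpace.single j (1 : ℝ)))

theorem contMDiffOn_dBase (m : M) (e : EuclideanSpace ℝ (Fin d)) :
    ContMDiffOn 𝓘(ℝ, EuclideanSpace ℝ (Fin d)) ((𝓡 d).prod 𝓘(ℝ, EuclideanSpace ℝ (Fin d))) ∞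
      (fun y => Bundle.TotalSpace.mk' (EuclideanSpace ℝ (Fin d)) (E := TangentSpace (𝓡 d))
        ((extChartAt (𝓡 d) m).symm y) (dBase m y e)) (extChartAt (𝓡 d) m).target := by
  have hW := isOpen_extChartAt_target (I := 𝓡 d) m
  have h1 := (contMDiffOn_extChartAt_symm (n := ∞) (I := 𝓡 d) m).contMDiffOn_tangentMapWithin
    (m := ∞) (by norm_cast) hW.uniqueMDiffOn
  have h2 : ContMDiffOn 𝓘(ℝ, EuclideanSpace ℝ (Fin d)) 𝓘(ℝ, EuclideanSpace ℝ (Fin d)).tangent ∞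
      (fun z => (⟨z, e⟩ : TangentBundle 𝓘(ℝ, EuclideanSpace ℝ (Fin d))
        (EuclideanSpace ℝ (Fin d)))) (extChartAt (𝓡 d) m).target := by
    intro z hz
    refine (Bundle.contMDiffWithinAt_section (F := EuclideanSpace ℝ (Fin d))
      (E := TangentSpace 𝓘(ℝ, EuclideanSpace ℝ (Fin d))) (s := fun _ => e)).2 ?_
    simp only [trivializationAt_model_space_apply]
    exact contMDiffWithinAt_const
  refine (h1.comp h2 (fun z hz => hz)).congr fun z hz => ?_
  simp only [Function.comp, tangentMapWithin, mfderivWithin_of_mem_nhds (hW.mem_nhds hz)]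
  rfl

theorem contDiffOn_collarH (m : M) (i j : Fin d) :
    ContDiffOn ℝ ∞ (fun z => collarH G m z i j) (D.S m) := by
  have hh := G.h_smooth.comp (D.pair_smooth m) (D.pair_mapsTo m)
  have hv := fun i : Fin d =>
    (contMDiffOn_dBase (d := d) m (EuclideanSpace.single i (1 : ℝ))).comp
      (s := D.S m) (tailL.contDiff.contMDiff.contMDiffOn) fun _ hz => hz.2.2
  have h := ContMDiffOn.clm_bundle_apply₂ (F₁ := EuclideanSpace ℝ (Fin d))
    (F₂ := EuclideanSpace ℝ (Fin d)) (F₃ := ℝ)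
    (E₁ := TangentSpace (𝓡 d)) (E₂ := TangentSpace (𝓡 d))
    (E₃ := Bundle.Trivial M ℝ) (b := fun z => (extChartAt (𝓡 d) m).symm (tailL z))
    (ψ := fun z => G.h (z 0) ((extChartAt (𝓡 d) m).symm (tailL z))) hh (hv i) (hv j)
  intro z hz
  exact (Bundle.contMDiffWithinAt_totalSpace.1 (h z hz)).2.contDiffWithinAt

theorem dBase_injective (m : M) {y : EuclideanSpace ℝ (Fin d)}
    (hy : y ∈ (extChartAt (𝓡 d) m).target) : Function.Injective (dBase m y) := by
  have hs := (extChartAt (𝓡 d) m).map_target hy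
  have hk : ContMDiffAt 𝓘(ℝ, EuclideanSpace ℝ (Fin d)) (𝓡 d) ∞ (extChartAt (𝓡 d) m).symm y :=
    (contMDiffOn_extChartAt_symm m).contMDiffAt ((isOpen_extChartAt_target m).mem_nhds hy)
  have hi : ContMDiffAt (𝓡 d) 𝓘(ℝ, EuclideanSpace ℝ (Fin d)) ∞ (extChartAt (𝓡 d) m)
      ((extChartAt (𝓡 d) m).symm y) :=
    contMDiffAt_extChartAt' (by rwa [extChartAt_source] at hs)
  have h := mfderiv_comp y (hi.mdifferentiableAt (by simp)) (hk.mdifferentiableAt (by simp))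
  have h2 : extChartAt (𝓡 d) m ∘ (extChartAt (𝓡 d) m).symm =ᶠ[𝓝 y] id := by
    filter_upwards [(isOpen_extChartAt_target m).mem_nhds hy] with w hw
      using (extChartAt (𝓡 d) m).right_inv hw
  rw [h2.mfderiv_eq, mfderiv_id] at h
  intro v w hvw
  have hv := congrArg (fun L : EuclideanSpace ℝ (Fin d) →L[ℝ] EuclideanSpace ℝ (Fin d) => L v) h
  have hw := congrArg (fun L : EuclideanSpace ℝ (Fin d) →L[ℝ] EuclideanSpace ℝ (Fin d) => L w) h
  change v = mfderiv (𝓡 d) 𝓘(ℝ, EuclideanSpace ℝ (Fin d)) (extChartAt (𝓡 d) m) _ (dBase m y v)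
    at hv
  change w = mfderiv (𝓡 d) 𝓘(ℝ, EuclideanSpace ℝ (Fin d)) (extChartAt (𝓡 d) m) _ (dBase m y w)
    at hw
  rw [hv, hw, hvw]

/-- Collar coordinates pull x back to the coordinate of index zero and y back to a chart of `M`, so
the chain rule turns `G.g_eq` into the block matrix. -/
theorem gramOf_collar (m : M) {z : Coord d} (hz : z ∈ D.W m) :
    gramOf G (D.κ m) z = collarGram (collarH G m) z := by
  have hzS := D.W_subset_S m hz
  have hx := D.x_κ hzS
  have hκ : ContMDiffAt 𝓘(ℝ, Coord d) (𝓡∂ (d + 1)) ∞ (D.κ m) z := (D.param m).κ_smoothAt hz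
  have hdx : ∀ v : Coord d, (D.dx (D.κ m z) : Coord d →L[ℝ] ℝ) (dPlain (D.κ m) z v) = v 0 := by
    intro v
    have h := mfderiv_comp z (D.x_smooth.contMDiffAt.mdifferentiableAt (by simp))
      (hκ.mdifferentiableAt (by simp))
    have h2 : D.x ∘ D.κ m =ᶠ[𝓝 z] fun w => w 0 := by
      filter_upwards [(D.isOpen_W m).mem_nhds hz] with w hw using D.x_κ (D.W_subset_S m hw)
    rw [h2.mfderiv_eq, mfderiv_eq_fderiv] at h
    have h3 := congrArg (fun L : Coord d →L[ℝ] ℝ => L v) h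
    have h4 : fderiv ℝ (fun w : Coord d => w 0) z =
        (EuclideanSpace.proj (𝕜 := ℝ) (0 : Fin (d + 1)) : Coord d →L[ℝ] ℝ) :=
      (EuclideanSpace.proj (𝕜 := ℝ) (0 : Fin (d + 1)) : Coord d →L[ℝ] ℝ).hasFDerivAt.fderiv
    change fderiv ℝ (fun w : Coord d => w 0) z v = _ at h3
    rw [h4] at h3
    exact h3.symm
  have hy : ∀ v : Coord d, (mfderiv (𝓡∂ (d + 1)) (𝓡 d) D.y (D.κ m z) :
      Coord d →L[ℝ] EuclideanSpace ℝ (Fin d)) (dPlain (D.κ m) z v) =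
      dBase m (tailL z) (tailL v) := by
    intro v
    have hyd : ContMDiffAt (𝓡∂ (d + 1)) (𝓡 d) ∞ D.y (D.κ m z) :=
      D.y_smooth.contMDiffAt ((D.isOpen_collar _).mem_nhds (by
        rw [mem_ofPred_eq, hx]; exact hz.2.1))
    have h := mfderiv_comp z (hyd.mdifferentiableAt (by simp)) (hκ.mdifferentiableAt (by simp))
    have h2 : D.y ∘ D.κ m =ᶠ[𝓝 z] (extChartAt (𝓡 d) m).symm ∘ tailL := by
      filter_upwards [(D.isOpen_W m).mem_nhds hz] with w hw using D.y_κ (D.W_subset_S m hw)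
    have hb : ContMDiffAt 𝓘(ℝ, EuclideanSpace ℝ (Fin d)) (𝓡 d) ∞ (extChartAt (𝓡 d) m).symm
        (tailL z) :=
      (contMDiffOn_extChartAt_symm m).contMDiffAt ((isOpen_extChartAt_target m).mem_nhds hz.2.2)
    have h5 := mfderiv_comp z (hb.mdifferentiableAt (by simp))
      (((tailL (d := d)).contDiff (n := ∞)).contMDiff.contMDiffAt.mdifferentiableAt (by simp))
    rw [h2.mfderiv_eq, h5, mfderiv_eq_fderiv, ContinuousLinearMap.fderiv] at h
    exact (congrArg (fun L : Coord d →L[ℝ] EuclideanSpace ℝ (Fin d) => L v) h).symm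
  have hg := G.g_eq (D.κ m z) (by rw [hx]; exact hz.1) (by rw [hx]; exact hz.2.1)
  have hyz := D.y_κ hzS
  have key : ∀ v w : Coord d, gPlain G (D.κ m z) (dPlain (D.κ m) z v) (dPlain (D.κ m) z w) =
      v 0 * w 0 / z 0 ^ 4 + hPlain G (z 0) ((extChartAt (𝓡 d) m).symm (tailL z))
        (dBase m (tailL z) (tailL v)) (dBase m (tailL z) (tailL w)) / z 0 ^ 2 := by
    intro v w
    have h1 : gPlain G (D.κ m z) (dPlain (D.κ m) z v) (dPlain (D.κ m) z w) =
      (D.dx (D.κ m z) : Coord d →L[ℝ] ℝ) (dPlain (D.κ m) z v) *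
        (D.dx (D.κ m z) : Coord d →L[ℝ] ℝ) (dPlain (D.κ m) z w) / D.x (D.κ m z) ^ 4 +
      hPlain G (D.x (D.κ m z)) (D.y (D.κ m z))
        ((mfderiv (𝓡∂ (d + 1)) (𝓡 d) D.y (D.κ m z) : Coord d →L[ℝ] EuclideanSpace ℝ (Fin d))
          (dPlain (D.κ m) z v))
        ((mfderiv (𝓡∂ (d + 1)) (𝓡 d) D.y (D.κ m z) : Coord d →L[ℝ] EuclideanSpace ℝ (Fin d))
          (dPlain (D.κ m) z w)) / D.x (D.κ m z) ^ 2 := hg _ _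
    rw [h1, hdx, hdx, hy, hy, hx, hyz]
  ext i j
  simp only [gramOf, collarGram, Matrix.of_apply, key]
  refine Fin.cases ?_ (fun i => ?_) i <;> refine Fin.cases ?_ (fun j => ?_) j <;>
    simp [tailL_single_zero, tailL_single_succ, collarH]

/-- Positivity of h is a hypothesis only at x = 0. For x > 0 it is recovered from positivity of g,
through the determinant of the block matrix. -/
theorem collarH_det_pos (m : M) {z : Coord d} (hz : z ∈ D.S m) : 0 < (collarH G m z).det := by
  rcases hz.1.eq_or_lt with h0 | h0
  · refine Matrix.PosDef.det_pos (Matrix.PosDef.of_dotProduct_mulVec_pos ?_ fun x hx => ?_)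
    · ext i j
      simp only [collarH, Matrix.conjTranspose_apply, Matrix.of_apply, star_trivial, ← h0]
      exact G.h_zero_symm _ _ _
    · have h1 : star x ⬝ᵥ (collarH G m z).mulVec x =
          hPlain G 0 ((extChartAt (𝓡 d) m).symm (tailL z)) (dBase m (tailL z) (WithLp.toLp 2 x))
            (dBase m (tailL z) (WithLp.toLp 2 x)) := by
        have hx : (WithLp.toLp 2 x : EuclideanSpace ℝ (Fin d)) =
            ∑ k, x k • EuclideanSpace.single k (1 : ℝ) := euclidean_sum_single _
        rw [hx]
        simp only [map_sum, map_smul, sum_apply, smul_apply, smul_eq_mul, dotProduct,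
          Matrix.mulVec, star_trivial, collarH, Matrix.of_apply, Finset.mul_sum, ← h0]
        rw [Finset.sum_comm]
        exact Finset.sum_congr rfl fun k _ => Finset.sum_congr rfl fun l _ => by ring
      rw [h1]
      refine G.h_zero_pos _ _ fun h => hx ?_
      have h2 : dBase m (tailL z) (WithLp.toLp 2 x) = dBase m (tailL z) 0 := by
        rw [map_zero]; exact h
      simpa using congrArg WithLp.ofLp (dBase_injective m hz.2.2 h2)
  · have hW : z ∈ D.W m := ⟨h0, hz.2⟩
    have h1 := (gramOf_posDef G (D.param m) hW).det_pos
    change 0 < (gramOf G (D.κ m) z).det at h1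
    rw [gramOf_collar G m hW, collarGram_det h0] at h1
    exact (pos_iff_pos_of_mul_pos h1).1 (by positivity)

end

section

/-! ### Linearity of the Laplacian -/

section Linear

variable {n : ℕ} {Gm : EuclideanSpace ℝ (Fin n) → Matrix (Fin n) (Fin n) ℝ}
  {f g : EuclideanSpace ℝ (Fin n) → ℂ} {z : EuclideanSpace ℝ (Fin n)}

theorem ContDiffAt_eventually_differentiableAt (hf : ContDiffAt ℝ ∞ f z) :
    ∀ᶠ w in 𝓝 z, DifferentiableAt ℝ f w :=
  ((hf.of_le (m := 1) (by norm_cast)).eventually (by simp)).mono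
    fun _ hw => hw.differentiableAt (by simp)

theorem lapE_add (h : SmoothMetricAt Gm z) (hf : ContDiffAt ℝ ∞ f z) (hg : ContDiffAt ℝ ∞ g z) :
    lapE Gm (fun w => f w + g w) z = lapE Gm f z + lapE Gm g z := by
  have h1 : ∀ i, flux Gm (fun w => f w + g w) i =ᶠ[𝓝 z]
      fun w => flux Gm f i w + flux Gm g i w := fun i => by
    filter_upwards [ContDiffAt_eventually_differentiableAt hf,
      ContDiffAt_eventually_differentiableAt hg] with w h1 h2
    simp only [flux, pd, fderiv_fun_add h1 h2, add_apply, mul_add, Finset.sum_add_distrib]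
  have hF := fun i => (contDiffAt_flux h hf i).differentiableAt (by simp)
  have hG := fun i => (contDiffAt_flux h hg i).differentiableAt (by simp)
  have h2 : ∀ i, pd i (flux Gm (fun w => f w + g w) i) z =
      pd i (flux Gm f i) z + pd i (flux Gm g i) z := fun i => by
    rw [pd_congr (h1 i)]
    simp only [pd, fderiv_fun_add (hF i) (hG i), add_apply]
  simp only [lapE, h2, Finset.sum_add_distrib, mul_add]

theorem lapE_const_mul (c : ℂ) (f : EuclideanSpace ℝ (Fin n) → ℂ) :
    lapE Gm (fun w => c * f w) z = c * lapE Gm f z := by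
  have hpd : ∀ (u : EuclideanSpace ℝ (Fin n) → ℂ) i w,
      pd i (fun w => c * u w) w = c * pd i u w := fun u i w => by
    simp only [pd]
    have : (fun w => c * u w) = c • u := rfl
    rw [this, fderiv_const_smul_field]
    rfl
  have h1 : ∀ i, flux Gm (fun w => c * f w) i = fun w => c * flux Gm f i w := fun i => by
    funext w
    simp only [flux, hpd, Finset.mul_sum]
    exact Finset.sum_congr rfl fun j _ => by ring
  simp only [lapE, h1, hpd, ← Finset.mul_sum]
  ring

theorem lapE_star (f : EuclideanSpace ℝ (Fin n) → ℂ) :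
    lapE Gm (fun w => star (f w)) z = star (lapE Gm f z) := by
  have hpd : ∀ (u : EuclideanSpace ℝ (Fin n) → ℂ) i w,
      pd i (fun w => star (u w)) w = star (pd i u w) := fun u i w => by
    simp only [pd]
    have := (Complex.conjCLE.comp_fderiv (f := u) (x := w))
    change fderiv ℝ (fun w => star (u w)) w = _ at this
    rw [this]
    rfl
  have h1 : ∀ i, flux Gm (fun w => star (f w)) i = fun w => star (flux Gm f i w) := fun i => by
    funext w
    simp only [flux, hpd]
    simp
  simp only [lapE, h1, hpd]
  simp

end Linear

/-! ### Functions smooth up to the boundary or in the interior, and the Laplacian acting on them. -/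

variable {d : ℕ}
  {X : Type*} [TopologicalSpace X] [ChartedSpace (EuclideanHalfSpace (d + 1)) X]
  [IsManifold (𝓡∂ (d + 1)) ∞ X]
  {M : Type*} [TopologicalSpace M] [ChartedSpace (EuclideanSpace ℝ (Fin d)) M]
  [IsManifold (𝓡 d) ∞ M]

namespace ProductDecomposition

variable (D : ProductDecomposition d X M)

/-- Smoothness up to the boundary. -/
def Sm (_ : ProductDecomposition d X M) (a : X → ℂ) : Prop :=
  ContMDiff (𝓡∂ (d + 1)) 𝓘(ℝ, ℂ) ∞ a

/-- Smoothness in the interior. -/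
def SmInt (a : X → ℂ) : Prop := ContMDiffOn (𝓡∂ (d + 1)) 𝓘(ℝ, ℂ) ∞ a {p | 0 < D.x p}

variable {D} {a b : X → ℂ}

theorem isOpen_pos : IsOpen {p | 0 < D.x p} := isOpen_Ioi.preimage D.x_continuous

theorem interior_eq : (𝓡∂ (d + 1)).interior X = {p | 0 < D.x p} := by
  ext p
  exact D.mem_interior_iff p

theorem contDiff_mul_complex : ContDiff ℝ ∞ (fun q : ℂ × ℂ => q.1 * q.2) :=
  contDiff_fst.mul contDiff_snd

theorem SmInt.at (ha : D.SmInt a) {p : X} (hp : 0 < D.x p) :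
    ContMDiffAt (𝓡∂ (d + 1)) 𝓘(ℝ, ℂ) ∞ a p :=
  ContMDiffOn.contMDiffAt ha (isOpen_pos.mem_nhds hp)

theorem Sm.int (ha : D.Sm a) : D.SmInt a := ContMDiff.contMDiffOn ha

theorem Sm.const (c : ℂ) : D.Sm fun _ => c := contMDiff_const

theorem Sm.add (ha : D.Sm a) (hb : D.Sm b) : D.Sm fun p => a p + b p := ContMDiff.add ha hb

theorem Sm.mul (ha : D.Sm a) (hb : D.Sm b) : D.Sm fun p => a p * b p :=
  contDiff_mul_complex.contMDiff.comp (ContMDiff.prodMk_space ha hb)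

theorem Sm.neg (ha : D.Sm a) : D.Sm fun p => -a p := by
  simpa using (Sm.const (D := D) (-1)).mul ha

theorem Sm.sub (ha : D.Sm a) (hb : D.Sm b) : D.Sm fun p => a p - b p := by
  simpa [sub_eq_add_neg] using ha.add hb.neg

theorem Sm.pow (ha : D.Sm a) (k : ℕ) : D.Sm fun p => a p ^ k := by
  induction k with
  | zero => simpa using Sm.const (D := D) 1
  | succ k ih => simpa only [pow_succ] using ih.mul ha

theorem Sm.sum {ι : Type*} {s : Finset ι} {f : ι → X → ℂ} (hf : ∀ i ∈ s, D.Sm (f i)) :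
    D.Sm fun p => ∑ i ∈ s, f i p := by
  classical
  induction s using Finset.induction_on with
  | empty => simpa using Sm.const (D := D) 0
  | insert i s hi ih =>
    simp only [Finset.sum_insert hi]
    exact (hf i (by simp)).add (ih fun j hj => hf j (by simp [hj]))

theorem Sm.comp_x {φ : ℝ → ℂ} (hφ : ContDiff ℝ ∞ φ) : D.Sm fun p => φ (D.x p) :=
  hφ.contMDiff.comp D.x_smooth

theorem Sm.x : D.Sm fun p => (D.x p : ℂ) := Sm.comp_x Complex.ofRealCLM.contDiff

theorem SmInt.add (ha : D.SmInt a) (hb : D.SmInt b) : D.SmInt fun p => a p + b p :=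
  ContMDiffOn.add ha hb

theorem SmInt.mul (ha : D.SmInt a) (hb : D.SmInt b) : D.SmInt fun p => a p * b p :=
  contDiff_mul_complex.contMDiff.comp_contMDiffOn (ContMDiffOn.prodMk_space ha hb)

theorem SmInt.sub (ha : D.SmInt a) (hb : D.SmInt b) : D.SmInt fun p => a p - b p := by
  have := ha.add ((Sm.const (D := D) (-1)).int.mul hb)
  simpa [sub_eq_add_neg] using this

theorem SmInt.comp_x {φ : ℝ → ℂ} (hφ : ContDiffOn ℝ ∞ φ (Ioi 0)) : D.SmInt fun p => φ (D.x p) :=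
  hφ.contMDiffOn.comp D.x_smooth.contMDiffOn fun _ hp => hp

theorem contDiffOn_inv_pow (k : ℕ) : ContDiffOn ℝ ∞ (fun t : ℝ => ((t : ℂ) ^ k)⁻¹) (Ioi 0) :=
  ContDiffOn.inv (Complex.ofRealCLM.contDiff.contDiffOn.pow k) fun t ht =>
    pow_ne_zero _ (by exact_mod_cast (ne_of_gt ht))

theorem SmInt.div_x (ha : D.SmInt a) (k : ℕ) : D.SmInt fun p => a p / (D.x p : ℂ) ^ k := by
  have := ha.mul (SmInt.comp_x (D := D) (contDiffOn_inv_pow k))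
  simpa [div_eq_mul_inv] using this

/-- Glue a function that is smooth in the interior with a smooth function that it agrees with near
the boundary. -/
theorem SmInt.glue (ha : D.SmInt a) (hb : D.Sm b) {δ : ℝ} (hδ : 0 < δ)
    (hab : ∀ p, 0 < D.x p → D.x p < δ → a p = b p) :
    ∃ c : X → ℂ, D.Sm c ∧ ∀ p, 0 < D.x p → a p = c p := by
  classical
  refine ⟨fun p => if 0 < D.x p then a p else b p, fun p => ?_, fun p hp => by simp [hp]⟩
  by_cases h : 0 < D.x p
  · refine (ha.at h).congr_of_eventuallyEq ?_
    filter_upwards [isOpen_pos.mem_nhds h] with q hq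
    exact if_pos hq
  · refine (hb p).congr_of_eventuallyEq ?_
    filter_upwards [(D.isOpen_collar δ).mem_nhds (lt_of_le_of_lt (not_lt.1 h) hδ)] with q hq
    by_cases h2 : 0 < D.x q
    · simp only [h2, if_true]
      exact hab q h2 hq
    · simp [h2]

/-- Continuous functions that agree in the interior agree. -/
theorem eq_of_eq_interior {Y : Type*} [TopologicalSpace Y] [T2Space Y] {f g : X → Y}
    (hf : Continuous f) (hg : Continuous g) (h : ∀ p, 0 < D.x p → f p = g p) (p : X) :
    f p = g p := by
  rcases (D.x_nonneg p).eq_or_lt with h0 | h0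
  · have hp : D.x p < D.ε := by rw [← h0]; exact D.ε_pos
    have hN := D.mem_N_self hp
    set m := D.y p
    set z := D.ι m p with hz
    have hzS : z ∈ D.S m := D.ι_mem_S hN
    have hz0 : z 0 = 0 := by simp [hz, ι, ← h0]
    -- A boundary point is approached along the normal line of the collar, where the two functions
    -- agree.
    let c : ℝ → Coord d := fun t => z + t • EuclideanSpace.single 0 1
    have hc0 : ∀ t, c t 0 = t := fun t => by simp [c, hz0]
    have hct : ∀ t, tailL (c t) = tailL z := fun t => by
      simp only [c, map_add, map_smul, tailL_single_zero]
      simp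
    have hcS : ∀ t ∈ Ico 0 D.ε, c t ∈ D.S m := fun t ht =>
      ⟨by rw [hc0]; exact ht.1, by rw [hc0]; exact ht.2, by rw [hct]; exact hzS.2.2⟩
    have hcz : c 0 = z := by simp [c]
    have hcont : Tendsto (fun t => D.κ m (c t)) (𝓝[>] 0) (𝓝 p) := by
      have h1 : ContinuousWithinAt (D.κ m) (D.S m) (c 0) := by
        rw [hcz]; exact (D.κ_smooth m).continuousOn z hzS
      have h2 : Tendsto c (𝓝[>] 0) (𝓝[D.S m] (c 0)) := by
        refine tendsto_nhdsWithin_iff.2 ⟨?_, ?_⟩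
        · exact Continuous.tendsto' (by fun_prop) 0 _ rfl |>.mono_left nhdsWithin_le_nhds
        · filter_upwards [Ioo_mem_nhdsGT D.ε_pos] with t ht using hcS t ⟨ht.1.le, ht.2⟩
      have h3 := h1.tendsto.comp h2
      rwa [hcz, D.κ_ι hN] at h3
    have hev : (fun t => f (D.κ m (c t))) =ᶠ[𝓝[>] 0] fun t => g (D.κ m (c t)) := by
      filter_upwards [Ioo_mem_nhdsGT D.ε_pos] with t ht
      refine h _ ?_
      rw [D.x_κ (hcS t ⟨ht.1.le, ht.2⟩), hc0]
      exact ht.1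
    exact tendsto_nhds_unique ((hf.tendsto p).comp hcont)
      (((hg.tendsto p).comp hcont).congr' hev.symm)
  · exact h p h0

end ProductDecomposition

open ProductDecomposition

variable {D : ProductDecomposition d X M} (G : ScatteringMetric D) {a b : X → ℂ}

theorem SmInt.laplacian (ha : D.SmInt a) : D.SmInt (G.laplacian a) := by
  have := contMDiffOn_laplacian G (f := a) (by rw [interior_eq (D := D)]; exact ha)
  rwa [interior_eq (D := D)] at this

theorem laplacian_chart (ha : D.SmInt a) {p : X} (hp : 0 < D.x p) :
    G.laplacian a p = lapE (gramOf G (Param.chart (d := d) p).κ)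
      (fun w => a ((Param.chart (d := d) p).κ w)) ((Param.chart (d := d) p).ι p) ∧
    SmoothMetricAt (gramOf G (Param.chart (d := d) p).κ) ((Param.chart (d := d) p).ι p) ∧
    ContDiffAt ℝ ∞ (fun w => a ((Param.chart (d := d) p).κ w)) ((Param.chart (d := d) p).ι p) := by
  have h1 := Param.mem_chart_image ((D.mem_interior_iff p).2 hp)
  have h2 := (Param.chart (d := d) p).ι_mem h1
  have h3 : ContMDiffAt (𝓡∂ (d + 1)) 𝓘(ℝ, ℂ) ∞ a
      ((Param.chart (d := d) p).κ ((Param.chart (d := d) p).ι p)) := by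
    rw [(Param.chart (d := d) p).κ_ι h1]
    exact ha.at hp
  have h4 := laplacian_param G (Param.chart (d := d) p) h2 h3
  rw [(Param.chart (d := d) p).κ_ι h1] at h4
  exact ⟨h4, smoothMetricAt_gramOf G _ h2,
    (h3.comp _ ((Param.chart (d := d) p).κ_smoothAt h2)).contDiffAt⟩

theorem laplacian_add (ha : D.SmInt a) (hb : D.SmInt b) {p : X} (hp : 0 < D.x p) :
    G.laplacian (fun q => a q + b q) p = G.laplacian a p + G.laplacian b p := by
  obtain ⟨h1, hm, h1'⟩ := laplacian_chart G ha hp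
  obtain ⟨h2, -, h2'⟩ := laplacian_chart G hb hp
  rw [h1, h2, (laplacian_chart G (ha.add hb) hp).1, lapE_add hm h1' h2']

theorem laplacian_const_mul (c : ℂ) (a : X → ℂ) (p : X) :
    G.laplacian (fun q => c * a q) p = c * G.laplacian a p :=
  lapE_const_mul (Gm := G.gram p) c _

theorem laplacian_star (a : X → ℂ) (p : X) :
    G.laplacian (fun q => star (a q)) p = star (G.laplacian a p) :=
  lapE_star (Gm := G.gram p) _

theorem laplacian_congr_int (h : ∀ q, 0 < D.x q → a q = b q) {p : X} (hp : 0 < D.x p) :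
    G.laplacian a p = G.laplacian b p :=
  laplacian_congr G (by filter_upwards [isOpen_pos.mem_nhds hp] with q hq using h q hq)

theorem laplacian_collar (ha : D.SmInt a) {m : M} {z : Coord d} (hz : z ∈ D.W m) :
    G.laplacian a (D.κ m z) = lapE (collarGram (collarH G m)) (fun w => a (D.κ m w)) z ∧
      ContDiffAt ℝ ∞ (fun w => a (D.κ m w)) z := by
  have h0 : 0 < D.x (D.κ m z) := by rw [D.x_κ (D.W_subset_S m hz)]; exact hz.1
  have h1 := laplacian_param G (D.param m) (f := a) hz (ha.at h0)
  refine ⟨h1.trans (lapE_congr ?_ EventuallyEq.rfl),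
    ((ha.at h0).comp _ ((D.param m).κ_smoothAt hz)).contDiffAt⟩
  filter_upwards [(D.isOpen_W m).mem_nhds hz] with w hw using gramOf_collar G m hw

theorem contDiffOn_collar (ha : D.Sm a) (m : M) : ContDiffOn ℝ ∞ (fun w => a (D.κ m w)) (D.S m) :=
  (ContMDiff.comp_contMDiffOn ha (D.κ_smooth m)).contDiffOn

variable [T2Space X] [CompactSpace X]

theorem exists_sm_extension {F : X → ℂ} (hF : D.SmInt F)
    (hS : ∀ m : M, ∃ Φ : Coord d → ℂ, ContDiffOn ℝ ∞ Φ (D.S m) ∧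
      ∀ z ∈ D.W m, F (D.κ m z) = Φ z) :
    ∃ b : X → ℂ, D.Sm b ∧ ∀ p, 0 < D.x p → F p = b p := by
  obtain ⟨b, hb⟩ := D.exists_smooth_extension hF hS
  exact ⟨b, b.contMDiff, hb⟩

/-- `Δ` maps smooth functions to `x²` times smooth functions. -/
theorem exists_laplacian_eq (ha : D.Sm a) :
    ∃ A, D.Sm A ∧ ∀ p, 0 < D.x p → G.laplacian a p = (D.x p : ℂ) ^ 2 * A p := by
  obtain ⟨A, hA, h⟩ := exists_sm_extension ((SmInt.laplacian G ha.int).div_x 2) fun m =>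
    ⟨collarLap (collarH G m) (D.S m) (fun w => a (D.κ m w)),
      contDiffOn_collarLap (D.uniqueDiffOn_S m) (contDiffOn_collarH G m)
        (fun w hw => collarH_det_pos G m hw) (contDiffOn_collar ha m), fun z hz => by
      have h0 : (z 0 : ℂ) ≠ 0 := by exact_mod_cast (ne_of_gt hz.1)
      rw [(laplacian_collar G ha.int hz).1, D.x_κ (D.W_subset_S m hz),
        lapE_collarGram (D.S_mem_nhds hz) hz.1 (contDiffOn_collarH G m)
          (fun w hw => collarH_det_pos G m hw) (laplacian_collar G ha.int hz).2]
      field_simp⟩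
  refine ⟨A, hA, fun p hp => ?_⟩
  have h0 : (D.x p : ℂ) ≠ 0 := by exact_mod_cast hp.ne'
  rw [← h p hp]
  field_simp

/-- The formula for `Δ x`. -/
theorem exists_laplacian_x :
    ∃ l, D.Sm l ∧ (∀ p, 0 < D.x p → G.laplacian (fun q => (D.x q : ℂ)) p =
      (d - 2) * (D.x p : ℂ) ^ 3 - (D.x p : ℂ) ^ 4 * l p) ∧
      ∀ m : M, ∀ z ∈ D.W m, l (D.κ m z) = collarLogDeriv (collarH G m) (D.S m) z := by
  have hx := (Sm.x (D := D)).int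
  have hkey : ∀ m : M, ∀ z ∈ D.W m, ((d - 2) * (D.x (D.κ m z) : ℂ) ^ 3 -
      G.laplacian (fun q => (D.x q : ℂ)) (D.κ m z)) / (D.x (D.κ m z) : ℂ) ^ 4 =
      collarLogDeriv (collarH G m) (D.S m) z := fun m z hz => by
    have h0 : (z 0 : ℂ) ≠ 0 := by exact_mod_cast (ne_of_gt hz.1)
    have h1 : lapE (collarGram (collarH G m)) (fun w => (D.x (D.κ m w) : ℂ)) z =
        lapE (collarGram (collarH G m)) (fun w => ((w 0 : ℝ) : ℂ)) z := by
      refine lapE_congr EventuallyEq.rfl ?_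
      filter_upwards [(D.isOpen_W m).mem_nhds hz] with w hw
      rw [D.x_κ (D.W_subset_S m hw)]
    rw [(laplacian_collar G hx hz).1, h1, D.x_κ (D.W_subset_S m hz),
      lapE_collarGram_coord (D.S_mem_nhds hz) hz.1 (contDiffOn_collarH G m)
          (fun w hw => collarH_det_pos G m hw)]
    field_simp
    ring
  obtain ⟨l, hl, h⟩ := exists_sm_extension
    (((((Sm.const (D := D) (d - 2)).mul (Sm.x.pow 3)).int.sub
      (SmInt.laplacian G hx)).div_x 4)) fun m =>
    ⟨collarLogDeriv (collarH G m) (D.S m),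
      contDiffOn_collarLogDeriv (D.uniqueDiffOn_S m) (contDiffOn_collarH G m)
        (fun w hw => collarH_det_pos G m hw), fun z hz => hkey m z hz⟩
  refine ⟨l, hl, fun p hp => ?_, fun m z hz => ?_⟩
  · have h0 : (D.x p : ℂ) ≠ 0 := by exact_mod_cast hp.ne'
    rw [← h p hp]
    field_simp
    ring
  · rw [← h _ (by rw [D.x_κ (D.W_subset_S m hz)]; exact hz.1), hkey m z hz]

/-- The Laplacian of a product with a function of `x` near the boundary. -/
theorem exists_laplacian_mul {l : X → ℂ}
    (hl : ∀ m : M, ∀ z ∈ D.W m, l (D.κ m z) = collarLogDeriv (collarH G m) (D.S m) z)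
    (hls : D.Sm l) (ha : D.Sm a) :
    ∃ B, D.Sm B ∧ ∀ φ : ℝ → ℂ, ContDiffOn ℝ ∞ φ (Ioi 0) → ∀ p, 0 < D.x p → D.x p < D.ε →
      G.laplacian (fun q => φ (D.x q) * a q) p =
        φ (D.x p) * G.laplacian a p - 2 * (D.x p : ℂ) ^ 4 * deriv φ (D.x p) * B p
        - (D.x p : ℂ) ^ 4 * deriv (deriv φ) (D.x p) * a p
        + deriv φ (D.x p) * ((d - 2) * (D.x p : ℂ) ^ 3 - (D.x p : ℂ) ^ 4 * l p) * a p := by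
  have key : ∀ φ : ℝ → ℂ, ContDiffOn ℝ ∞ φ (Ioi 0) → ∀ m : M, ∀ z ∈ D.W m,
      G.laplacian (fun q => φ (D.x q) * a q) (D.κ m z) =
        φ (z 0) * G.laplacian a (D.κ m z) -
        2 * (z 0 : ℂ) ^ 4 * deriv φ (z 0) * pdW (D.S m) 0 (fun w => a (D.κ m w)) z
        - (z 0 : ℂ) ^ 4 * deriv (deriv φ) (z 0) * a (D.κ m z)
        + deriv φ (z 0) * ((d - 2) * (z 0 : ℂ) ^ 3 - (z 0 : ℂ) ^ 4 * l (D.κ m z)) *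
          a (D.κ m z) := by
    intro φ hφ m z hz
    have h1 : lapE (collarGram (collarH G m)) (fun w => φ (D.x (D.κ m w)) * a (D.κ m w)) z =
        lapE (collarGram (collarH G m)) (fun w => φ (w 0) * a (D.κ m w)) z := by
      refine lapE_congr EventuallyEq.rfl ?_
      filter_upwards [(D.isOpen_W m).mem_nhds hz] with w hw
      rw [D.x_κ (D.W_subset_S m hw)]
    rw [(laplacian_collar G ((SmInt.comp_x hφ).mul ha.int) hz).1, h1,
      lapE_collarGram_mul (D.S_mem_nhds hz) hz.1 (contDiffOn_collarH G m)
          (fun w hw => collarH_det_pos G m hw) (laplacian_collar G ha.int hz).2 hφ,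
      (laplacian_collar G ha.int hz).1, pdW_eq_pd (D.S_mem_nhds hz), hl m z hz]
  have hid : ContDiffOn ℝ ∞ (fun t : ℝ => (t : ℂ)) (Ioi 0) :=
    Complex.ofRealCLM.contDiff.contDiffOn
  have hx := (Sm.x (D := D)).int
  have hd1 : deriv (fun t : ℝ => (t : ℂ)) = fun _ => 1 := by
    funext t
    exact (Complex.ofRealCLM.hasDerivAt (x := t)).deriv
  -- The choice φ(t) = t in the product formula isolates 2 ∂ₓa as a globally defined expression, so
  -- the local normal derivatives patch together without choosing a vector field.
  have hBκ : ∀ m : M, ∀ z ∈ D.W m, (((D.x (D.κ m z) : ℂ) * G.laplacian a (D.κ m z) +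
      ((d - 2) * (D.x (D.κ m z) : ℂ) ^ 3 - (D.x (D.κ m z) : ℂ) ^ 4 * l (D.κ m z)) * a (D.κ m z) -
      G.laplacian (fun q => (D.x q : ℂ) * a q) (D.κ m z)) / (D.x (D.κ m z) : ℂ) ^ 4) =
      2 * pdW (D.S m) 0 (fun w => a (D.κ m w)) z := fun m z hz => by
    have h0 : (z 0 : ℂ) ≠ 0 := by exact_mod_cast (ne_of_gt hz.1)
    rw [key _ hid m z hz, D.x_κ (D.W_subset_S m hz), hd1]
    simp
    field_simp
  obtain ⟨B, hB, hBe⟩ := exists_sm_extension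
    ((((hx.mul (SmInt.laplacian G ha.int)).add ((((Sm.const (D := D) (d - 2)).mul
      (Sm.x.pow 3)).sub ((Sm.x.pow 4).mul hls)).mul ha).int).sub
        (SmInt.laplacian G (hx.mul ha.int))).div_x 4) fun m =>
    ⟨fun z => 2 * pdW (D.S m) 0 (fun w => a (D.κ m w)) z,
      contDiffOn_const.mul (contDiffOn_pdW (D.uniqueDiffOn_S m) (contDiffOn_collar ha m) 0),
      fun z hz => hBκ m z hz⟩
  refine ⟨fun p => (1 / 2 : ℂ) * B p, (Sm.const _).mul hB, fun φ hφ p hp hpε => ?_⟩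
  have hN := D.mem_N_self hpε
  have hz := D.ι_mem_W hN hp
  have h1 := key φ hφ _ _ hz
  have h2 := hBκ _ _ hz
  have h3 := hBe p hp
  simp only [D.κ_ι hN] at h1 h2
  have h4 : (D.ι (D.y p) p) 0 = D.x p := by simp [ι]
  rw [h4] at h1
  have h5 := h3.symm.trans h2
  rw [h1]
  simp only [h5]
  ring

/-! ### Conjugation of the Laplacian by exponential weights. -/

/-- The weight `e^(-γ/x) x^(d/2)`. -/
def wt (d : ℕ) (γ : ℂ) (t : ℝ) : ℂ :=
  Complex.exp (-γ / t) * ((t ^ ((d : ℝ) / 2) : ℝ) : ℂ)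

theorem wt_ne_zero (d : ℕ) (γ : ℂ) {t : ℝ} (ht : 0 < t) : wt d γ t ≠ 0 :=
  mul_ne_zero (Complex.exp_ne_zero _) (by exact_mod_cast (Real.rpow_pos_of_pos ht _).ne')

theorem hasDerivAt_ofReal_complex (t : ℝ) : HasDerivAt (fun t : ℝ => (t : ℂ)) 1 t :=
  Complex.ofRealCLM.hasDerivAt

theorem hasDerivAt_wt (d : ℕ) (γ : ℂ) {t : ℝ} (ht : 0 < t) :
    HasDerivAt (wt d γ) (wt d γ t * (γ / t ^ 2 + d / (2 * t))) t := by
  have h0 : (t : ℂ) ≠ 0 := by exact_mod_cast ht.ne'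
  have h1 : HasDerivAt (fun t : ℝ => Complex.exp (-γ / t))
      (Complex.exp (-γ / t) * (γ / t ^ 2)) t := by
    have := ((hasDerivAt_const t (-γ)).fun_div (hasDerivAt_ofReal_complex t) h0).cexp
    convert! this using 1
    ring
  have h2 : HasDerivAt (fun t : ℝ => ((t ^ ((d : ℝ) / 2) : ℝ) : ℂ))
      (((d : ℝ) / 2 * t ^ ((d : ℝ) / 2 - 1) : ℝ) : ℂ) t :=
    (Real.hasDerivAt_rpow_const (Or.inl ht.ne')).ofReal_comp
  have := h1.mul h2
  convert! this using 1
  rw [Real.rpow_sub_one ht.ne']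
  simp only [wt]
  push_cast
  field_simp

theorem contDiffOn_wt (d : ℕ) (γ : ℂ) : ContDiffOn ℝ ∞ (wt d γ) (Ioi 0) := by
  refine ContDiffOn.mul ?_ ?_
  · have h : ContDiffOn ℝ ∞ (fun t : ℝ => -γ / (t : ℂ)) (Ioi 0) := by
      simpa [div_eq_mul_inv] using (contDiffOn_const (c := -γ)).mul (contDiffOn_inv_pow 1)
    exact h.cexp
  · exact Complex.ofRealCLM.contDiff.comp_contDiffOn fun t ht =>
      (Real.contDiffAt_rpow_const_of_ne (ne_of_gt ht)).contDiffWithinAt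

/-- The Laplacian conjugated by the weight `e^(-γ/x) x^(d/2)`. -/
theorem exists_conj_laplacian (γ : ℂ) (ha : D.Sm a) :
    ∃ T K, D.Sm T ∧ D.Sm K ∧
      (∀ p, 0 < D.x p → G.laplacian (fun q => wt d γ (D.x q) * a q) p =
        wt d γ (D.x p) * (-γ ^ 2 * a p + (D.x p : ℂ) ^ 2 * T p)) ∧
      ∀ η : ℝ → ℂ, ContDiffOn ℝ ∞ η (Ioi 0) → ∀ p, 0 < D.x p → D.x p < D.ε →
        G.laplacian (fun q => wt d γ (D.x q) * (η (D.x q) * a q)) p =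
          wt d γ (D.x p) * (-γ ^ 2 * (η (D.x p) * a p) + (D.x p : ℂ) ^ 2 * (η (D.x p) * T p)
            - (D.x p : ℂ) ^ 2 * deriv η (D.x p) * (2 * γ * a p + D.x p * K p)
            - (D.x p : ℂ) ^ 4 * deriv (deriv η) (D.x p) * a p) := by
  obtain ⟨A, hA, hAe⟩ := exists_laplacian_eq G ha
  obtain ⟨l, hl, -, hlκ⟩ := exists_laplacian_x G (D := D)
  obtain ⟨B, hB, hBe⟩ := exists_laplacian_mul G hlκ hl ha
  -- Obtained by inserting w'/w = γ/x² + d/(2x) in the product formula. The terms of order x are -γd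
  -- + 2γ from the second derivative and γ(d-2) from Δx; they cancel.
  set T : X → ℂ := fun p => A p - (2 * γ + d * D.x p) * B p +
    (d * (d - 2) / 2 - γ * l p - d / 2 * D.x p * l p - d ^ 2 / 4 + d / 2) * a p with hTdef
  set K : X → ℂ := fun p => 2 * a p + D.x p * l p * a p + 2 * D.x p * B p with hKdef
  have hx := Sm.x (D := D)
  have hc := fun c => Sm.const (D := D) c
  have hT : D.Sm T := (hA.sub (((hc _).add ((hc _).mul hx)).mul hB)).add
    ((((((hc _).sub ((hc _).mul hl)).sub (((hc _).mul hx).mul hl)).sub (hc _)).add (hc _)).mul ha)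
  have hK : D.Sm K := (((hc _).mul ha).add ((hx.mul hl).mul ha)).add (((hc _).mul hx).mul hB)
  have key : ∀ η : ℝ → ℂ, ContDiffOn ℝ ∞ η (Ioi 0) → ∀ p, 0 < D.x p → D.x p < D.ε →
        G.laplacian (fun q => wt d γ (D.x q) * (η (D.x q) * a q)) p =
          wt d γ (D.x p) * (-γ ^ 2 * (η (D.x p) * a p) + (D.x p : ℂ) ^ 2 * (η (D.x p) * T p)
            - (D.x p : ℂ) ^ 2 * deriv η (D.x p) * (2 * γ * a p + D.x p * K p)
            - (D.x p : ℂ) ^ 4 * deriv (deriv η) (D.x p) * a p) := by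
    intro η hη p hp hpε
    have h0 : (D.x p : ℂ) ≠ 0 := by exact_mod_cast hp.ne'
    have hη' : ContDiffOn ℝ ∞ (deriv η) (Ioi 0) := hη.deriv_of_isOpen isOpen_Ioi (by norm_cast)
    have hd : ∀ {χ : ℝ → ℂ}, ContDiffOn ℝ ∞ χ (Ioi 0) → ∀ t : ℝ, 0 < t →
        HasDerivAt χ (deriv χ t) t := fun hχ t ht =>
      ((hχ.contDiffAt (Ioi_mem_nhds ht)).differentiableAt (by simp)).hasDerivAt
    have hφ : ContDiffOn ℝ ∞ (fun t => wt d γ t * η t) (Ioi 0) := (contDiffOn_wt d γ).mul hη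
    have h1 : ∀ t : ℝ, 0 < t → deriv (fun t => wt d γ t * η t) t =
        wt d γ t * (γ / t ^ 2 + d / (2 * t)) * η t + wt d γ t * deriv η t := fun t ht =>
      ((hasDerivAt_wt d γ ht).mul (hd hη t ht)).deriv
    have h2 : deriv (deriv (fun t => wt d γ t * η t)) (D.x p) =
        wt d γ (D.x p) * (deriv (deriv η) (D.x p) +
          2 * (γ / D.x p ^ 2 + d / (2 * D.x p)) * deriv η (D.x p) +
          ((γ / D.x p ^ 2 + d / (2 * D.x p)) ^ 2 - 2 * γ / D.x p ^ 3 - d / (2 * D.x p ^ 2)) *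
            η (D.x p)) := by
      have he : deriv (fun t => wt d γ t * η t) =ᶠ[𝓝 (D.x p)] fun t =>
          wt d γ t * (γ / t ^ 2 + d / (2 * t)) * η t + wt d γ t * deriv η t := by
        filter_upwards [Ioi_mem_nhds hp] with t ht using h1 t ht
      rw [he.deriv_eq]
      have hx1 := hasDerivAt_ofReal_complex (D.x p)
      have hσ : HasDerivAt (fun t : ℝ => γ / (t : ℂ) ^ 2 + d / (2 * (t : ℂ)))
          (-2 * γ / D.x p ^ 3 - d / (2 * D.x p ^ 2)) (D.x p) := by
        have h3 := ((hasDerivAt_const (D.x p) γ).fun_div (hx1.fun_pow 2) (pow_ne_zero 2 h0)).fun_add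
          ((hasDerivAt_const (D.x p) (d : ℂ)).fun_div (hx1.const_mul 2)
            (mul_ne_zero two_ne_zero h0))
        convert! h3 using 1
        field_simp
        ring
      have h4 := (((hasDerivAt_wt d γ hp).fun_mul hσ).fun_mul (hd hη _ hp)).fun_add
        ((hasDerivAt_wt d γ hp).fun_mul (hd hη' _ hp))
      rw [h4.deriv]
      ring
    have h5 := hBe _ hφ p hp hpε
    simp only [mul_assoc] at h5 ⊢
    rw [h5, hAe p hp, h2, h1 _ hp]
    simp only [hTdef, hKdef]
    field_simp
    ring
  have hone : ContDiffOn ℝ ∞ (fun _ : ℝ => (1 : ℂ)) (Ioi 0) := contDiffOn_const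
  have hw := SmInt.comp_x (D := D) (contDiffOn_wt d γ)
  have hwinv : D.SmInt fun p => (wt d γ (D.x p))⁻¹ := SmInt.comp_x (φ := fun t => (wt d γ t)⁻¹)
    ((contDiffOn_wt d γ).inv fun t ht => wt_ne_zero d γ ht)
  -- Outside the collar the explicit formula for `T` is not available. There `T` is defined by
  -- solving the conjugation identity, and the two definitions agree in the collar.
  have hF : D.SmInt fun p => ((wt d γ (D.x p))⁻¹ *
      G.laplacian (fun q => wt d γ (D.x q) * a q) p + γ ^ 2 * a p) / (D.x p : ℂ) ^ 2 :=
    ((hwinv.mul (SmInt.laplacian G (hw.mul ha.int))).add ((hc _).mul ha).int).div_x 2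
  obtain ⟨T', hT', hT'e⟩ := hF.glue hT D.ε_pos (fun p hp hpε => by
    have h0 : (D.x p : ℂ) ≠ 0 := by exact_mod_cast hp.ne'
    have hw0 := wt_ne_zero d γ hp
    have := key _ hone p hp hpε
    simp only [one_mul, deriv_const'] at this
    rw [this]
    field_simp
    simp)
  refine ⟨T', K, hT', hK, fun p hp => ?_, fun η hη p hp hpε => ?_⟩
  · have h0 : (D.x p : ℂ) ≠ 0 := by exact_mod_cast hp.ne'
    have hw0 := wt_ne_zero d γ hp
    rw [← hT'e p hp]
    field_simp
    ring
  · have h0 : (D.x p : ℂ) ≠ 0 := by exact_mod_cast hp.ne'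
    have hw0 := wt_ne_zero d γ hp
    have hTT : T' p = T p := by
      rw [← hT'e p hp]
      have := key _ hone p hp hpε
      simp only [one_mul, deriv_const'] at this
      rw [this]
      field_simp
      simp
    rw [hTT]
    exact key η hη p hp hpε

end

section

/-! ### Series of smooth functions on convex sets -/

section Series

variable {E F : Type*} [NormedAddCommGroup E] [NormedSpace ℝ E]
  [NormedAddCommGroup F] [NormedSpace ℝ F] [CompleteSpace F] {K : Set E} {u : ℕ → ℝ}

/-- An ε/3 argument: finitely many terms are differentiable, and the increment of the tail is
controlled by the mean value inequality. That inequality needs convexity but not openness, which is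
essential for boxes touching the boundary. -/
theorem hasFDerivWithinAt_tsum_of_convex (hK : Convex ℝ K) (hu : Summable u)
    {f : ℕ → E → F} {f' : ℕ → E → E →L[ℝ] F}
    (hf : ∀ i, ∀ y ∈ K, HasFDerivWithinAt (f i) (f' i y) K y)
    (hf' : ∀ i, ∀ y ∈ K, ‖f' i y‖ ≤ u i) (hs : ∀ y ∈ K, Summable fun i => f i y)
    {z : E} (hz : z ∈ K) :
    HasFDerivWithinAt (fun y => ∑' i, f i y) (∑' i, f' i z) K z := by
  have hs' : Summable fun i => f' i z := Summable.of_norm_bounded hu fun i => hf' i z hz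
  rw [hasFDerivWithinAt_iff_isLittleO, Asymptotics.isLittleO_iff]
  intro c hc
  obtain ⟨N, hN⟩ : ∃ N, ∑' i, u (i + N) < c / 3 := by
    have := (tendsto_sum_nat_add u).eventually (gt_mem_nhds (show 0 < c / 3 by positivity))
    exact this.exists
  have hfin : HasFDerivWithinAt (fun y => ∑ i ∈ Finset.range N, f i y)
      (∑ i ∈ Finset.range N, f' i z) K z :=
    HasFDerivWithinAt.fun_sum fun i _ => hf i z hz
  rw [hasFDerivWithinAt_iff_isLittleO, Asymptotics.isLittleO_iff] at hfin
  filter_upwards [hfin (show 0 < c / 3 by positivity), self_mem_nhdsWithin] with y hy hyK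
  have huN : Summable fun i => u (i + N) := (summable_nat_add_iff N).2 hu
  have e1 : ∀ w ∈ K, ∑' i, f i w = ∑ i ∈ Finset.range N, f i w + ∑' i, f (i + N) w :=
    fun w hw => ((hs w hw).sum_add_tsum_nat_add N).symm
  have e2 : ∑' i, f' i z = ∑ i ∈ Finset.range N, f' i z + ∑' i, f' (i + N) z :=
    (hs'.sum_add_tsum_nat_add N).symm
  have e3 : ‖∑' i, f (i + N) y - ∑' i, f (i + N) z‖ ≤ c / 3 * ‖y - z‖ := by
    rw [← ((summable_nat_add_iff N).2 (hs y hyK)).tsum_sub ((summable_nat_add_iff N).2 (hs z hz))]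
    refine (tsum_of_norm_bounded (huN.mul_right ‖y - z‖).hasSum fun i => ?_).trans ?_
    · exact hK.norm_image_sub_le_of_norm_hasFDerivWithin_le (hf (i + N)) (hf' (i + N)) hz hyK
    · rw [tsum_mul_right]
      gcongr
  have e4 : ‖(∑' i, f' (i + N) z) (y - z)‖ ≤ c / 3 * ‖y - z‖ := by
    refine (ContinuousLinearMap.le_opNorm _ _).trans ?_
    gcongr
    exact (tsum_of_norm_bounded huN.hasSum fun i => hf' (i + N) z hz).trans hN.le
  have e5 : ∑' i, f i y - ∑' i, f i z - (∑' i, f' i z) (y - z) =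
      (∑ i ∈ Finset.range N, f i y - ∑ i ∈ Finset.range N, f i z -
        (∑ i ∈ Finset.range N, f' i z) (y - z)) +
      (∑' i, f (i + N) y - ∑' i, f (i + N) z) - (∑' i, f' (i + N) z) (y - z) := by
    rw [e1 y hyK, e1 z hz, e2, add_apply]
    abel
  rw [e5]
  refine (norm_sub_le _ _).trans ((add_le_add_left (norm_add_le _ _) _).trans ?_)
  linarith

/-- The Taylor series of the sum is the sum of the Taylor series, by termwise differentiation at
each order below n. -/
theorem contDiffOn_tsum_of_convex (hK : Convex ℝ K) (hd : UniqueDiffOn ℝ K) (hu : Summable u)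
    {n : ℕ} {f : ℕ → E → F} (hf : ∀ i, ContDiffOn ℝ n (f i) K)
    (hb : ∀ m ≤ n, ∀ i, ∀ z ∈ K, ‖iteratedFDerivWithin ℝ m (f i) K z‖ ≤ u i) :
    ContDiffOn ℝ n (fun z => ∑' i, f i z) K := by
  have hsum : ∀ m ≤ n, ∀ z ∈ K, Summable fun i => iteratedFDerivWithin ℝ m (f i) K z :=
    fun m hm z hz => Summable.of_norm_bounded hu fun i => hb m hm i z hz
  have h : HasFTaylorSeriesUpToOn n (fun z => ∑' i, f i z)
      (fun z m => ∑' i, iteratedFDerivWithin ℝ m (f i) K z) K := by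
    refine ⟨fun z hz => ?_, fun m hm z hz => ?_, fun m hm => ?_⟩
    · have := (continuousMultilinearCurryFin0 ℝ E F).toContinuousLinearEquiv.map_tsum
        (L := SummationFilter.unconditional ℕ) (f := fun i => iteratedFDerivWithin ℝ 0 (f i) K z)
      exact this
    · have hm' : m + 1 ≤ n := by
        have : m < n := by exact_mod_cast hm
        omega
      have h1 := hasFDerivWithinAt_tsum_of_convex (f := fun i => iteratedFDerivWithin ℝ m (f i) K)
        (f' := fun i z => (iteratedFDerivWithin ℝ (m + 1) (f i) K z).curryLeft) hK hu
        (fun i y hy => ((hf i).ftaylorSeriesWithin hd).fderivWithin m (by exact_mod_cast hm) y hy)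
        (fun i y hy => by
          rw [ContinuousMultilinearMap.curryLeft_norm]
          exact hb _ hm' i y hy) (fun y hy => hsum m (by omega) y hy) hz
      convert! h1 using 1
      exact (continuousMultilinearCurryLeftEquiv ℝ (fun _ : Fin (m + 1) => E)
        F).toContinuousLinearEquiv.map_tsum
          (L := SummationFilter.unconditional ℕ) (f := fun i => iteratedFDerivWithin ℝ (m + 1) (f i) K z)
    · have hm' : m ≤ n := by exact_mod_cast hm
      exact continuousOn_tsum (fun i => (hf i).continuousOn_iteratedFDerivWithin
        (by exact_mod_cast hm) hd) hu fun i z hz => hb m hm' i z hz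
  exact HasFTaylorSeriesUpToOn.contDiffOn (n := (n : ℕ∞)) h

end Series

/-! ### Cut-off monomials -/

section Cutoff

/-- A smooth cut-off function, equal to one on `[-1, 1]`. -/
def cutoff : ContDiffBump (0 : ℝ) := ⟨1, 2, one_pos, one_lt_two⟩

/-- The monomial `t ^ k`, cut off at scale `ε` and divided by `t ^ N`, as `ε ^ k θ(t / ε)`. -/
def cutMono (k : ℕ) (ε t : ℝ) : ℝ := ε ^ k * ((ε⁻¹ * t) ^ k * cutoff (ε⁻¹ * t))

theorem contDiff_cutMono (k : ℕ) (ε : ℝ) : ContDiff ℝ ∞ (cutMono k ε) := by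
  have h : ContDiff ℝ ∞ fun t : ℝ => ε⁻¹ * t := contDiff_const.mul contDiff_id
  exact contDiff_const.mul ((h.pow k).mul (cutoff.contDiff.comp h))

/-- Multiplication by a power of t only shifts the exponent. This lets x^N be factored out of the
tail of a Borel sum, leaving a series of the same kind. -/
theorem cutMono_mul_pow (k N : ℕ) {ε : ℝ} (hε : 0 < ε) (t : ℝ) :
    t ^ N * cutMono k ε t = cutMono (k + N) ε t := by
  have h : ε ^ N * (ε⁻¹ * t) ^ N = t ^ N := by
    rw [← mul_pow, mul_inv_cancel_left₀ hε.ne']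
  rw [← h]
  simp only [cutMono, pow_add]
  ring

theorem cutMono_eq (k : ℕ) {ε : ℝ} (hε : 0 < ε) {t : ℝ} (ht : |t| ≤ ε) : cutMono k ε t = t ^ k := by
  have h : cutoff (ε⁻¹ * t) = 1 := by
    refine cutoff.one_of_mem_closedBall ?_
    rw [mem_closedBall_zero_iff, Real.norm_eq_abs, abs_mul, abs_inv, abs_of_pos hε]
    change ε⁻¹ * |t| ≤ 1
    rw [inv_mul_le_iff₀ hε]
    linarith
  rw [cutMono, h, mul_one, ← mul_pow]
  field_simp

/-- By scaling, the m-th derivative of ε^k θ(t/ε) is of size ε^(k-m), which is at most ε when m < k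
and ε ≤ 1. One constant serves all k ≤ j because the tails of the Borel sum use the scale of index j
with smaller exponents. -/
theorem exists_bound_cutMono :
    ∃ C : ℕ → ℝ, ∀ j, 0 ≤ C j ∧ ∀ k m, k ≤ j → m < k → ∀ ε : ℝ, 0 < ε → ε ≤ 1 → ∀ t,
      ‖iteratedFDeriv ℝ m (cutMono k ε) t‖ ≤ C j * ε := by
  have h1 : ∀ k m : ℕ, ∃ c : ℝ, 0 ≤ c ∧ ∀ s, ‖iteratedDeriv m (fun s => s ^ k * cutoff s) s‖ ≤ c := by
    intro k m
    have hsm : ContDiff ℝ ∞ fun s : ℝ => s ^ k * cutoff s := (contDiff_id.pow k).mul cutoff.contDiff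
    have hcs : HasCompactSupport fun s : ℝ => s ^ k * cutoff s :=
      cutoff.hasCompactSupport.mul_left
    have hc : HasCompactSupport (iteratedFDeriv ℝ m fun s : ℝ => s ^ k * cutoff s) :=
      hcs.iteratedFDeriv m
    obtain ⟨c, hc⟩ := hc.exists_bound_of_continuous (hsm.continuous_iteratedFDeriv
      (by exact_mod_cast le_top))
    refine ⟨c, (norm_nonneg _).trans (hc 0), fun s => ?_⟩
    rw [← norm_iteratedFDeriv_eq_norm_iteratedDeriv]
    exact hc s
  choose c hc0 hc using h1
  refine ⟨fun j => ∑ k ∈ Finset.range (j + 1), ∑ m ∈ Finset.range (j + 1), c k m, fun j =>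
    ⟨Finset.sum_nonneg fun k _ => Finset.sum_nonneg fun m _ => hc0 k m, ?_⟩⟩
  intro k m hk hm ε hε hε1 t
  have hsm : ContDiff ℝ m fun s : ℝ => s ^ k * cutoff s := (contDiff_id.pow k).mul cutoff.contDiff
  have hsm2 : ContDiff ℝ m fun t : ℝ => (ε⁻¹ * t) ^ k * cutoff (ε⁻¹ * t) :=
    hsm.comp (contDiff_const.mul contDiff_id)
  have e1 : iteratedDeriv m (cutMono k ε) t =
      ε ^ k * ((ε⁻¹) ^ m * iteratedDeriv m (fun s => s ^ k * cutoff s) (ε⁻¹ * t)) := by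
    have h2 := congrFun (iteratedDeriv_comp_const_mul hsm ε⁻¹) t
    rw [← smul_eq_mul (ε⁻¹ ^ m)] 
    have h3 := iteratedDeriv_const_mul (𝕜 := ℝ) (ε ^ k) (hsm2.contDiffAt (x := t))
    simp only [smul_eq_mul] at h2 ⊢
    rw [← h2]
    exact h3
  rw [norm_iteratedFDeriv_eq_norm_iteratedDeriv, e1, norm_mul, norm_mul]
  have h4 : c k m ≤ ∑ k ∈ Finset.range (j + 1), ∑ m ∈ Finset.range (j + 1), c k m :=
    (Finset.single_le_sum (f := fun m => c k m) (fun m _ => hc0 k m)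
      (Finset.mem_range.2 (by omega))).trans
      (Finset.single_le_sum (f := fun k => ∑ m ∈ Finset.range (j + 1), c k m)
        (fun k _ => Finset.sum_nonneg fun m _ => hc0 k m) (Finset.mem_range.2 (by omega)))
  have h5 : ‖ε ^ k‖ * ‖ε⁻¹ ^ m‖ ≤ ε := by
    obtain ⟨r, rfl⟩ : ∃ r, k = m + 1 + r := ⟨k - (m + 1), by omega⟩
    have h6 : ε ^ (m + 1 + r) * ε⁻¹ ^ m = ε * ε ^ r := by
      rw [pow_add, pow_succ, mul_right_comm, mul_right_comm (ε ^ m), ← mul_pow,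
        mul_inv_cancel₀ hε.ne', one_pow, one_mul]
    rw [← norm_mul, h6, Real.norm_of_nonneg (by positivity)]
    exact mul_le_of_le_one_right hε.le (pow_le_one₀ hε.le hε1)
  rw [← mul_assoc]
  calc _ ≤ ε * c k m := mul_le_mul h5 (hc k m _) (norm_nonneg _) hε.le
    _ ≤ _ := by rw [mul_comm]; gcongr

end Cutoff

end

section

/-! ### Derivative estimates on compact sets. -/

section Estimate

variable {E : Type*} [NormedAddCommGroup E] [NormedSpace ℝ E] {K : Set E}

theorem exists_bound_iteratedFDerivWithin {F : Type*} [NormedAddCommGroup F] [NormedSpace ℝ F]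
    (hK : IsCompact K) (hd : UniqueDiffOn ℝ K) {f : E → F} (hf : ContDiffOn ℝ ∞ f K) (n : ℕ) :
    ∃ B : ℝ, 1 ≤ B ∧ ∀ m ≤ n, ∀ z ∈ K, ‖iteratedFDerivWithin ℝ m f K z‖ ≤ B := by
  have h : ∀ m : ℕ, ∃ B : ℝ, ∀ z ∈ K, ‖iteratedFDerivWithin ℝ m f K z‖ ≤ B := fun m =>
    hK.exists_bound_of_continuousOn
      (hf.continuousOn_iteratedFDerivWithin (by exact_mod_cast le_top) hd)
  choose B hB using h
  refine ⟨1 + ∑ m ∈ Finset.range (n + 1), |B m|,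
    le_add_of_nonneg_right (Finset.sum_nonneg fun m _ => abs_nonneg _), fun m hm z hz => ?_⟩
  have h1 := Finset.single_le_sum (f := fun m => |B m|) (fun m _ => abs_nonneg _)
    (Finset.mem_range.2 (Nat.lt_succ_of_le hm))
  have h2 := (hB m z hz).trans (le_abs_self _)
  linarith

/-- The Leibniz rule and the bound for derivatives of compositions. The point is that the bound is
linear in c with a factor independent of η, so that shrinking the cut-off scale makes the term
small. -/
theorem exists_bound_comp_smul (hK : IsCompact K) (hd : UniqueDiffOn ℝ K) {x : E → ℝ}
    (hx : ContDiffOn ℝ ∞ x K) {b : E → ℂ} (hb : ContDiffOn ℝ ∞ b K) (n : ℕ) :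
    ∃ P : ℝ, 0 ≤ P ∧ ∀ η : ℝ → ℝ, ContDiff ℝ ∞ η → ∀ c, ∀ m ≤ n,
      (∀ i ≤ m, ∀ t, ‖iteratedFDeriv ℝ i η t‖ ≤ c) → ∀ z ∈ K,
        ‖iteratedFDerivWithin ℝ m (fun z => η (x z) • b z) K z‖ ≤ P * c := by
  obtain ⟨A, hA1, hA⟩ := exists_bound_iteratedFDerivWithin hK hd hx n
  obtain ⟨B, hB1, hB⟩ := exists_bound_iteratedFDerivWithin hK hd hb n
  have hA0 : 0 ≤ A := zero_le_one.trans hA1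
  have hB0 : 0 ≤ B := zero_le_one.trans hB1
  refine ⟨∑ m ∈ Finset.range (n + 1), ∑ i ∈ Finset.range (m + 1),
    (m.choose i : ℝ) * (i.factorial * A ^ i) * B, by positivity, ?_⟩
  intro η hη c m hm hc z hz
  have hc0 : 0 ≤ c := (norm_nonneg _).trans (hc 0 (Nat.zero_le _) 0)
  refine (norm_iteratedFDerivWithin_smul_le (hη.comp_contDiffOn hx) hb hd hz
    (by exact_mod_cast le_top)).trans ?_
  have h1 : ∀ i ≤ m, ‖iteratedFDerivWithin ℝ i (η ∘ x) K z‖ ≤ i.factorial * c * A ^ i := by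
    intro i hi
    refine norm_iteratedFDerivWithin_comp_le (t := univ) (N := ∞) hη.contDiffOn hx
      (by exact_mod_cast le_top) uniqueDiffOn_univ hd (mapsTo_univ _ _) hz ?_ ?_
    · intro l hl
      rw [iteratedFDerivWithin_univ]
      exact hc l (hl.trans hi) _
    · intro l hl1 hl
      -- The composition estimate wants the l-th derivative bounded by the l-th power of a constant;
      -- this is why the constants are normalized to be at least 1.
      exact (hA l (by omega) z hz).trans (le_self_pow₀ hA1 (by omega))
  calc _ ≤ ∑ i ∈ Finset.range (m + 1), (m.choose i : ℝ) * (i.factorial * c * A ^ i) * B := by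
        refine Finset.sum_le_sum fun i hi => ?_
        have hi' := Finset.mem_range_succ_iff.1 hi
        exact mul_le_mul (mul_le_mul_of_nonneg_left (h1 i hi') (Nat.cast_nonneg _))
          (hB _ (by omega) z hz) (norm_nonneg _) (by positivity)
    _ = (∑ i ∈ Finset.range (m + 1), (m.choose i : ℝ) * (i.factorial * A ^ i) * B) * c := by
        rw [Finset.sum_mul]
        exact Finset.sum_congr rfl fun i _ => by ring
    _ ≤ _ := by
        refine mul_le_mul_of_nonneg_right ?_ hc0
        exact Finset.single_le_sum (f := fun m => ∑ i ∈ Finset.range (m + 1),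
          (m.choose i : ℝ) * (i.factorial * A ^ i) * B) (fun m _ => by positivity)
          (Finset.mem_range.2 (Nat.lt_succ_of_le hm))

end Estimate

/-! ### Convex compact boxes in charts, including those that meet the boundary. -/

section ChartBox

variable {d : ℕ} {X : Type*} [TopologicalSpace X] [ChartedSpace (EuclideanHalfSpace (d + 1)) X]

/-- The part of the closed ball of radius `r` about the coordinates of `q` in the half-space. -/
def chartBox (q : X) (r : ℝ) : Set (Coord d) :=
  Metric.closedBall (extChartAt (𝓡∂ (d + 1)) q q) r ∩ range (𝓡∂ (d + 1))

theorem convex_chartBox (q : X) (r : ℝ) : Convex ℝ (chartBox (d := d) q r) :=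
  (convex_closedBall _ _).inter (𝓡∂ (d + 1)).convex_range

theorem isCompact_chartBox (q : X) (r : ℝ) : IsCompact (chartBox (d := d) q r) :=
  (isCompact_closedBall _ _).inter_right (𝓡∂ (d + 1)).isClosed_range

theorem uniqueDiffOn_chartBox (q : X) {r : ℝ} (hr : 0 < r) :
    UniqueDiffOn ℝ (chartBox (d := d) q r) := by
  refine uniqueDiffOn_convex (convex_chartBox q r) ?_
  have h1 : extChartAt (𝓡∂ (d + 1)) q q ∈ closure (interior (range (𝓡∂ (d + 1)))) :=
    (𝓡∂ (d + 1)).range_subset_closure_interior (extChartAt_target_subset_range q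
      (mem_extChartAt_target q))
  obtain ⟨z, hz1, hz2⟩ := mem_closure_iff.1 h1 _ Metric.isOpen_ball (Metric.mem_ball_self hr)
  refine ⟨z, mem_interior.2 ⟨_, ?_, Metric.isOpen_ball.inter isOpen_interior, hz1, hz2⟩⟩
  exact inter_subset_inter Metric.ball_subset_closedBall interior_subset

theorem exists_chartBox_subset (q : X) :
    ∃ r > 0, chartBox (d := d) q r ⊆ (extChartAt (𝓡∂ (d + 1)) q).target := by
  have h := extChartAt_target_mem_nhdsWithin (I := 𝓡∂ (d + 1)) q
  obtain ⟨r, hr, h⟩ := Metric.mem_nhdsWithin_iff.1 h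
  exact ⟨r / 2, half_pos hr, fun z hz => h ⟨Metric.closedBall_subset_ball (half_lt_self hr) hz.1,
    hz.2⟩⟩

/-- The points whose coordinates are in the open ball. -/
def chartBall (q : X) (r : ℝ) : Set X :=
  (extChartAt (𝓡∂ (d + 1)) q).source ∩
    extChartAt (𝓡∂ (d + 1)) q ⁻¹' Metric.ball (extChartAt (𝓡∂ (d + 1)) q q) r

theorem isOpen_chartBall (q : X) (r : ℝ) : IsOpen (chartBall (d := d) q r) :=
  (continuousOn_extChartAt q).isOpen_inter_preimage (isOpen_extChartAt_source q) Metric.isOpen_ball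

theorem mem_chartBall_self (q : X) {r : ℝ} (hr : 0 < r) : q ∈ chartBall (d := d) q r :=
  ⟨mem_extChartAt_source q, Metric.mem_ball_self hr⟩

theorem mem_chartBox_of_mem_chartBall {p q : X} {r : ℝ} (hp : p ∈ chartBall (d := d) q r) :
    extChartAt (𝓡∂ (d + 1)) q p ∈ chartBox (d := d) q r :=
  ⟨Metric.ball_subset_closedBall hp.2,
    extChartAt_target_subset_range q ((extChartAt (𝓡∂ (d + 1)) q).map_source hp.1)⟩

variable [IsManifold (𝓡∂ (d + 1)) ∞ X]

theorem contDiffOn_chartBox {F : Type*} [NormedAddCommGroup F] [NormedSpace ℝ F] {f : X → F}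
    (hf : ContMDiff (𝓡∂ (d + 1)) 𝓘(ℝ, F) ∞ f) {q : X} {r : ℝ}
    (hr : chartBox (d := d) q r ⊆ (extChartAt (𝓡∂ (d + 1)) q).target) :
    ContDiffOn ℝ ∞ (fun z => f ((extChartAt (𝓡∂ (d + 1)) q).symm z)) (chartBox q r) :=
  (hf.comp_contMDiffOn ((contMDiffOn_extChartAt_symm q).mono hr)).contDiffOn

theorem contMDiffAt_of_chartBox {F : Type*} [NormedAddCommGroup F] [NormedSpace ℝ F] {f : X → F}
    {n : ℕ} {q : X} {r : ℝ}
    (hf : ContDiffOn ℝ n (fun z => f ((extChartAt (𝓡∂ (d + 1)) q).symm z)) (chartBox q r))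
    {p : X} (hp : p ∈ chartBall (d := d) q r) : ContMDiffAt (𝓡∂ (d + 1)) 𝓘(ℝ, F) n f p := by
  have h1 : ContMDiffAt (𝓡∂ (d + 1)) 𝓘(ℝ, Coord d) n (extChartAt (𝓡∂ (d + 1)) q) p :=
    ((contMDiffOn_extChartAt (I := 𝓡∂ (d + 1)) (n := ∞) (x := q)).contMDiffAt
      ((chartAt _ q).open_source.mem_nhds (by simpa using hp.1))).of_le (by exact_mod_cast le_top)
  have h2 := (hf _ (mem_chartBox_of_mem_chartBall hp)).contMDiffWithinAt
  have h3 : ContMDiffAt (𝓡∂ (d + 1)) 𝓘(ℝ, F) n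
      ((fun z => f ((extChartAt (𝓡∂ (d + 1)) q).symm z)) ∘ extChartAt (𝓡∂ (d + 1)) q) p := by
    refine (h2.comp p (h1.contMDiffWithinAt (s := chartBall q r)) fun w hw =>
      mem_chartBox_of_mem_chartBall hw).contMDiffAt ((isOpen_chartBall q r).mem_nhds hp)
  refine h3.congr_of_eventuallyEq ?_
  filter_upwards [(isOpen_chartBall q r).mem_nhds hp] with w hw
  simp only [Function.comp_apply]
  rw [(extChartAt (𝓡∂ (d + 1)) q).left_inv hw.1]

end ChartBox

/-! ### Borel summation in powers of the boundary defining function. -/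

section Borel

variable {d : ℕ}
  {X : Type*} [TopologicalSpace X] [ChartedSpace (EuclideanHalfSpace (d + 1)) X]
  [IsManifold (𝓡∂ (d + 1)) ∞ X]
  {M : Type*} [TopologicalSpace M] [ChartedSpace (EuclideanSpace ℝ (Fin d)) M]
  [IsManifold (𝓡 d) ∞ M]
  {D : ProductDecomposition d X M}

namespace ProductDecomposition

/-- Borel's lemma: a smooth function with prescribed expansion in powers of `x`. -/
theorem exists_borel_sum [CompactSpace X] {b : ℕ → X → ℂ} (hb : ∀ j, D.Sm (b j))
    (hb0 : ∀ p, b 0 p = 0) :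
    ∃ a : X → ℂ, D.Sm a ∧ (∀ p, ‖a p‖ ≤ 1 / 2) ∧ ∀ N : ℕ, ∃ s : X → ℂ, D.Sm s ∧
      ∃ δ > 0, ∀ p, D.x p < δ →
        a p = ∑ j ∈ Finset.range N, (D.x p : ℂ) ^ j * b j p + (D.x p : ℂ) ^ N * s p := by
  choose r hr hrt using exists_chartBox_subset (d := d) (X := X)
  obtain ⟨t, ht⟩ := isCompact_univ.elim_finite_subcover (fun q : X => chartBall (d := d) q (r q))
    (fun q => isOpen_chartBall q _) (fun q _ => mem_iUnion.2 ⟨q, mem_chartBall_self q (hr q)⟩)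
  have hcov : ∀ p, ∃ q ∈ t, p ∈ chartBall (d := d) q (r q) := fun p => by
    simpa using ht (mem_univ p)
  obtain ⟨C, hC⟩ := exists_bound_cutMono
  choose P hP0 hP using fun (j : ℕ) (q : X) =>
    exists_bound_comp_smul (isCompact_chartBox (d := d) q (r q)) (uniqueDiffOn_chartBox q (hr q))
      (contDiffOn_chartBox D.x_smooth (hrt q)) (contDiffOn_chartBox (hb j) (hrt q)) j
  -- Only finitely many boxes cover X, so one scale for each j makes the bounds in all of them
  -- summable.
  have hε : ∀ j : ℕ, ∃ ε : ℝ, 0 < ε ∧ ε ≤ 1 ∧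
      ∀ q ∈ t, P j q * (C j * ε) ≤ (1 / 4) * (1 / 2) ^ j := by
    intro j
    have h1 : ∀ᶠ ε : ℝ in 𝓝[>] 0, ∀ q ∈ t, P j q * (C j * ε) < (1 / 4) * (1 / 2) ^ j := by
      refine (t.eventually_all).2 fun q _ => ?_
      have h2 : Tendsto (fun ε : ℝ => P j q * (C j * ε)) (𝓝[>] 0) (𝓝 0) := by
        have : Continuous fun ε : ℝ => P j q * (C j * ε) := by fun_prop
        simpa using (this.tendsto 0).mono_left nhdsWithin_le_nhds
      exact h2.eventually (gt_mem_nhds (by positivity))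
    have h3 : ∀ᶠ ε : ℝ in 𝓝[>] 0, ε ∈ Ioc (0 : ℝ) 1 := Ioc_mem_nhdsGT one_pos
    obtain ⟨ε, h4, h5⟩ := (h1.and h3).exists
    exact ⟨ε, h5.1, h5.2, fun q hq => (h4 q hq).le⟩
  choose ε hε0 hε1 hεP using hε
  have hbd : ∀ j k m, k ≤ j → m < k → ∀ q ∈ t, ∀ z ∈ chartBox (d := d) q (r q),
      ‖iteratedFDerivWithin ℝ m (fun z => cutMono k (ε j) (D.x ((extChartAt (𝓡∂ (d + 1)) q).symm z))
        • b j ((extChartAt (𝓡∂ (d + 1)) q).symm z)) (chartBox q (r q)) z‖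
        ≤ (1 / 4) * (1 / 2) ^ j := by
    intro j k m hkj hmk q hq z hz
    refine (hP j q (cutMono k (ε j)) (contDiff_cutMono _ _) (C j * ε j) m (by omega) ?_ z hz).trans
      (hεP j q hq)
    exact fun i hi s => (hC j).2 k i hkj (by omega) (ε j) (hε0 j) (hε1 j) s
  have hpt : ∀ j k, k ≤ j → 0 < k → ∀ p, ‖cutMono k (ε j) (D.x p) • b j p‖ ≤ (1 / 4) * (1 / 2) ^ j := by
    intro j k hkj hk p
    obtain ⟨q, hq, hp⟩ := hcov p
    have := hbd j k 0 hkj hk q hq _ (mem_chartBox_of_mem_chartBall hp)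
    rwa [norm_iteratedFDerivWithin_zero, (extChartAt (𝓡∂ (d + 1)) q).left_inv hp.1] at this
  have hgeo : Summable fun j : ℕ => (1 / 4 : ℝ) * (1 / 2) ^ j := summable_geometric_two.mul_left _
  have hsm1 : ∀ k j, D.Sm fun p => cutMono k (ε j) (D.x p) • b j p := fun k j =>
    ContMDiff.smul ((contDiff_cutMono k (ε j)).contMDiff.comp D.x_smooth) (hb j)
  have hsum : ∀ N p, Summable fun i => cutMono i (ε (i + N)) (D.x p) • b (i + N) p := by
    intro N p
    refine (summable_nat_add_iff 1).1 ?_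
    refine Summable.of_norm_bounded ((summable_nat_add_iff (N + 1)).2 hgeo) fun i => ?_
    have := hpt (i + 1 + N) (i + 1) (by omega) (by omega) p
    rwa [show i + (N + 1) = i + 1 + N by omega]
  -- The bounds control derivatives of order m only for exponents above m. For C^n regularity the
  -- first n + 1 terms, each smooth, are therefore split off.
  have hsm : ∀ N, D.Sm fun p => ∑' i, cutMono i (ε (i + N)) (D.x p) • b (i + N) p := by
    intro N
    have h1 : ∀ n : ℕ, ContMDiff (𝓡∂ (d + 1)) 𝓘(ℝ, ℂ) n
        fun p => ∑' i, cutMono i (ε (i + N)) (D.x p) • b (i + N) p := by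
      intro n
      have h2 : (fun p => ∑' i, cutMono i (ε (i + N)) (D.x p) • b (i + N) p) = fun p =>
          ∑ i ∈ Finset.range (n + 1), cutMono i (ε (i + N)) (D.x p) • b (i + N) p +
          ∑' i, cutMono (i + (n + 1)) (ε (i + (n + 1) + N)) (D.x p) • b (i + (n + 1) + N) p :=
        funext fun p => ((hsum N p).sum_add_tsum_nat_add (n + 1)).symm
      rw [h2]
      have h3 : ContMDiff (𝓡∂ (d + 1)) 𝓘(ℝ, ℂ) n fun p =>
          ∑ i ∈ Finset.range (n + 1), cutMono i (ε (i + N)) (D.x p) • b (i + N) p :=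
        (Sm.sum fun i _ => hsm1 i (i + N)).of_le (by exact_mod_cast le_top)
      refine h3.add fun p => ?_
      obtain ⟨q, hq, hp⟩ := hcov p
      refine contMDiffAt_of_chartBox ?_ hp
      refine contDiffOn_tsum_of_convex (convex_chartBox q _) (uniqueDiffOn_chartBox q (hr q))
        ((summable_nat_add_iff (n + 1 + N)).2 hgeo) (fun i => ?_) fun m hm i z hz => ?_
      · exact (contDiffOn_chartBox (hsm1 _ _) (hrt q)).of_le (by exact_mod_cast le_top)
      · have := hbd (i + (n + 1) + N) (i + (n + 1)) m (by omega) (by omega) q hq z hz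
        rwa [show i + (n + 1 + N) = i + (n + 1) + N by omega]
    exact contMDiff_infty.2 h1
  refine ⟨_, hsm 0, fun p => ?_, fun N => ⟨_, hsm N, ?_⟩⟩
  · refine tsum_of_norm_bounded (g := fun j : ℕ => (1 / 4 : ℝ) * (1 / 2) ^ j) (a := 1 / 2) ?_ fun j => ?_
    · have := hasSum_geometric_two.mul_left (1 / 4 : ℝ)
      norm_num at this ⊢
      exact this
    · rcases Nat.eq_zero_or_pos j with rfl | hj
      · simp [hb0]
      · exact hpt j j le_rfl hj p
  · have h1 : ∀ᶠ δ : ℝ in 𝓝[>] 0, ∀ j ∈ Finset.range N, δ < ε j :=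
      (Finset.eventually_all _).2 fun j _ =>
        (gt_mem_nhds (hε0 j)).filter_mono nhdsWithin_le_nhds
    obtain ⟨δ, hδ, hδ0⟩ := (h1.and self_mem_nhdsWithin).exists
    refine ⟨δ, hδ0, fun p hp => ?_⟩
    rw [← (hsum 0 p).sum_add_tsum_nat_add N, ← tsum_mul_left]
    congr 1
    · refine Finset.sum_congr rfl fun j hj => ?_
      rw [add_zero, cutMono_eq j (hε0 j)]
      · simp
      · rw [abs_of_nonneg (D.x_nonneg p)]
        exact (hp.trans (hδ j hj)).le
    · refine tsum_congr fun i => ?_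
      rw [add_zero, ← cutMono_mul_pow i N (hε0 (i + N))]
      push_cast [Complex.real_smul]
      ring

end ProductDecomposition

end Borel

end

section

/-! ### The exponentially flat weight as a function on the whole line. -/

section Flat

/-- The function `t ^ s e ^ (-1 / t)`, extended by zero. -/
def flatWt (s t : ℝ) : ℝ := if t ≤ 0 then 0 else Real.exp (-t⁻¹) * t ^ s

/-- For t > 0 write t^s = t^(-M) t^(s+M). Negative integral powers are absorbed by e^(-1/t), and M ≥
n - s makes t^(s+M) of class C^n even at zero. -/
theorem contDiff_flatWt (s : ℝ) : ContDiff ℝ ∞ (flatWt s) := by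
  refine contDiff_infty.2 fun n => ?_
  obtain ⟨M, hM⟩ := exists_nat_ge (n - s)
  have h : flatWt s = fun t => (Polynomial.X ^ M : Polynomial ℝ).eval t⁻¹ * expNegInvGlue t *
      t ^ (s + M) := by
    funext t
    rcases le_or_gt t 0 with ht | ht
    · simp [flatWt, ht, expNegInvGlue]
    · rw [flatWt, expNegInvGlue, if_neg ht.not_ge, if_neg ht.not_ge, Real.rpow_add ht,
        Real.rpow_natCast, Polynomial.eval_pow, Polynomial.eval_X, inv_pow]
      field_simp
  rw [h]
  exact (expNegInvGlue.contDiff_polynomial_eval_inv_mul _).mul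
    (Real.contDiff_rpow_const_of_le (by linarith))

theorem flatWt_eq (s : ℝ) (N : ℕ) {t : ℝ} (ht : 0 ≤ t) : flatWt s t = t ^ N * flatWt (s - N) t := by
  rcases ht.eq_or_lt with rfl | ht
  · simp [flatWt]
  · rw [flatWt, flatWt, if_neg ht.not_ge, if_neg ht.not_ge, Real.rpow_sub_natCast ht.ne']
    field_simp

theorem wt_one (d : ℕ) {t : ℝ} (ht : 0 < t) : wt d 1 t = (flatWt (d / 2) t : ℂ) := by
  rw [flatWt, if_neg ht.not_ge, wt]
  push_cast
  congr 2
  field_simp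

end Flat

/-! ### Schwartz functions on the manifold. -/

variable {d : ℕ}
  {X : Type*} [TopologicalSpace X] [ChartedSpace (EuclideanHalfSpace (d + 1)) X]
  [IsManifold (𝓡∂ (d + 1)) ∞ X]
  {M : Type*} [TopologicalSpace M] [ChartedSpace (EuclideanSpace ℝ (Fin d)) M]
  [IsManifold (𝓡 d) ∞ M]

namespace ProductDecomposition

variable (D : ProductDecomposition d X M)

/-- Smoothness together with vanishing to infinite order at the boundary. -/
def Schw (a : X → ℂ) : Prop := ∀ N : ℕ, ∃ w, D.Sm w ∧ ∀ p, a p = (D.x p : ℂ) ^ N * w p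

variable {D} {a b : X → ℂ}

theorem Sm.star (ha : D.Sm a) : D.Sm fun p => star (a p) :=
  Complex.conjCLE.contDiff.contMDiff.comp ha

theorem Sm.inv (ha : D.Sm a) (h : ∀ p, a p ≠ 0) : D.Sm fun p => (a p)⁻¹ := fun p =>
  (contDiffAt_inv ℝ (h p)).contMDiffAt.comp p (ha p)

theorem Schw.sm (ha : D.Schw a) : D.Sm a := by
  obtain ⟨w, hw, h⟩ := ha 0
  have : a = w := funext fun p => by simpa using h p
  rwa [this]

theorem Schw.add (ha : D.Schw a) (hb : D.Schw b) : D.Schw fun p => a p + b p := fun N => by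
  obtain ⟨w, hw, h⟩ := ha N
  obtain ⟨w', hw', h'⟩ := hb N
  exact ⟨_, hw.add hw', fun p => by simp only [h, h']; ring⟩

theorem Schw.mul (ha : D.Schw a) (hb : D.Sm b) : D.Schw fun p => a p * b p := fun N => by
  obtain ⟨w, hw, h⟩ := ha N
  exact ⟨_, hw.mul hb, fun p => by simp only [h]; ring⟩

theorem Schw.neg (ha : D.Schw a) : D.Schw fun p => -a p := by
  simpa using ha.mul (Sm.const (-1))

theorem Schw.star (ha : D.Schw a) : D.Schw fun p => star (a p) := fun N => by
  obtain ⟨w, hw, h⟩ := ha N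
  exact ⟨_, hw.star, fun p => by simp [h]⟩

theorem Schw.flat (s : ℝ) : D.Schw fun p => (flatWt s (D.x p) : ℂ) := fun N =>
  ⟨_, Sm.comp_x (Complex.ofRealCLM.contDiff.comp (contDiff_flatWt (s - N))), fun p => by
    beta_reduce
    rw [flatWt_eq s N (D.x_nonneg p)]
    simp⟩

theorem smInt_wt (γ : ℂ) (ha : D.SmInt a) : D.SmInt fun p => wt d γ (D.x p) * a p :=
  (SmInt.comp_x (contDiffOn_wt d γ)).mul ha

end ProductDecomposition

/-! ### Transport equations, approximate eigenfunctions and the potential. -/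

open ProductDecomposition

variable {D : ProductDecomposition d X M} (G : ScatteringMetric D) {a b r s : X → ℂ} {γ : ℂ}

/-- The Laplacian maps `w a` to `w (-γ² a + x² r)`, where `w` is the weight `e^(-γ/x) x^(d/2)`. -/
def Conj (γ : ℂ) (a r : X → ℂ) : Prop := ∀ p, 0 < D.x p →
  G.laplacian (fun q => wt d γ (D.x q) * a q) p =
    wt d γ (D.x p) * (-γ ^ 2 * a p + (D.x p : ℂ) ^ 2 * r p)

variable {G}

theorem Conj.unique (h : Conj G γ a r) (h' : Conj G γ a s) {p : X} (hp : 0 < D.x p) :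
    r p = s p := by
  have h1 := (h p hp).symm.trans (h' p hp)
  have h2 : (D.x p : ℂ) ≠ 0 := by exact_mod_cast hp.ne'
  exact mul_left_cancel₀ (pow_ne_zero 2 h2)
    (add_left_cancel (mul_left_cancel₀ (wt_ne_zero d γ hp) h1))

theorem Conj.congr (h : Conj G γ a r) (ha : ∀ p, 0 < D.x p → b p = a p)
    (hr : ∀ p, 0 < D.x p → s p = r p) : Conj G γ b s := fun p hp => by
  rw [ha p hp, hr p hp, ← h p hp]
  exact laplacian_congr_int G (fun q hq => by rw [ha q hq]) hp

theorem Conj.add (h : Conj G γ a r) (h' : Conj G γ b s) (ha : D.SmInt a) (hb : D.SmInt b) :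
    Conj G γ (fun p => a p + b p) fun p => r p + s p := fun p hp => by
  simp only [mul_add]
  rw [laplacian_add G (smInt_wt γ ha) (smInt_wt γ hb) hp, h p hp, h' p hp]
  ring

theorem Conj.const_mul (h : Conj G γ a r) (c : ℂ) :
    Conj G γ (fun p => c * a p) fun p => c * r p := fun p hp => by
  simp only [mul_left_comm _ c]
  rw [laplacian_const_mul, h p hp]
  ring

theorem star_wt_one {t : ℝ} (ht : 0 < t) : star (wt d 1 t) = wt d 1 t := by
  rw [wt_one d ht]
  exact Complex.conj_ofReal _

/-- The weight with γ = 1 is real, so conjugation commutes with everything in sight. -/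
theorem Conj.star (h : Conj G 1 a r) :
    Conj G 1 (fun p => star (a p)) fun p => star (r p) := fun p hp => by
  have h1 := laplacian_star G (fun q => wt d 1 (D.x q) * a q) p
  rw [h p hp] at h1
  rw [laplacian_congr_int G (b := fun q => Star.star (wt d 1 (D.x q) * a q)) _ hp, h1]
  · rw [star_mul', star_wt_one hp]
    simp
  · intro q hq
    rw [star_mul', star_wt_one hq]

variable (G) in
theorem exists_conj [T2Space X] [CompactSpace X] (γ : ℂ) (ha : D.Sm a) :
    ∃ r, D.Sm r ∧ Conj G γ a r := by
  obtain ⟨T, K, hT, -, h, -⟩ := exists_conj_laplacian G γ ha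
  exact ⟨T, hT, h⟩

variable (G) in
-- The transport term -2γ x² η' a with η = x^(j+1) has one power of x less than everything else. Its
-- coefficient -2γ(j+1) is nonzero when γ ≠ 0, so a remainder x^j r can be removed by a correction
-- of order x^(j+1).
theorem exists_conj_pow [T2Space X] [CompactSpace X] (γ : ℂ) (ha : D.Sm a) (j : ℕ) :
    ∃ s, D.Sm s ∧ Conj G γ (fun p => (D.x p : ℂ) ^ (j + 1) * a p) fun p =>
      (D.x p : ℂ) ^ j * (-(2 * γ * (j + 1)) * a p) + (D.x p : ℂ) ^ (j + 1) * s p := by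
  obtain ⟨T, K, hT, hK, -, h⟩ := exists_conj_laplacian G γ ha
  obtain ⟨r, hr, hc⟩ := exists_conj G γ ((Sm.x.pow (j + 1)).mul ha)
  have hx : ∀ p, 0 < D.x p → (D.x p : ℂ) ≠ 0 := fun p hp => by exact_mod_cast hp.ne'
  have hη : ContDiff ℝ ∞ fun t : ℝ => (t : ℂ) ^ (j + 1) := Complex.ofRealCLM.contDiff.pow _
  have hd : ∀ i : ℕ, deriv (fun t : ℝ => (t : ℂ) ^ i) = fun t : ℝ => (i : ℂ) * (t : ℂ) ^ (i - 1) := by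
    intro i
    funext t
    simpa using ((hasDerivAt_ofReal_complex t).fun_pow i).deriv
  have hd2 : deriv (fun t : ℝ => ((j + 1 : ℕ) : ℂ) * (t : ℂ) ^ j) =
      fun t : ℝ => ((j + 1 : ℕ) : ℂ) * (j * (t : ℂ) ^ (j - 1)) := by
    funext t
    simpa using (((hasDerivAt_ofReal_complex t).fun_pow j).const_mul ((j + 1 : ℕ) : ℂ)).deriv
  have hnear : ∀ p, 0 < D.x p → D.x p < D.ε →
      (r p - (D.x p : ℂ) ^ j * (-(2 * γ * (j + 1)) * a p)) / (D.x p : ℂ) ^ (j + 1) =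
        T p - (j + 1) * K p - (j + 1) * j * a p := by
    intro p hp hε
    have h1 := (hc p hp).symm.trans (h _ hη.contDiffOn p hp hε)
    have h2 := mul_left_cancel₀ (wt_ne_zero d γ hp) h1
    rw [hd (j + 1)] at h2
    simp only [Nat.add_sub_cancel] at h2
    rw [hd2] at h2
    rw [div_eq_iff (pow_ne_zero _ (hx p hp))]
    refine mul_left_cancel₀ (pow_ne_zero 2 (hx p hp)) ?_
    -- The truncated exponent j - 1 is harmless at j = 0 because of the factor j.
    have h3 : (D.x p : ℂ) * (j * (D.x p : ℂ) ^ (j - 1)) = j * (D.x p : ℂ) ^ j := by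
      cases j with
      | zero => simp
      | succ j => rw [Nat.add_sub_cancel]; ring
    push_cast at h2
    linear_combination h2 - (D.x p : ℂ) ^ 3 * (j + 1) * a p * h3
  have hc' := fun c => Sm.const (D := D) c
  obtain ⟨s, hs, hse⟩ := SmInt.glue (D := D)
    ((hr.int.sub (((Sm.x.pow j).mul ((hc' (-(2 * γ * (j + 1)))).mul ha)).int)).div_x (j + 1))
    ((hT.sub ((hc' (j + 1)).mul hK)).sub ((hc' ((j + 1) * j)).mul ha)) D.ε_pos hnear
  refine ⟨s, hs, hc.congr (fun _ _ => rfl) fun p hp => ?_⟩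
  rw [← hse p hp, mul_div_cancel₀ _ (pow_ne_zero _ (hx p hp))]
  ring

theorem schw_of_interior (hr : D.Sm r)
    (hN : ∀ N : ℕ, ∃ w, D.Sm w ∧ ∀ p, 0 < D.x p → r p = (D.x p : ℂ) ^ N * w p) : D.Schw r :=
  fun N => by
    obtain ⟨w, hw, hwe⟩ := hN N
    exact ⟨w, hw, eq_of_eq_interior (D := D) (ContMDiff.continuous hr)
      (ContMDiff.continuous ((Sm.x.pow N).mul hw)) hwe⟩

variable (G) in
-- Factor x^(N+1) out of s and apply `exists_conj_pow`: the remainder is divisible by x^N. Since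
-- remainders are unique, one r works for all N.
theorem exists_conj_schw [T2Space X] [CompactSpace X] (γ : ℂ) (hs : D.Schw s) :
    ∃ r, D.Schw r ∧ Conj G γ s r := by
  obtain ⟨r, hr, hc⟩ := exists_conj G γ hs.sm
  refine ⟨r, schw_of_interior hr fun N => ?_, hc⟩
  obtain ⟨w, hw, hwe⟩ := hs (N + 1)
  obtain ⟨t, ht, htc⟩ := exists_conj_pow G γ hw N
  refine ⟨_, (((Sm.const (-(2 * γ * (N + 1)))).mul hw).add (Sm.x.mul ht)), fun p hp => ?_⟩
  rw [(hc.congr (fun p _ => (hwe p).symm) fun _ _ => rfl).unique htc hp]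
  ring

variable (G) in
/-- The formal solution of the transport equations, summed by Borel's lemma. -/
theorem exists_conj_eigen [T2Space X] [CompactSpace X] (hγ : γ ≠ 0) :
    ∃ a r, D.Sm a ∧ D.Schw r ∧ Conj G γ a r ∧ ∀ p, ‖a p - 1‖ ≤ 1 / 2 := by
  have hx : ∀ p, 0 < D.x p → (D.x p : ℂ) ≠ 0 := fun p hp => by exact_mod_cast hp.ne'
  -- solve the transport equations recursively
  let cf : ℕ → (X → ℂ) → X → ℂ := fun N r p => (2 * γ * (N + 1))⁻¹ * r p
  have hcf : ∀ N r, D.Sm r → D.Sm (cf N r) := fun N r hr => (Sm.const _).mul hr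
  choose! F hF hFc using fun (N : ℕ) (r : X → ℂ) (hr : D.Sm r) =>
    exists_conj_pow G γ (hcf N r hr) N
  obtain ⟨r0, hr0, hrc0⟩ := exists_conj G γ (Sm.const (D := D) 1)
  -- `R N` is the remainder left after N corrections, with its factor x^N removed.
  let R : ℕ → X → ℂ := fun N => Nat.rec r0 (fun N r => F N r) N
  have hR : ∀ N, D.Sm (R N) := fun N => by
    induction N with
    | zero => exact hr0
    | succ N ih => exact hF N _ ih
  -- The correction that removes the remainder of order x^N has order x^(N+1), hence the shift of
  -- index. The leading coefficient 1 is kept apart, so `b 0` is zero, as the Borel sum requires.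
  let b : ℕ → X → ℂ := fun j => Nat.casesOn j (fun _ => 0) fun N => cf N (R N)
  have hb : ∀ j, D.Sm (b j) := fun j => by
    cases j with
    | zero => exact Sm.const 0
    | succ N => exact hcf N _ (hR N)
  let A : ℕ → X → ℂ := fun N p => 1 + ∑ j ∈ Finset.range (N + 1), (D.x p : ℂ) ^ j * b j p
  have hA : ∀ N, D.Sm (A N) := fun N =>
    (Sm.const 1).add (Sm.sum fun j _ => (Sm.x.pow j).mul (hb j))
  have hAc : ∀ N, Conj G γ (A N) fun p => (D.x p : ℂ) ^ N * R N p := fun N => by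
    induction N with
    | zero => exact hrc0.congr (fun p _ => by simp [A, b]) fun p _ => by simp [R]
    | succ N ih =>
      refine (ih.add (hFc N _ (hR N)) (hA N).int ((Sm.x.pow _).mul (hcf N _ (hR N))).int).congr
        (fun p _ => ?_) fun p _ => ?_
      · simp only [A]
        rw [Finset.sum_range_succ _ (N + 1), add_assoc]
      · have h1 : (2 * γ * ((N : ℂ) + 1)) ≠ 0 :=
          mul_ne_zero (mul_ne_zero two_ne_zero hγ) (by exact_mod_cast N.succ_ne_zero)
        simp only [cf, R]
        rw [neg_mul, mul_inv_cancel_left₀ h1]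
        ring
  obtain ⟨β, hβ, hβ2, hβs⟩ := exists_borel_sum hb fun p => rfl
  have ha : D.Sm fun p => 1 + β p := (Sm.const 1).add hβ
  obtain ⟨r, hr, hrc⟩ := exists_conj G γ ha
  refine ⟨_, r, ha, schw_of_interior hr fun N => ?_, hrc, fun p => by simpa using hβ2 p⟩
  -- The Borel sum differs from the N-th partial solution by x^(N+1) times a smooth function. By
  -- `exists_conj_pow` this difference changes the remainder only at order x^N.
  obtain ⟨s, hs, δ, hδ, hsδ⟩ := hβs (N + 1)
  obtain ⟨t, ht, hte⟩ := SmInt.glue (D := D) ((ha.int.sub (hA N).int).div_x (N + 1)) hs hδ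
    fun p hp hpδ => by
      rw [div_eq_iff (pow_ne_zero _ (hx p hp)), hsδ p hpδ]
      simp only [A]
      ring
  obtain ⟨u, hu, huc⟩ := exists_conj_pow G γ ht N
  refine ⟨_, (hR N).add (((Sm.const (-(2 * γ * (N + 1)))).mul ht).add (Sm.x.mul hu)),
    fun p hp => ?_⟩
  rw [(hrc.congr (b := fun p => A N p + (D.x p : ℂ) ^ (N + 1) * t p) (fun p hp => ?_)
    fun _ _ => rfl).unique ((hAc N).add huc (hA N).int ((Sm.x.pow _).mul ht).int) hp]
  · ring
  · rw [← hte p hp, mul_div_cancel₀ _ (pow_ne_zero _ (hx p hp))]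
    ring

variable (G) in
-- Twice the real part of the formal solution. Since |a - 1| ≤ 1/2, the real part of a is at least
-- 1/2 and has no zeros.
theorem exists_conj_eigen_real [T2Space X] [CompactSpace X] :
    ∃ a r, D.Sm a ∧ D.Schw r ∧ Conj G 1 a r ∧ (∀ p, star (a p) = a p) ∧ ∀ p, a p ≠ 0 := by
  obtain ⟨a, r, ha, hr, hc, h⟩ := exists_conj_eigen G (one_ne_zero (α := ℂ))
  refine ⟨fun p => a p + star (a p), fun p => r p + star (r p), ha.add ha.star, hr.add hr.star,
    hc.add hc.star ha.int ha.star.int, fun p => by simp [add_comm], fun p h0 => ?_⟩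
  have h1 := (Complex.abs_re_le_norm (a p - 1)).trans (h p)
  have h2 : (a p).re = 0 := by
    have := congrArg Complex.re h0
    simp at this
    linarith
  rw [Complex.sub_re, h2] at h1
  norm_num at h1

variable (G) in
-- For γ = 1 each application multiplies the amplitude by -1 up to a Schwartz function, and the
-- conjugated Laplacian maps earlier Schwartz errors to Schwartz errors.
theorem exists_iterate_laplacian [T2Space X] [CompactSpace X] (ha : D.Sm a) (hr : D.Schw r)
    (hc : Conj G 1 a r) (k : ℕ) : ∃ s, D.Schw s ∧ ∀ p, 0 < D.x p →
      G.laplacian^[k] (fun q => wt d 1 (D.x q) * a q) p =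
        wt d 1 (D.x p) * ((-1) ^ k * a p + s p) := by
  induction k with
  | zero => exact ⟨fun _ => 0, fun N => ⟨_, Sm.const 0, by simp⟩, fun p _ => by simp⟩
  | succ k ih =>
    obtain ⟨s, hs, hse⟩ := ih
    obtain ⟨t, ht, htc⟩ := exists_conj_schw G 1 hs
    have h1 := ((hc.const_mul ((-1) ^ k)).add htc ((Sm.const _).mul ha).int hs.sm.int)
    refine ⟨fun p => -s p + (((-1) ^ k * r p + t p) * (D.x p : ℂ) ^ 2), hs.neg.add
      (Schw.mul ((hr.mul (Sm.const ((-1) ^ k))).add ht |> fun h => by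
        simpa only [mul_comm] using h) (Sm.x.pow 2)), fun p hp => ?_⟩
    rw [Function.iterate_succ_apply', laplacian_congr_int G hse hp, h1 p hp]
    ring

theorem star_iterate_laplacian (h : ∀ p, 0 < D.x p → star (a p) = a p) (k : ℕ) {p : X}
    (hp : 0 < D.x p) : star (G.laplacian^[k] a p) = G.laplacian^[k] a p := by
  induction k generalizing p with
  | zero => exact h p hp
  | succ k ih =>
    rw [Function.iterate_succ_apply', ← laplacian_star]
    exact laplacian_congr_int G (fun q hq => ih hq) hp

variable (G) in
-- For even k the iterate is w(a + s) with s Schwartz, so v = -s/a makes w a an exact eigenfunction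
-- with eigenvalue 1. Division by a keeps v Schwartz because a has no zeros.
theorem exists_potential [T2Space X] [CompactSpace X] {k : ℕ} (hk : Even k) :
    ∃ v a, D.Schw v ∧ (∀ p, star (v p) = v p) ∧ D.Sm a ∧ (∀ p, a p ≠ 0) ∧
      ∀ p, 0 < D.x p → G.laplacian^[k] (fun q => wt d 1 (D.x q) * a q) p +
        v p * (wt d 1 (D.x p) * a p) = wt d 1 (D.x p) * a p := by
  obtain ⟨a, r, ha, hr, hc, hreal, h0⟩ := exists_conj_eigen_real G
  obtain ⟨s, hs, hse⟩ := exists_iterate_laplacian G ha hr hc k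
  have hv : D.Schw fun p => -s p * (a p)⁻¹ := hs.neg.mul (ha.inv h0)
  refine ⟨_, a, hv, ?_, ha, h0, fun p hp => ?_⟩
  · refine eq_of_eq_interior (D := D) (ContMDiff.continuous hv.sm.star)
      (ContMDiff.continuous hv.sm) fun p hp => ?_
    have h1 := star_iterate_laplacian (G := G) (a := fun q => wt d 1 (D.x q) * a q)
      (fun q hq => by rw [star_mul', star_wt_one hq, hreal]) k hp
    rw [hse p hp, star_mul', star_wt_one hp, hk.neg_one_pow, one_mul, star_add, hreal] at h1
    have h2 := add_left_cancel (mul_left_cancel₀ (wt_ne_zero d 1 hp) h1)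
    rw [star_mul', star_neg, h2, star_inv₀, hreal]
  · rw [hse p hp, hk.neg_one_pow]
    field_simp [h0 p]
    ring

end

/-! ### The Riemannian volume measure. -/

section

theorem det_fderiv_eq_jac {n : ℕ} (τ : EuclideanSpace ℝ (Fin n) → EuclideanSpace ℝ (Fin n))
    (z : EuclideanSpace ℝ (Fin n)) : (fderiv ℝ τ z).det = (jac τ z).det := by
  rw [ContinuousLinearMap.det, ← LinearMap.det_toMatrix (EuclideanSpace.basisFun (Fin n) ℝ).toBasis]
  congr 1

variable {d : ℕ}
  {X : Type*} [TopologicalSpace X] [ChartedSpace (EuclideanHalfSpace (d + 1)) X]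
  [IsManifold (𝓡∂ (d + 1)) ∞ X]
  {M : Type*} [TopologicalSpace M] [ChartedSpace (EuclideanSpace ℝ (Fin d)) M]
  [IsManifold (𝓡 d) ∞ M]
  {D : ProductDecomposition d X M} (G : ScatteringMetric D)
  [MeasurableSpace X] [BorelSpace X]

theorem continuousOn_sqrt_det (P : Param d X) :
    ContinuousOn (fun z => √(gramOf G P.κ z).det) P.W := fun _ hz =>
  (ContDiffAt.continuousAt (contDiffWithinAt_univ.1 (contDiffWithinAt_sqrt_det
    (fun i j => ((contDiffOn_gramOf G P i j).contDiffAt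
      (P.isOpen_W.mem_nhds hz)).contDiffWithinAt)
    (gramOf_posDef G P hz).det_pos))).continuousWithinAt

/-- The Riemannian volume in a parametrization. -/
def paramVol (P : Param d X) : Measure X :=
  (((volume : Measure (Coord d)).restrict P.W).withDensity
    fun z => ENNReal.ofReal √(gramOf G P.κ z).det).map P.κ

theorem Param.measurableSet_preimage (P : Param d X) {A : Set X} (hA : MeasurableSet A) :
    MeasurableSet (P.W ∩ P.κ ⁻¹' A) := by
  have h1 : Measurable fun z : P.W => P.κ z :=
    (continuousOn_iff_continuous_domRestrict.1 P.κ_smooth.continuousOn).measurable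
  have h2 := MeasurableSet.subtype_image P.isOpen_W.measurableSet (h1 hA)
  convert h2 using 1
  ext z
  simp [and_comm]

theorem Param.aemeasurable (P : Param d X) : AEMeasurable P.κ
    (((volume : Measure (Coord d)).restrict P.W).withDensity
      fun z => ENNReal.ofReal √(gramOf G P.κ z).det) :=
  (P.κ_smooth.continuousOn.aemeasurable P.isOpen_W.measurableSet).mono_ac
    (withDensity_absolutelyContinuous _ _)

theorem paramVol_apply (P : Param d X) {A : Set X} (hA : MeasurableSet A) :
    paramVol G P A = ∫⁻ z in P.W ∩ P.κ ⁻¹' A, ENNReal.ofReal √(gramOf G P.κ z).det := by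
  rw [paramVol, Measure.map_apply_of_aemeasurable (P.aemeasurable G) hA, withDensity_apply',
    Measure.restrict_restrict' P.isOpen_W.measurableSet, inter_comm]

theorem measurable_image_param (P : Param d X) : MeasurableSet (P.κ '' P.W) :=
  P.isOpen_image.measurableSet

theorem paramVol_inter_image (P : Param d X) {A : Set X} (hA : MeasurableSet A) :
    paramVol G P (A ∩ P.κ '' P.W) = paramVol G P A := by
  rw [paramVol_apply G P hA, paramVol_apply G P (hA.inter (measurable_image_param P))]
  congr 2
  ext z
  simp only [mem_inter_iff, mem_preimage]
  exact ⟨fun h => ⟨h.1, h.2.1⟩, fun h => ⟨h.1, h.2, mem_image_of_mem _ h.1⟩⟩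

/-- Change of variables: |det J| times √det of the metric at the image point is √det(JᵀGJ), the
density of the pulled-back metric. -/
theorem paramVol_eq (P Q : Param d X) {A : Set X} (hA : MeasurableSet A) (hP : A ⊆ P.κ '' P.W)
    (hQ : A ⊆ Q.κ '' Q.W) : paramVol G P A = paramVol G Q A := by
  have himg : Q.W ∩ Q.κ ⁻¹' A = P.trans Q '' (P.W ∩ P.κ ⁻¹' A) := by
    ext w
    constructor
    · rintro ⟨hw, hwA⟩
      refine ⟨Q.trans P w, ⟨P.ι_mem (hP hwA), ?_⟩, Param.trans_trans hw (hP hwA)⟩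
      rw [mem_preimage, Param.κ_trans (hP hwA)]
      exact hwA
    · rintro ⟨z, ⟨hz, hzA⟩, rfl⟩
      refine ⟨Param.trans_mem (hQ hzA), ?_⟩
      rw [mem_preimage, Param.κ_trans (hQ hzA)]
      exact hzA
  have hinj : InjOn (P.trans Q) (P.W ∩ P.κ ⁻¹' A) := fun z hz w hw h => by
    rw [← Param.trans_trans hz.1 (hQ hz.2), h, Param.trans_trans hw.1 (hQ hw.2)]
  rw [paramVol_apply G P hA, paramVol_apply G Q hA, himg,
    lintegral_image_eq_lintegral_abs_det_fderiv_mul _ (P.measurableSet_preimage hA)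
      (fun z hz => (((Param.contDiffAt_trans hz.1 (hQ hz.2)).differentiableAt
        (by simp)).hasFDerivAt).hasFDerivWithinAt) hinj]
  refine setLIntegral_congr_fun (P.measurableSet_preimage hA) fun z hz => ?_
  rw [gramOf_trans G hz.1 (hQ hz.2), Matrix.det_mul, Matrix.det_mul, Matrix.det_transpose,
    det_fderiv_eq_jac, ← ENNReal.ofReal_mul (abs_nonneg _), mul_right_comm, ← sq,
    Real.sqrt_mul (sq_nonneg _), Real.sqrt_sq_eq_abs]

/-- The points lost lie on the frontier of the half-space, and the frontier of a convex set is null.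
-/
theorem volume_target_diff_interior (p : X) :
    volume ((extChartAt (𝓡∂ (d + 1)) p).target \ interior (extChartAt (𝓡∂ (d + 1)) p).target) = 0 := by
  refine measure_mono_null (fun z hz => ?_)
    ((𝓡∂ (d + 1)).convex_range.addHaar_frontier (volume : Measure (Coord d)))
  rw [(𝓡∂ (d + 1)).isClosed_range.frontier_eq]
  refine ⟨extChartAt_target_subset_range p hz.1, fun h => hz.2 ?_⟩
  have h1 : (extChartAt (𝓡∂ (d + 1)) p).target ∈ 𝓝[range (𝓡∂ (d + 1))] z :=
    extChartAt_target_mem_nhdsWithin_of_mem hz.1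
  rw [mem_interior_iff_mem_nhds]
  rwa [nhdsWithin_eq_nhds.2 (mem_interior_iff_mem_nhds.1 h)] at h1

theorem chartVolume_eq (p : X) : G.chartVolume p = paramVol G (Param.chart (d := d) p) := by
  have h1 : (extChartAt (𝓡∂ (d + 1)) p).target =ᵐ[(volume : Measure (Coord d))]
      (Param.chart (d := d) p).W := by
    rw [ae_eq_set]
    refine ⟨volume_target_diff_interior p, ?_⟩
    rw [sdiff_eq_empty.2]
    · exact measure_empty
    · exact interior_subset
  have h2 : (fun z => ENNReal.ofReal √(G.gram p z).det)
      =ᵐ[(volume : Measure (Coord d)).restrict (Param.chart (d := d) p).W]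
      fun z => ENNReal.ofReal √(gramOf G (Param.chart (d := d) p).κ z).det := by
    filter_upwards [ae_restrict_mem (Param.chart (d := d) p).isOpen_W.measurableSet] with z hz
    rw [gram_eq_gramOf G p hz]
  rw [ScatteringMetric.chartVolume, paramVol, Measure.restrict_congr_set h1,
    withDensity_congr_ae h2]
  rfl

theorem paramVol_chart_le (p : X) : paramVol G (Param.chart (d := d) p) ≤ G.vol := by
  rw [← chartVolume_eq]
  exact le_iSup G.chartVolume p

theorem vol_le {μ : Measure X} (h : ∀ p, paramVol G (Param.chart (d := d) p) ≤ μ) : G.vol ≤ μ :=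
  iSup_le fun p => (chartVolume_eq G p).trans_le (h p)

/-- A supremum of measures is bounded above by exhibiting a dominating measure. Here it is the
measure of the parametrization together with the volume off its image; `paramVol_eq` shows that it
dominates every chart measure. -/
theorem vol_restrict_le (P : Param d X) : G.vol.restrict (P.κ '' P.W) ≤ paramVol G P := by
  have hO := measurable_image_param P
  have h : G.vol ≤ paramVol G P + G.vol.restrict (P.κ '' P.W)ᶜ := by
    refine vol_le G fun p => Measure.le_iff.2 fun A hA => ?_
    set Q := Param.chart (d := d) p
    have hQO := measurable_image_param Q
    rw [Measure.add_apply, Measure.restrict_apply hA, ← measure_inter_add_sdiff A hO]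
    refine add_le_add ?_ ?_
    · rw [← paramVol_inter_image G Q (hA.inter hO),
        ← paramVol_eq G P Q ((hA.inter hO).inter hQO) (inter_subset_left.trans inter_subset_right)
          inter_subset_right]
      exact measure_mono (inter_subset_left.trans inter_subset_left)
    · exact paramVol_chart_le G p _
  calc G.vol.restrict (P.κ '' P.W)
      ≤ (paramVol G P + G.vol.restrict (P.κ '' P.W)ᶜ).restrict (P.κ '' P.W) :=
        Measure.restrict_mono subset_rfl h
    _ ≤ paramVol G P := by
        rw [Measure.restrict_add, Measure.restrict_restrict hO, inter_compl_self,
          Measure.restrict_empty, add_zero]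
        exact Measure.restrict_le_self

/-- For the reverse inequality, finitely many charts cover X. On the part of the image inside one
chart the measure equals a chart measure, which lies below the supremum. -/
theorem vol_restrict_param [CompactSpace X] (P : Param d X) :
    G.vol.restrict (P.κ '' P.W) = paramVol G P := by
  have hO := measurable_image_param P
  obtain ⟨t, ht⟩ := isCompact_univ.elim_finite_subcover
    (fun q : X => (chartAt (EuclideanHalfSpace (d + 1)) q).source)
    (fun q => (chartAt _ q).open_source) (fun q _ => mem_iUnion.2 ⟨q, mem_chart_source _ q⟩)
  have hcov : ⋃ q : t, (chartAt (EuclideanHalfSpace (d + 1)) (q : X)).source = univ := by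
    refine eq_univ_of_univ_subset (ht.trans ?_)
    rw [iUnion_subtype]
  refine (Measure.ext_iff_of_iUnion_eq_univ hcov).2 fun q => Measure.ext fun A hA => ?_
  have hS : MeasurableSet (chartAt (EuclideanHalfSpace (d + 1)) (q : X)).source :=
    (chartAt _ (q : X)).open_source.measurableSet
  rw [Measure.restrict_apply hA, Measure.restrict_apply hA]
  set B := A ∩ (chartAt (EuclideanHalfSpace (d + 1)) (q : X)).source
  have hB : MeasurableSet B := hA.inter hS
  refine le_antisymm (vol_restrict_le G P _) ?_
  set Q := Param.chart (d := d) (q : X)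
  have h1 : B ∩ P.κ '' P.W ⊆ Q.κ '' Q.W := by
    rintro x ⟨hxB, z, hz, rfl⟩
    rw [Param.chart_image]
    exact ⟨hxB.2, P.κ_int z hz⟩
  rw [Measure.restrict_apply hB, ← paramVol_inter_image G P hB,
    paramVol_eq G P Q (hB.inter hO) inter_subset_right h1]
  exact paramVol_chart_le G _ _

/-- The restriction of the volume to the interior still dominates every chart measure, so it
dominates their supremum. -/
theorem vol_boundary : G.vol {p | D.x p = 0} = 0 := by
  have hS : MeasurableSet {p | 0 < D.x p} := D.isOpen_pos.measurableSet
  have h : G.vol ≤ G.vol.restrict {p | 0 < D.x p} := by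
    refine vol_le G fun p => Measure.le_iff.2 fun A hA => ?_
    rw [Measure.restrict_apply hA]
    refine le_trans ?_ (paramVol_chart_le G p _)
    rw [← paramVol_inter_image G _ hA]
    refine measure_mono (inter_subset_inter_right _ ?_)
    rw [Param.chart_image, D.interior_eq]
    exact inter_subset_right
  refine le_antisymm ((h _).trans ?_) zero_le
  rw [Measure.restrict_apply' hS]
  have : {p | D.x p = 0} ∩ {p | 0 < D.x p} = ∅ := by
    ext p
    simp only [mem_inter_iff, mem_ofPred_eq, mem_empty_iff_false, iff_false, not_and]
    intro h0
    rw [h0]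
    exact lt_irrefl 0
  rw [this, measure_empty]

theorem ae_pos : ∀ᵐ p ∂G.vol, 0 < D.x p := by
  rw [ae_iff]
  convert vol_boundary G using 2
  ext p
  have := D.x_nonneg p
  simp only [mem_ofPred_eq, not_lt]
  exact ⟨fun h => le_antisymm h this, fun h => h.le⟩

/-- The volume is finite away from the boundary. -/
theorem vol_lt_top [CompactSpace X] {δ : ℝ} (hδ : 0 < δ) : G.vol {p | δ ≤ D.x p} < ⊤ := by
  have hc : IsCompact {p | δ ≤ D.x p} := (isClosed_Ici.preimage D.x_continuous).isCompact
  refine hc.measure_lt_top_of_nhdsWithin fun p hp => ?_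
  set P := Param.chart (d := d) p
  have hpP : p ∈ P.κ '' P.W :=
    Param.mem_chart_image ((D.mem_interior_iff p).2 (lt_of_lt_of_le hδ hp))
  have hW := P.ι_mem hpP
  obtain ⟨K, hK, hzK, hKW⟩ := exists_compact_subset P.isOpen_W hW
  obtain ⟨C, hC⟩ := hK.exists_bound_of_continuousOn ((continuousOn_sqrt_det G P).mono hKW)
  set A := P.κ '' P.W ∩ P.ι ⁻¹' interior K with hAdef
  have hA : IsOpen A :=
    P.ι_smooth.continuousOn.isOpen_inter_preimage P.isOpen_image isOpen_interior
  refine ⟨A, mem_nhdsWithin_of_mem_nhds (hA.mem_nhds ⟨hpP, hzK⟩), ?_⟩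
  have h1 : G.vol A ≤ paramVol G P A := by
    refine le_trans (le_of_eq ?_) (vol_restrict_le G P A)
    rw [Measure.restrict_apply hA.measurableSet, inter_eq_left.2 inter_subset_left]
  refine h1.trans_lt ?_
  rw [paramVol_apply G P hA.measurableSet]
  have h2 : P.W ∩ P.κ ⁻¹' A ⊆ K := by
    rintro z ⟨hz, -, hzA⟩
    rw [mem_preimage, P.ι_κ z hz] at hzA
    exact interior_subset hzA
  calc _ ≤ ∫⁻ z in K, ENNReal.ofReal √(gramOf G P.κ z).det := lintegral_mono_set h2
    _ ≤ ∫⁻ _ in K, ENNReal.ofReal C :=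
        setLIntegral_mono' hK.measurableSet fun z hz =>
          ENNReal.ofReal_le_ofReal ((le_abs_self _).trans (hC z hz))
    _ < ⊤ := by
        rw [setLIntegral_const]
        exact ENNReal.mul_lt_top ENNReal.ofReal_lt_top hK.measure_lt_top

end

section

/-! ### Product boxes in collar coordinates, with explicit volume. -/

section Slab

variable {d : ℕ}

/-- The cube of radius `ρ` about `y`. -/
def cube (y : EuclideanSpace ℝ (Fin d)) (ρ : ℝ) : Set (EuclideanSpace ℝ (Fin d)) :=
  {w | ∀ i, |w i - y i| ≤ ρ}

/-- The points `(t, w)` with `t₀ < t ≤ t₁` and `w` in a cube. -/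
def slab (y : EuclideanSpace ℝ (Fin d)) (ρ t₀ t₁ : ℝ) : Set (Coord d) :=
  {z | z 0 ∈ Ioc t₀ t₁ ∧ tailL z ∈ cube y ρ}

theorem cube_eq_image {y : EuclideanSpace ℝ (Fin d)} {ρ : ℝ} (hρ : 0 ≤ ρ) :
    cube y ρ = WithLp.toLp 2 '' Metric.closedBall (WithLp.ofLp y) ρ := by
  ext w
  constructor
  · intro h
    refine ⟨WithLp.ofLp w, ?_, rfl⟩
    rw [Metric.mem_closedBall, dist_pi_le_iff hρ]
    exact fun i => h i
  · rintro ⟨v, hv, rfl⟩ i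
    rw [Metric.mem_closedBall, dist_pi_le_iff hρ] at hv
    exact hv i

theorem isCompact_cube {y : EuclideanSpace ℝ (Fin d)} {ρ : ℝ} (hρ : 0 ≤ ρ) :
    IsCompact (cube y ρ) := by
  rw [cube_eq_image hρ]
  exact (isCompact_closedBall _ _).image (PiLp.continuous_toLp 2 _)

theorem exists_cube_subset {U : Set (EuclideanSpace ℝ (Fin d))} {y : EuclideanSpace ℝ (Fin d)}
    (hU : U ∈ 𝓝 y) : ∃ ρ > 0, cube y ρ ⊆ U := by
  have h1 : WithLp.toLp 2 ⁻¹' U ∈ 𝓝 (WithLp.ofLp y) :=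
    (PiLp.continuous_toLp 2 _).continuousAt.preimage_mem_nhds hU
  obtain ⟨ρ, hρ, h⟩ := Metric.nhds_basis_closedBall.mem_iff.1 h1
  refine ⟨ρ, hρ, ?_⟩
  rw [cube_eq_image hρ.le]
  exact image_subset_iff.2 h

theorem cube_mem_nhds (y : EuclideanSpace ℝ (Fin d)) {ρ : ℝ} (hρ : 0 < ρ) : cube y ρ ∈ 𝓝 y := by
  have h1 : WithLp.ofLp ⁻¹' Metric.closedBall (WithLp.ofLp y) ρ ∈ 𝓝 y :=
    (PiLp.continuous_ofLp 2 _).continuousAt.preimage_mem_nhds (Metric.closedBall_mem_nhds _ hρ)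
  filter_upwards [h1] with w hw
  rw [cube_eq_image hρ.le]
  exact ⟨_, hw, rfl⟩

theorem slab_eq_preimage (y : EuclideanSpace ℝ (Fin d)) (ρ t₀ t₁ : ℝ) :
    slab y ρ t₀ t₁ = WithLp.ofLp ⁻¹' Set.pi univ
      (Fin.cons (Ioc t₀ t₁) fun i => Icc (y i - ρ) (y i + ρ) : Fin (d + 1) → Set ℝ) := by
  ext z
  simp only [slab, cube, mem_ofPred_eq, mem_preimage, Set.mem_pi, mem_univ, true_imp_iff,
    Fin.forall_fin_succ, Fin.cons_zero, Fin.cons_succ, tailL_apply, abs_le, Set.mem_Icc]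
  refine and_congr_right fun _ => forall_congr' fun i => ?_
  constructor <;> rintro ⟨h1, h2⟩ <;> constructor <;> linarith

theorem measurableSet_slab (y : EuclideanSpace ℝ (Fin d)) (ρ t₀ t₁ : ℝ) :
    MeasurableSet (slab y ρ t₀ t₁) := by
  rw [slab_eq_preimage]
  refine (PiLp.volume_preserving_ofLp (Fin (d + 1))).measurable (MeasurableSet.univ_pi fun i => ?_)
  refine Fin.cases ?_ (fun i => ?_) i
  · exact measurableSet_Ioc
  · exact measurableSet_Icc

theorem volume_slab (y : EuclideanSpace ℝ (Fin d)) (ρ t₀ t₁ : ℝ) :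
    volume (slab y ρ t₀ t₁) = ENNReal.ofReal (t₁ - t₀) * ENNReal.ofReal (2 * ρ) ^ d := by
  rw [slab_eq_preimage, (PiLp.volume_preserving_ofLp (Fin (d + 1))).measure_preimage, volume_pi_pi,
    Fin.prod_univ_succ]
  · simp only [Fin.cons_zero, Fin.cons_succ, Real.volume_Ioc, Real.volume_Icc]
    congr 1
    simp [two_mul]
  · refine (MeasurableSet.univ_pi fun i => ?_).nullMeasurableSet
    refine Fin.cases ?_ (fun i => ?_) i
    · exact measurableSet_Ioc
    · exact measurableSet_Icc

end Slab

/-! ### Two-sided bounds for integrals of functions of x near the boundary. -/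

variable {d : ℕ}
  {X : Type*} [TopologicalSpace X] [ChartedSpace (EuclideanHalfSpace (d + 1)) X]
  [IsManifold (𝓡∂ (d + 1)) ∞ X]
  {M : Type*} [TopologicalSpace M] [ChartedSpace (EuclideanSpace ℝ (Fin d)) M]
  [IsManifold (𝓡 d) ∞ M]
  {D : ProductDecomposition d X M} (G : ScatteringMetric D)

/-- The density √det H is continuous and positive on a compact box that includes the face x = 0, so
it has positive bounds that are uniform up to the boundary. -/
theorem exists_slab_bound (m : M) : ∃ ρ > 0, ∃ c > 0, ∃ C > 0,
    (∀ t₀ t₁, 0 ≤ t₀ → t₁ ≤ D.ε / 2 → slab (extChartAt (𝓡 d) m m) ρ t₀ t₁ ⊆ D.W m) ∧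
    ∀ z ∈ slab (extChartAt (𝓡 d) m m) ρ 0 (D.ε / 2),
      c ≤ √(collarH G m z).det ∧ √(collarH G m z).det ≤ C := by
  obtain ⟨ρ, hρ, hcube⟩ := exists_cube_subset (extChartAt_target_mem_nhds (I := 𝓡 d) m)
  set y := extChartAt (𝓡 d) m m
  let K : Set (Coord d) := (fun q : ℝ × EuclideanSpace ℝ (Fin d) => consE q.1 q.2) ''
    (Icc 0 (D.ε / 2) ×ˢ cube y ρ)
  have hcont : Continuous fun q : ℝ × EuclideanSpace ℝ (Fin d) => consE q.1 q.2 :=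
    (continuous_fst.smul continuous_const).add ((injL (d := d)).continuous.comp continuous_snd)
  have hK : IsCompact K := (isCompact_Icc.prod (isCompact_cube hρ.le)).image hcont
  have hε := D.ε_pos
  have hKS : K ⊆ D.S m := by
    rintro _ ⟨⟨t, w⟩, ⟨ht, hw⟩, rfl⟩
    refine ⟨?_, ?_, ?_⟩
    · simpa using ht.1
    · simpa using lt_of_le_of_lt ht.2 (half_lt_self hε)
    · simpa using hcube hw
  have hsub : ∀ z, z 0 ∈ Icc 0 (D.ε / 2) → tailL z ∈ cube y ρ → z ∈ K := fun z h1 h2 =>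
    ⟨(z 0, tailL z), ⟨h1, h2⟩, consE_tailL z⟩
  have hcd : ContinuousOn (fun z => √(collarH G m z).det) K := fun z hz =>
    ((contDiffWithinAt_sqrt_det (fun i j => contDiffOn_collarH G m i j z (hKS hz))
      (collarH_det_pos G m (hKS hz))).continuousWithinAt).mono hKS
  have hne : K.Nonempty := ⟨consE 0 y, hsub _ (by simpa using (half_pos hε).le) (by simp [cube, hρ.le])⟩
  obtain ⟨z₁, hz₁, hmin⟩ := hK.exists_isMinOn hne hcd
  obtain ⟨z₂, hz₂, hmax⟩ := hK.exists_isMaxOn hne hcd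
  refine ⟨ρ, hρ, _, Real.sqrt_pos.2 (collarH_det_pos G m (hKS hz₁)), _,
    Real.sqrt_pos.2 (collarH_det_pos G m (hKS hz₂)), ?_, ?_⟩
  · rintro t₀ t₁ h0 h1 z ⟨hz, hw⟩
    have h2 := hKS (hsub z ⟨h0.trans hz.1.le, hz.2.trans h1⟩ hw)
    exact ⟨lt_of_le_of_lt h0 hz.1, h2.2⟩
  · rintro z ⟨hz, hw⟩
    have h := hsub z ⟨hz.1.le, hz.2⟩ hw
    exact ⟨hmin h, hmax h⟩

theorem sqrt_det_collar (m : M) {z : Coord d} (hz : z ∈ D.W m) :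
    √(gramOf G (D.param m).κ z).det = (z 0 ^ (d + 2))⁻¹ * √(collarH G m z).det := by
  change √(gramOf G (D.κ m) z).det = _
  rw [gramOf_collar G m hz, collarGram_sqrt_det hz.1]

variable [MeasurableSpace X] [BorelSpace X]

theorem Param.measurableSet_image_inter (P : Param d X) {T : Set (Coord d)} (hT : MeasurableSet T) :
    MeasurableSet (P.κ '' P.W ∩ P.ι ⁻¹' T) := by
  have h1 : Measurable fun p : P.κ '' P.W => P.ι p :=
    (continuousOn_iff_continuous_domRestrict.1 P.ι_smooth.continuousOn).measurable
  have h2 := MeasurableSet.subtype_image P.isOpen_image.measurableSet (h1 hT)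
  convert h2 using 1
  ext z
  simp [and_comm]

theorem setLIntegral_vol_param [CompactSpace X] (P : Param d X) {T : Set (Coord d)}
    (hT : MeasurableSet T) (hTW : T ⊆ P.W) {f : X → ℝ≥0∞} (hf : Measurable f) :
    ∫⁻ p in P.κ '' P.W ∩ P.ι ⁻¹' T, f p ∂G.vol =
      ∫⁻ z in T, ENNReal.ofReal √(gramOf G P.κ z).det * f (P.κ z) := by
  have hA := P.measurableSet_image_inter hT
  set A := P.κ '' P.W ∩ P.ι ⁻¹' T with hAdef
  have h1 : (G.vol.restrict A) = (paramVol G P).restrict A := by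
    rw [← vol_restrict_param, Measure.restrict_restrict hA, inter_eq_left.2 inter_subset_left]
  have hd : AEMeasurable (fun z => ENNReal.ofReal √(gramOf G P.κ z).det)
      ((volume : Measure (Coord d)).restrict P.W) :=
    ((continuousOn_sqrt_det G P).aemeasurable P.isOpen_W.measurableSet).ennreal_ofReal
  rw [h1, ← lintegral_indicator hA, paramVol, lintegral_map' (hf.indicator hA).aemeasurable
    (P.aemeasurable G), lintegral_withDensity_eq_lintegral_mul_non_measurable₀ _ hd
    (Eventually.of_forall fun _ => ENNReal.ofReal_lt_top)]
  have h2 : T = T ∩ P.W := (inter_eq_left.2 hTW).symm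
  conv_rhs => rw [h2, ← Measure.restrict_restrict hT, ← lintegral_indicator hT]
  refine setLIntegral_congr_fun P.isOpen_W.measurableSet fun z hz => ?_
  simp only [Pi.mul_apply]
  by_cases hzT : z ∈ T
  · have : P.κ z ∈ A := ⟨mem_image_of_mem _ hz, by rwa [mem_preimage, P.ι_κ z hz]⟩
    rw [indicator_of_mem this, indicator_of_mem hzT]
  · have : P.κ z ∉ A := fun h => hzT (by have := h.2; rwa [mem_preimage, P.ι_κ z hz] at this)
    rw [indicator_of_notMem this, indicator_of_notMem hzT, mul_zero]

theorem measurable_x : Measurable D.x := D.x_continuous.measurable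

/-- Integrals of functions of `x` near the boundary, over a cube in the boundary. -/
theorem setLIntegral_slab [CompactSpace X] (m : M) {y : EuclideanSpace ℝ (Fin d)} {ρ t₀ t₁ : ℝ}
    (hs : slab y ρ t₀ t₁ ⊆ D.W m) {F : ℝ → ℝ≥0∞} (hF : Measurable F) :
    ∫⁻ p in D.κ m '' D.W m ∩ D.ι m ⁻¹' slab y ρ t₀ t₁, F (D.x p) ∂G.vol =
      ∫⁻ z in slab y ρ t₀ t₁, ENNReal.ofReal √(collarH G m z).det *
        (F (z 0) * ENNReal.ofReal ((z 0 ^ (d + 2))⁻¹)) := by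
  have h := setLIntegral_vol_param G (D.param m) (measurableSet_slab y ρ t₀ t₁) hs
    (hF.comp (measurable_x (D := D)))
  refine h.trans (setLIntegral_congr_fun (measurableSet_slab y ρ t₀ t₁) fun z hz => ?_)
  have h1 : D.x ((D.param m).κ z) = z 0 := D.x_κ (D.W_subset_S m (hs hz))
  have h2 : 0 < z 0 := (hs hz).1
  simp only [Function.comp_apply]
  rw [sqrt_det_collar G m (hs hz), h1, ENNReal.ofReal_mul (by positivity)]
  ring

/-- Upper bounds for integrals of functions of `x` near the boundary. -/
theorem exists_setLIntegral_x_le [CompactSpace X] [CompactSpace M] :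
    ∃ C : ℝ≥0∞, C ≠ ⊤ ∧ ∀ F : ℝ → ℝ≥0∞, Measurable F → ∀ (B : ℝ≥0∞) (t₀ t₁ : ℝ), 0 ≤ t₀ →
      t₁ ≤ D.ε / 2 → (∀ t ∈ Ioc t₀ t₁, F t * ENNReal.ofReal ((t ^ (d + 2))⁻¹) ≤ B) →
      ∫⁻ p in {p | D.x p ∈ Ioc t₀ t₁}, F (D.x p) ∂G.vol ≤ C * B * ENNReal.ofReal (t₁ - t₀) := by
  choose ρ hρ c hc C hC hW hcC using exists_slab_bound G (D := D)
  -- Interiors of cubes are needed only to extract a finite cover of `M`; the integrals are then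
  -- taken over the full cubes, where overlaps do no harm to an upper bound.
  let U : M → Set M := fun m => (extChartAt (𝓡 d) m).source ∩
    extChartAt (𝓡 d) m ⁻¹' interior (cube (extChartAt (𝓡 d) m m) (ρ m))
  obtain ⟨s, hs⟩ := isCompact_univ.elim_finite_subcover U
    (fun m => (continuousOn_extChartAt m).isOpen_inter_preimage (isOpen_extChartAt_source m)
      isOpen_interior)
    (fun m _ => mem_iUnion.2 ⟨m, mem_extChartAt_source m,
      mem_interior_iff_mem_nhds.2 (cube_mem_nhds _ (hρ m))⟩)
  refine ⟨∑ m ∈ s, ENNReal.ofReal (C m) * ENNReal.ofReal (2 * ρ m) ^ d,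
    (ENNReal.sum_lt_top.2 fun m _ => ENNReal.mul_lt_top ENNReal.ofReal_lt_top
      (ENNReal.pow_lt_top ENNReal.ofReal_lt_top)).ne, ?_⟩
  intro F hF B t₀ t₁ h0 h1 hB
  let A : M → Set X := fun m =>
    D.κ m '' D.W m ∩ D.ι m ⁻¹' slab (extChartAt (𝓡 d) m m) (ρ m) t₀ t₁
  have hcov : {p | D.x p ∈ Ioc t₀ t₁} ⊆ ⋃ m ∈ s, A m := by
    intro p hp
    obtain ⟨m, hm, hpm⟩ : ∃ m ∈ s, D.y p ∈ U m := by simpa using hs (mem_univ (D.y p))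
    have hx0 : 0 < D.x p := lt_of_le_of_lt h0 hp.1
    have hxε : D.x p < D.ε := lt_of_le_of_lt (hp.2.trans h1) (half_lt_self D.ε_pos)
    refine mem_iUnion₂.2 ⟨m, hm, ?_, ?_⟩
    · rw [D.κ_image]
      exact ⟨⟨hxε, hpm.1⟩, hx0⟩
    · refine ⟨?_, ?_⟩
      · simpa [ProductDecomposition.ι] using hp
      · simpa [ProductDecomposition.ι] using interior_subset hpm.2
  calc ∫⁻ p in {p | D.x p ∈ Ioc t₀ t₁}, F (D.x p) ∂G.vol
      ≤ ∫⁻ p in ⋃ m ∈ s, A m, F (D.x p) ∂G.vol := lintegral_mono_set hcov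
    _ ≤ ∑ m ∈ s, ∫⁻ p in A m, F (D.x p) ∂G.vol := by
        have h2 : ⋃ m ∈ s, A m = ⋃ m : s, A m := by rw [iUnion_subtype]
        rw [h2]
        refine (lintegral_iUnion_le (fun m : s => A m) fun p => F (D.x p)).trans_eq ?_
        rw [tsum_fintype, Finset.sum_coe_sort s fun m => ∫⁻ p in A m, F (D.x p) ∂G.vol]
    _ ≤ ∑ m ∈ s, ENNReal.ofReal (C m) * ENNReal.ofReal (2 * ρ m) ^ d * B *
          ENNReal.ofReal (t₁ - t₀) := by
        refine Finset.sum_le_sum fun m _ => ?_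
        rw [setLIntegral_slab G m (hW m t₀ t₁ h0 h1) hF]
        calc _ ≤ ∫⁻ _ in slab (extChartAt (𝓡 d) m m) (ρ m) t₀ t₁, ENNReal.ofReal (C m) * B :=
              setLIntegral_mono' (measurableSet_slab _ _ _ _) fun z hz => by
                gcongr
                · exact (hcC m z ⟨⟨lt_of_le_of_lt h0 hz.1.1, hz.1.2.trans h1⟩, hz.2⟩).2
                · exact hB _ hz.1
          _ = _ := by
              rw [setLIntegral_const, volume_slab]
              ring
    _ = _ := by rw [Finset.sum_mul, Finset.sum_mul]

/-- Lower bounds for integrals of functions of `x` near the boundary. -/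
theorem exists_le_setLIntegral_x [CompactSpace X] [Nonempty M] :
    ∃ c : ℝ≥0∞, c ≠ 0 ∧ ∀ F : ℝ → ℝ≥0∞, Measurable F → ∀ (B : ℝ≥0∞) (t₀ t₁ : ℝ), 0 ≤ t₀ →
      t₁ ≤ D.ε / 2 → (∀ t ∈ Ioc t₀ t₁, B ≤ F t * ENNReal.ofReal ((t ^ (d + 2))⁻¹)) →
      c * B * ENNReal.ofReal (t₁ - t₀) ≤ ∫⁻ p in {p | D.x p ∈ Ioc t₀ t₁}, F (D.x p) ∂G.vol := by
  obtain ⟨m⟩ := ‹Nonempty M›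
  obtain ⟨ρ, hρ, c, hc, C, hC, hW, hcC⟩ := exists_slab_bound G (D := D) m
  refine ⟨ENNReal.ofReal c * ENNReal.ofReal (2 * ρ) ^ d, ?_, ?_⟩
  · refine mul_ne_zero (by simpa using hc) (pow_ne_zero _ ?_)
    simpa using hρ
  intro F hF B t₀ t₁ h0 h1 hB
  calc _ = ∫⁻ _ in slab (extChartAt (𝓡 d) m m) ρ t₀ t₁, ENNReal.ofReal c * B := by
        rw [setLIntegral_const, volume_slab]
        ring
    _ ≤ ∫⁻ z in slab (extChartAt (𝓡 d) m m) ρ t₀ t₁, ENNReal.ofReal √(collarH G m z).det *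
        (F (z 0) * ENNReal.ofReal ((z 0 ^ (d + 2))⁻¹)) :=
        setLIntegral_mono' (measurableSet_slab _ _ _ _) fun z hz => by
          gcongr
          · exact (hcC z ⟨⟨lt_of_le_of_lt h0 hz.1.1, hz.1.2.trans h1⟩, hz.2⟩).1
          · exact hB _ hz.1
    _ = _ := (setLIntegral_slab G m (hW t₀ t₁ h0 h1) hF).symm
    _ ≤ _ := lintegral_mono_set <| by
        rintro p ⟨⟨z, hz, rfl⟩, hp⟩
        have h2 := hp.1
        simpa [ProductDecomposition.ι] using h2

end

section

/-! ### Square integrability and norms in L². -/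

section LTwo

variable {α : Type*} [MeasurableSpace α] {μ : Measure α} {f : α → ℂ}

theorem eLpNorm_two_sq : eLpNorm f 2 μ ^ 2 = ∫⁻ a, ‖f a‖ₑ ^ 2 ∂μ := by
  have h := eLpNorm_nnreal_pow_eq_lintegral (μ := μ) (f := f) (p := 2) two_ne_zero
  simpa [ENNReal.rpow_ofNat] using h

theorem memLp_two_of_lintegral_lt_top (hf : AEStronglyMeasurable f μ)
    (h : ∫⁻ a, ‖f a‖ₑ ^ 2 ∂μ < ⊤) : MemLp f 2 μ := by
  refine ⟨hf, ?_⟩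
  rw [← eLpNorm_two_sq] at h
  exact (ENNReal.pow_lt_top_iff.1 h).resolve_right two_ne_zero

theorem norm_toLp_sq (hf : MemLp f 2 μ) :
    ‖hf.toLp f‖ ^ 2 = (∫⁻ a, ‖f a‖ₑ ^ 2 ∂μ).toReal := by
  rw [Lp.norm_toLp, ← ENNReal.toReal_pow, eLpNorm_two_sq]

end LTwo

variable {d : ℕ}
  {X : Type*} [TopologicalSpace X] [ChartedSpace (EuclideanHalfSpace (d + 1)) X]
  [IsManifold (𝓡∂ (d + 1)) ∞ X]
  {M : Type*} [TopologicalSpace M] [ChartedSpace (EuclideanSpace ℝ (Fin d)) M]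
  [IsManifold (𝓡 d) ∞ M]
  {D : ProductDecomposition d X M} (G : ScatteringMetric D) {a : X → ℂ}

open ProductDecomposition

theorem Sm.exists_bound [CompactSpace X] (ha : D.Sm a) : ∃ C, ∀ p, ‖a p‖ ≤ C := by
  obtain ⟨C, hC⟩ := isCompact_univ.exists_bound_of_continuousOn
    (ContMDiff.continuous ha).continuousOn
  exact ⟨C, fun p => hC p (mem_univ p)⟩

variable [MeasurableSpace X] [BorelSpace X]

theorem SmInt.aestronglyMeasurable (ha : D.SmInt a) : AEStronglyMeasurable a G.vol := by
  have h1 : G.vol.restrict {p | 0 < D.x p} = G.vol :=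
    Measure.restrict_eq_self_of_ae_mem (ae_pos G)
  rw [← h1]
  exact (ContMDiffOn.continuousOn ha).aestronglyMeasurable isOpen_pos.measurableSet

/-- Vanishing to order d + 2 already beats the density x^(-d-2) near the boundary. Elsewhere the
function is bounded and the volume is finite. -/
theorem Schw.memLp [CompactSpace X] [CompactSpace M] (ha : D.Schw a) : MemLp a 2 G.vol := by
  refine memLp_two_of_lintegral_lt_top (SmInt.aestronglyMeasurable G ha.sm.int) ?_
  obtain ⟨C, hC⟩ := Sm.exists_bound ha.sm
  obtain ⟨w, hw, hwe⟩ := ha (d + 2)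
  obtain ⟨K, hK⟩ := Sm.exists_bound hw
  have hε := D.ε_pos
  obtain ⟨A, hA, hAF⟩ := exists_setLIntegral_x_le G (D := D)
  let F : ℝ → ℝ≥0∞ := fun t => ENNReal.ofReal (K * t ^ (d + 2)) ^ 2
  have hF : Measurable F := by fun_prop
  have h1 := hAF F hF (ENNReal.ofReal K ^ 2 * ENNReal.ofReal ((D.ε / 2) ^ (d + 2))) 0 (D.ε / 2)
    le_rfl le_rfl fun t ht => by
      have ht0 : 0 < t := ht.1
      -- The bound `K` carries no sign; if it is negative, the majorant `F` vanishes on the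
      -- interval.
      have hK0 : 0 ≤ K ∨ K < 0 := le_or_gt 0 K
      rcases hK0 with hK0 | hK0
      · have e : F t * ENNReal.ofReal ((t ^ (d + 2))⁻¹) =
            ENNReal.ofReal K ^ 2 * ENNReal.ofReal (t ^ (d + 2)) := by
          simp only [F]
          rw [← ENNReal.ofReal_pow (by positivity), ← ENNReal.ofReal_pow hK0,
            ← ENNReal.ofReal_mul (by positivity), ← ENNReal.ofReal_mul (by positivity)]
          congr 1
          field_simp
        rw [e]
        gcongr
        exact ht.2
      · have : F t = 0 := by
          simp only [F]
          rw [ENNReal.ofReal_of_nonpos (mul_nonpos_of_nonpos_of_nonneg hK0.le (by positivity))]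
          simp
        rw [this, zero_mul]
        exact zero_le
  have h2 : ∫⁻ p in {p | D.x p ∈ Ioc 0 (D.ε / 2)}, ‖a p‖ₑ ^ 2 ∂G.vol ≤
      ∫⁻ p in {p | D.x p ∈ Ioc 0 (D.ε / 2)}, F (D.x p) ∂G.vol := by
    refine lintegral_mono fun p => ?_
    simp only [F]
    gcongr
    rw [← ofReal_norm]
    refine ENNReal.ofReal_le_ofReal ?_
    rw [hwe p, norm_mul, norm_pow, Complex.norm_real, Real.norm_of_nonneg (D.x_nonneg p), mul_comm]
    exact mul_le_mul_of_nonneg_right (hK p) (pow_nonneg (D.x_nonneg p) _)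
  have h3 : ∫⁻ p in {p | D.ε / 2 ≤ D.x p}, ‖a p‖ₑ ^ 2 ∂G.vol ≤
      ENNReal.ofReal C ^ 2 * G.vol {p | D.ε / 2 ≤ D.x p} := by
    rw [← setLIntegral_const]
    refine lintegral_mono fun p => ?_
    gcongr
    rw [← ofReal_norm]
    exact ENNReal.ofReal_le_ofReal (hC p)
  have h4 : ∫⁻ p, ‖a p‖ₑ ^ 2 ∂G.vol ≤ ∫⁻ p in {p | D.x p ∈ Ioc 0 (D.ε / 2)}, ‖a p‖ₑ ^ 2 ∂G.vol +
      ∫⁻ p in {p | D.ε / 2 ≤ D.x p}, ‖a p‖ₑ ^ 2 ∂G.vol := by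
    refine le_trans (le_of_eq ?_) (lintegral_union_le _ _ _)
    rw [Measure.restrict_eq_self_of_ae_mem]
    filter_upwards [ae_pos G] with p hp
    rcases le_total (D.x p) (D.ε / 2) with h | h
    · exact Or.inl ⟨hp, h⟩
    · exact Or.inr h
  refine h4.trans_lt (ENNReal.add_lt_top.2 ⟨(h2.trans h1).trans_lt ?_, h3.trans_lt ?_⟩)
  · exact ENNReal.mul_lt_top (ENNReal.mul_lt_top hA.lt_top (ENNReal.mul_lt_top
      (ENNReal.pow_lt_top ENNReal.ofReal_lt_top) ENNReal.ofReal_lt_top)) ENNReal.ofReal_lt_top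
  · exact ENNReal.mul_lt_top (ENNReal.pow_lt_top ENNReal.ofReal_lt_top)
      (vol_lt_top G (half_pos hε))

/-- The volume of the region where `x` is comparable with `1 / R`, with weight `x ^ d`. -/
theorem exists_lintegral_pow_le [CompactSpace X] [CompactSpace M] : ∃ C : ℝ, 0 < C ∧
    ∀ R : ℝ, 2 / D.ε ≤ R → ∀ f : X → ℂ, ∀ K : ℝ, 0 ≤ K →
      (∀ p, 0 < D.x p → ‖f p‖ ≤ K * D.x p ^ ((d : ℝ) / 2)) →
      (∀ p, 0 < D.x p → D.x p ∉ Ioc (1 / (4 * R)) (1 / R) → f p = 0) →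
      ∫⁻ p, ‖f p‖ₑ ^ 2 ∂G.vol ≤ ENNReal.ofReal (C * K ^ 2 * R) := by
  obtain ⟨A, hA, hAF⟩ := exists_setLIntegral_x_le G (D := D)
  obtain ⟨b, hb, rfl⟩ : ∃ b : ℝ, 0 ≤ b ∧ A = ENNReal.ofReal b :=
    ⟨A.toReal, ENNReal.toReal_nonneg, (ENNReal.ofReal_toReal hA).symm⟩
  -- On the interval x^d x^(-d-2) ≤ 16 R², and its length is 3/(4R), which gives 12 R. The summand 1
  -- only keeps the constant positive.
  refine ⟨12 * b + 1, by positivity, fun R hR f K hK hf hf0 => ?_⟩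
  have hε := D.ε_pos
  have hR0 : 0 < R := lt_of_lt_of_le (by positivity) hR
  have hR1 : 1 / R ≤ D.ε / 2 := by
    rw [div_le_div_iff₀ hR0 two_pos]
    rw [div_le_iff₀ hε] at hR
    linarith
  let F : ℝ → ℝ≥0∞ := fun t => ENNReal.ofReal (K ^ 2 * t ^ d)
  have hF : Measurable F := by fun_prop
  have h1 := hAF F hF (ENNReal.ofReal (K ^ 2 * (16 * R ^ 2))) (1 / (4 * R)) (1 / R)
    (by positivity) hR1 fun t ht => by
      have ht0 : 0 < t := lt_trans (by positivity) ht.1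
      simp only [F]
      rw [← ENNReal.ofReal_mul (by positivity)]
      refine ENNReal.ofReal_le_ofReal ?_
      have e : K ^ 2 * t ^ d * (t ^ (d + 2))⁻¹ = K ^ 2 * (t⁻¹) ^ 2 := by
        rw [pow_add]
        field_simp
      have ht1 : t⁻¹ ≤ 4 * R := by
        rw [inv_le_comm₀ ht0 (by positivity), ← one_div]
        exact ht.1.le
      rw [e]
      have : (t⁻¹) ^ 2 ≤ (4 * R) ^ 2 := pow_le_pow_left₀ (by positivity) ht1 2
      have h16 : (4 * R) ^ 2 = 16 * R ^ 2 := by ring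
      rw [← h16]
      gcongr
  have hmeas : MeasurableSet {p | D.x p ∈ Ioc (1 / (4 * R)) (1 / R)} :=
    measurable_x (D := D) measurableSet_Ioc
  have h2 : ∫⁻ p, ‖f p‖ₑ ^ 2 ∂G.vol ≤
      ∫⁻ p in {p | D.x p ∈ Ioc (1 / (4 * R)) (1 / R)}, F (D.x p) ∂G.vol := by
    rw [← lintegral_indicator hmeas]
    refine lintegral_mono_ae ?_
    filter_upwards [ae_pos G] with p hp
    by_cases hpR : D.x p ∈ Ioc (1 / (4 * R)) (1 / R)
    · rw [indicator_of_mem (show p ∈ {p | D.x p ∈ Ioc (1 / (4 * R)) (1 / R)} from hpR),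
        ← ofReal_norm, ← ENNReal.ofReal_pow (norm_nonneg _)]
      refine ENNReal.ofReal_le_ofReal ((pow_le_pow_left₀ (norm_nonneg _) (hf p hp) 2).trans_eq ?_)
      rw [mul_pow, ← Real.rpow_mul_natCast hp.le]
      congr 1
      rw [← Real.rpow_natCast]
      congr 1
      push_cast
      ring
    · rw [hf0 p hp hpR]
      simp
  refine (h2.trans h1).trans ?_
  rw [← ENNReal.ofReal_mul hb, ← ENNReal.ofReal_mul (by positivity)]
  refine ENNReal.ofReal_le_ofReal ?_
  have e : b * (K ^ 2 * (16 * R ^ 2)) * (1 / R - 1 / (4 * R)) =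
      12 * b * K ^ 2 * R := by
    field_simp
    ring
  rw [e]
  gcongr
  linarith

/-- On this interval x^d x^(-d-2) ≥ 4R², and its length is 1/(6R), which yields a lower bound
proportional to (2/3) R. The interval is the region where the later cut-off is equal to 1. -/
theorem exists_le_lintegral_pow [CompactSpace X] [Nonempty M] : ∃ c : ℝ, 0 < c ∧
    ∀ R : ℝ, 2 / D.ε ≤ R → ∀ f : X → ℂ,
      (∀ p, D.x p ∈ Ioc (1 / (3 * R)) (1 / (2 * R)) → ‖f p‖ = D.x p ^ ((d : ℝ) / 2)) →
      ENNReal.ofReal (c * R) ≤ ∫⁻ p, ‖f p‖ₑ ^ 2 ∂G.vol := by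
  obtain ⟨A, hA, hAF⟩ := exists_le_setLIntegral_x G (D := D)
  -- The constant from the lower integral bound may be infinite, so a positive real number below it
  -- is used.
  obtain ⟨B, hB0, hBA⟩ : ∃ B : ℝ, 0 < B ∧ ENNReal.ofReal B ≤ A := by
    rcases eq_or_ne A ⊤ with rfl | hA'
    · exact ⟨1, one_pos, le_top⟩
    · exact ⟨A.toReal, ENNReal.toReal_pos hA hA', (ENNReal.ofReal_toReal hA').le⟩
  refine ⟨B * (2 / 3), by positivity, fun R hR f hf => ?_⟩
  have hε := D.ε_pos
  have hR0 : 0 < R := lt_of_lt_of_le (by positivity) hR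
  have hR1 : 1 / (2 * R) ≤ D.ε / 2 := by
    rw [div_le_div_iff₀ (by positivity) two_pos]
    rw [div_le_iff₀ hε] at hR
    nlinarith
  let F : ℝ → ℝ≥0∞ := fun t => ENNReal.ofReal (t ^ d)
  have hF : Measurable F := by fun_prop
  have h1 := hAF F hF (ENNReal.ofReal (4 * R ^ 2)) (1 / (3 * R)) (1 / (2 * R))
    (by positivity) hR1 fun t ht => by
      have ht0 : 0 < t := lt_trans (by positivity) ht.1
      simp only [F]
      rw [← ENNReal.ofReal_mul (by positivity)]
      refine ENNReal.ofReal_le_ofReal ?_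
      have e : t ^ d * (t ^ (d + 2))⁻¹ = (t⁻¹) ^ 2 := by
        rw [pow_add]
        field_simp
      have ht1 : 2 * R ≤ t⁻¹ := by
        rw [le_inv_comm₀ (by positivity) ht0, ← one_div]
        exact ht.2
      rw [e]
      have : (2 * R) ^ 2 ≤ (t⁻¹) ^ 2 := pow_le_pow_left₀ (by positivity) ht1 2
      linarith [show (2 * R) ^ 2 = 4 * R ^ 2 by ring]
  have h2 : ENNReal.ofReal (B * (2 / 3) * R) =
      ENNReal.ofReal B * ENNReal.ofReal (4 * R ^ 2) *
        ENNReal.ofReal (1 / (2 * R) - 1 / (3 * R)) := by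
    rw [← ENNReal.ofReal_mul hB0.le, ← ENNReal.ofReal_mul (by positivity)]
    congr 1
    field_simp
    ring
  calc _ ≤ A * ENNReal.ofReal (4 * R ^ 2) * ENNReal.ofReal (1 / (2 * R) - 1 / (3 * R)) := by
        rw [h2]
        gcongr
    _ ≤ _ := h1
    _ ≤ ∫⁻ p in {p | D.x p ∈ Ioc (1 / (3 * R)) (1 / (2 * R))}, ‖f p‖ₑ ^ 2 ∂G.vol := by
        refine setLIntegral_mono' (measurable_x (D := D) measurableSet_Ioc) fun p hp => ?_
        have hp0 : 0 ≤ D.x p := D.x_nonneg p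
        rw [← ofReal_norm, hf p hp, ← ENNReal.ofReal_pow (by positivity),
          ← Real.rpow_mul_natCast hp0]
        refine ENNReal.ofReal_le_ofReal (le_of_eq ?_)
        rw [← Real.rpow_natCast]
        congr 1
        push_cast
        ring
    _ ≤ _ := setLIntegral_le_lintegral _ _

end

section

/-! ### Cut-off profiles in the rescaled variable 1/(xR). -/

section Profile

theorem contDiff_of_eq_zero {g : ℝ → ℂ} {δ : ℝ} (hδ : 0 < δ) (hg : ContDiffOn ℝ ∞ g (Ioi 0))
    (h0 : ∀ t < δ, g t = 0) : ContDiff ℝ ∞ g := by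
  refine contDiff_iff_contDiffAt.2 fun t => ?_
  rcases lt_or_ge t δ with ht | ht
  · refine (contDiffAt_const (c := (0 : ℂ))).congr_of_eventuallyEq ?_
    filter_upwards [Iio_mem_nhds ht] with s hs using h0 s hs
  · exact hg.contDiffAt (Ioi_mem_nhds (lt_of_lt_of_le hδ ht))

/-- A smooth function supported in `[3/2, 7/2]`. -/
def IsProfile (f : ℝ → ℂ) : Prop := ContDiff ℝ ∞ f ∧ ∀ s ∉ Icc (3 / 2 : ℝ) (7 / 2), f s = 0

variable {f : ℝ → ℂ}

theorem IsProfile.deriv (hf : IsProfile f) : IsProfile (deriv f) := by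
  refine ⟨(contDiff_infty_iff_deriv.1 hf.1).2, fun s hs => ?_⟩
  have h : f =ᶠ[𝓝 s] fun _ => 0 := by
    filter_upwards [isClosed_Icc.isOpen_compl.mem_nhds hs] with t ht using hf.2 t ht
  rw [h.deriv_eq, deriv_const]

theorem IsProfile.div_pow (hf : IsProfile f) (n : ℕ) : IsProfile fun s => f s / (s : ℂ) ^ n := by
  have h0 : ∀ s ∉ Icc (3 / 2 : ℝ) (7 / 2), f s / (s : ℂ) ^ n = 0 := fun s hs => by
    rw [hf.2 s hs, zero_div]
  refine ⟨contDiff_of_eq_zero one_pos ?_ fun t ht => h0 t fun h => ?_, h0⟩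
  · simpa only [div_eq_mul_inv] using
      hf.1.contDiffOn.mul (ProductDecomposition.contDiffOn_inv_pow n)
  · linarith [h.1]

theorem IsProfile.exists_bound (hf : IsProfile f) : ∃ C, 0 ≤ C ∧ ∀ s, ‖f s‖ ≤ C := by
  obtain ⟨C, hC⟩ := isCompact_Icc.exists_bound_of_continuousOn
    (s := Icc (3 / 2 : ℝ) (7 / 2)) hf.1.continuous.continuousOn
  have hC0 : 0 ≤ C := (norm_nonneg _).trans (hC 2 (by norm_num))
  refine ⟨C, hC0, fun s => ?_⟩
  by_cases hs : s ∈ Icc (3 / 2 : ℝ) (7 / 2)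
  · exact hC s hs
  · rw [hf.2 s hs, norm_zero]
    exact hC0

theorem contDiffOn_scale {R : ℝ} (hR : 0 < R) :
    ContDiffOn ℝ ∞ (fun t : ℝ => 1 / (t * R)) (Ioi 0) :=
  contDiffOn_const.div (contDiffOn_id.mul contDiffOn_const) fun _ ht => (mul_pos ht hR).ne'

theorem hasDerivAt_scale {R t : ℝ} (hR : 0 < R) (ht : 0 < t) :
    HasDerivAt (fun t : ℝ => 1 / (t * R)) (-(1 / (t ^ 2 * R))) t := by
  have h := ((hasDerivAt_id t).mul_const R).fun_inv (mul_pos ht hR).ne'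
  simp only [one_div]
  convert! h using 1
  simp only [id]
  field_simp

theorem IsProfile.contDiffOn_comp_scale (hf : IsProfile f) {R : ℝ} (hR : 0 < R) :
    ContDiffOn ℝ ∞ (fun t : ℝ => f (1 / (t * R))) (Ioi 0) :=
  hf.1.comp_contDiffOn (contDiffOn_scale hR)

theorem IsProfile.hasDerivAt_comp_scale (hf : IsProfile f) {R t : ℝ} (hR : 0 < R) (ht : 0 < t) :
    HasDerivAt (fun t : ℝ => f (1 / (t * R)))
      (-(1 / ((t : ℂ) ^ 2 * R)) * _root_.deriv f (1 / (t * R))) t := by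
  have h1 : HasDerivAt f (_root_.deriv f (1 / (t * R))) (1 / (t * R)) :=
    (hf.1.differentiable (by simp) _).hasDerivAt
  have h2 := h1.scomp t (hasDerivAt_scale hR ht)
  convert! h2 using 1
  simp [Complex.real_smul]

theorem IsProfile.eq_zero_of_lt (hf : IsProfile f) {R t : ℝ} (hR : 0 < R) (ht : t < 2 / (7 * R)) :
    f (1 / (t * R)) = 0 := by
  refine hf.2 _ fun h => ?_
  rcases le_or_gt t 0 with h0 | h0
  · have : 1 / (t * R) ≤ 0 := div_nonpos_of_nonneg_of_nonpos zero_le_one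
      (mul_nonpos_of_nonpos_of_nonneg h0 hR.le)
    linarith [h.1]
  · have h1 := h.2
    rw [div_le_div_iff₀ (mul_pos h0 hR) two_pos] at h1
    rw [lt_div_iff₀ (by positivity)] at ht
    linarith

end Profile

/-! ### Rescaled families and approximate eigenfunctions for γ = i. -/

variable {d : ℕ}
  {X : Type*} [TopologicalSpace X] [ChartedSpace (EuclideanHalfSpace (d + 1)) X]
  [IsManifold (𝓡∂ (d + 1)) ∞ X]
  {M : Type*} [TopologicalSpace M] [ChartedSpace (EuclideanSpace ℝ (Fin d)) M]
  [IsManifold (𝓡 d) ∞ M]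

open ProductDecomposition

/-- The families `R ↦ Φ R` of functions on `X` that are spanned by `R⁻ᵉ f(1 / (x R)) b`, where
`e ≥ n`, the function `f` is a profile and `b` is smooth. -/
inductive Fam (D : ProductDecomposition d X M) (n : ℕ) : (ℝ → X → ℂ) → Prop
  | single {e : ℕ} {f : ℝ → ℂ} {b : X → ℂ} (he : n ≤ e) (hf : IsProfile f) (hb : D.Sm b) :
    Fam D n fun R p => ((R : ℂ)⁻¹) ^ e * (f (1 / (D.x p * R)) * b p)
  | add {Φ Ψ : ℝ → X → ℂ} (hΦ : Fam D n Φ) (hΨ : Fam D n Ψ) : Fam D n fun R p => Φ R p + Ψ R p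

variable {D : ProductDecomposition d X M} (G : ScatteringMetric D) {a b v : X → ℂ} {n : ℕ}
  {Φ Ψ : ℝ → X → ℂ}

theorem Fam.mono {m : ℕ} (h : Fam D n Φ) (hmn : m ≤ n) : Fam D m Φ := by
  induction h with
  | single he hf hb => exact .single (hmn.trans he) hf hb
  | add _ _ ih ih' => exact .add ih ih'

theorem Fam.eq_zero (h : Fam D n Φ) {R : ℝ} {p : X}
    (hp : 1 / (D.x p * R) ∉ Icc (3 / 2 : ℝ) (7 / 2)) : Φ R p = 0 := by
  induction h with
  | single he hf hb => simp only [hf.2 _ hp, zero_mul, mul_zero]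
  | add _ _ ih ih' => simp only [ih, ih', add_zero]

theorem Fam.smInt (h : Fam D n Φ) {R : ℝ} (hR : 0 < R) : D.SmInt (Φ R) := by
  induction h with
  | single he hf hb =>
    exact (Sm.const _).int.mul ((SmInt.comp_x (hf.contDiffOn_comp_scale hR)).mul hb.int)
  | add _ _ ih ih' => exact ih.add ih'

theorem Fam.exists_bound [CompactSpace X] (h : Fam D n Φ) :
    ∃ C, 0 ≤ C ∧ ∀ R, 1 ≤ R → ∀ p, ‖Φ R p‖ ≤ C * R⁻¹ ^ n := by
  induction h with
  | @single e f b he hf hb =>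
    obtain ⟨C, hC0, hC⟩ := hf.exists_bound
    obtain ⟨B, hB⟩ := Sm.exists_bound hb
    refine ⟨C * |B|, by positivity, fun R hR p => ?_⟩
    have hR0 : 0 < R := by linarith
    rw [norm_mul, norm_mul, norm_pow, norm_inv, Complex.norm_real, Real.norm_of_nonneg hR0.le,
      mul_comm]
    refine mul_le_mul ?_ ?_ (by positivity) (by positivity)
    · exact mul_le_mul (hC _) ((hB p).trans (le_abs_self B)) (norm_nonneg _) hC0
    · exact pow_le_pow_of_le_one (by positivity) (inv_le_one_of_one_le₀ hR) he
  | add _ _ ih ih' =>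
    obtain ⟨C, hC0, hC⟩ := ih
    obtain ⟨C', hC0', hC'⟩ := ih'
    refine ⟨C + C', by positivity, fun R hR p => (norm_add_le _ _).trans ?_⟩
    rw [add_mul]
    exact add_le_add (hC R hR p) (hC' R hR p)

/-- For R ≥ 2/ε the support of every profile stays in x ≤ ε/2, strictly inside the collar where the
conjugation formula with a cut-off is valid. -/
theorem scale_notMem {R : ℝ} (hR : 2 / D.ε ≤ R) {p : X} (hp : D.ε / 2 < D.x p) :
    1 / (D.x p * R) ∉ Icc (3 / 2 : ℝ) (7 / 2) := by
  intro h
  have hε := D.ε_pos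
  have h1 : 1 < D.x p * R := by
    calc (1 : ℝ) = D.ε / 2 * (2 / D.ε) := by field_simp
      _ < D.x p * (2 / D.ε) := by gcongr
      _ ≤ _ := by gcongr; linarith
  have h2 : 1 / (D.x p * R) < 1 := by
    rw [div_lt_one (by linarith)]
    exact h1
  linarith [h.1]

variable (D) in
theorem scale_pos {R : ℝ} (hR : 2 / D.ε ≤ R) : 0 < R :=
  lt_of_lt_of_le (div_pos two_pos D.ε_pos) hR

/-- For γ = i the main term reproduces the family because -γ² = 1. With s = 1/(xR), the factor x² is
R⁻²s⁻², and x² times the first derivative of f(s) is -R⁻¹f'(s), so every error term gains at least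
one power of R⁻¹. -/
theorem Fam.exists_laplacian [T2Space X] [CompactSpace X] (h : Fam D n Φ) :
    ∃ Ψ, Fam D (n + 1) Ψ ∧ ∀ R, 2 / D.ε ≤ R → ∀ p, 0 < D.x p →
      G.laplacian (fun q => wt d Complex.I (D.x q) * Φ R q) p =
        wt d Complex.I (D.x p) * (Φ R p + Ψ R p) := by
  induction h with
  | @single e f b he hf hb =>
    obtain ⟨T, K, hT, hK, -, hkey⟩ := exists_conj_laplacian G Complex.I hb
    have hf' := hf.deriv
    have hf'' := hf'.deriv
    have hI := fun c => Sm.const (D := D) c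
    -- The terms come from x²T, from the transport term 2γ, from xK together with the
    -- first-derivative part of the second derivative of the cut-off, and from f''.
    have hΨ : Fam D (n + 1) _ := Fam.add
      (.single (e := e + 2) (by omega) (hf.div_pow 2) hT)
      (.add (.single (e := e + 1) (by omega) hf' ((hI (2 * Complex.I)).mul hb))
      (.add (.single (e := e + 2) (by omega) (hf'.div_pow 1) (hK.sub ((hI 2).mul hb)))
        (.single (e := e + 2) (by omega) hf'' hb.neg)))
    refine ⟨_, hΨ, fun R hR p hp => ?_⟩
    have hR0 := scale_pos D hR
    have hx0 : (D.x p : ℂ) ≠ 0 := by exact_mod_cast hp.ne'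
    have hRC : (R : ℂ) ≠ 0 := by exact_mod_cast hR0.ne'
    rcases lt_or_ge (D.x p) D.ε with hxε | hxε
    · have h1 := hkey _ (hf.contDiffOn_comp_scale hR0) p hp hxε
      have e1 : deriv (fun t : ℝ => f (1 / (t * R))) (D.x p) =
          -(1 / ((D.x p : ℂ) ^ 2 * R)) * deriv f (1 / (D.x p * R)) :=
        (hf.hasDerivAt_comp_scale hR0 hp).deriv
      have e2 : deriv (deriv fun t : ℝ => f (1 / (t * R))) (D.x p) =
          2 / ((D.x p : ℂ) ^ 3 * R) * deriv f (1 / (D.x p * R)) +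
            1 / ((D.x p : ℂ) ^ 4 * R ^ 2) * deriv (deriv f) (1 / (D.x p * R)) := by
        have h2 : deriv (fun t : ℝ => f (1 / (t * R))) =ᶠ[𝓝 (D.x p)] fun t : ℝ =>
            -(1 / ((t : ℂ) ^ 2 * R)) * deriv f (1 / (t * R)) := by
          filter_upwards [Ioi_mem_nhds hp] with t ht
          exact (hf.hasDerivAt_comp_scale hR0 ht).deriv
        rw [h2.deriv_eq]
        have h3 : HasDerivAt (fun t : ℝ => -(1 / ((t : ℂ) ^ 2 * R)))
            (2 / ((D.x p : ℂ) ^ 3 * R)) (D.x p) := by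
          have := ((((hasDerivAt_ofReal_complex (D.x p)).fun_pow 2).mul_const (R : ℂ)).fun_inv
            (mul_ne_zero (pow_ne_zero 2 hx0) hRC)).fun_neg
          simp only [one_div]
          convert! this using 1
          push_cast
          field_simp
        rw [(h3.fun_mul (hf'.hasDerivAt_comp_scale hR0 hp)).deriv]
        field_simp
      rw [e1, e2] at h1
      have h3 : (fun q => wt d Complex.I (D.x q) * (((R : ℂ)⁻¹) ^ e *
          (f (1 / (D.x q * R)) * b q))) = fun q => ((R : ℂ)⁻¹) ^ e * (wt d Complex.I (D.x q) *
            (f (1 / (D.x q * R)) * b q)) := by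
        funext q
        ring
      rw [h3, laplacian_const_mul, h1, Complex.I_sq]
      push_cast
      simp only [pow_add, pow_one, inv_pow]
      field_simp
      ring
    -- Outside the collar the family vanishes in a neighbourhood of the point, so both sides are
    -- zero.
    · have hs : ∀ q, D.ε / 2 < D.x q → 1 / (D.x q * R) ∉ Icc (3 / 2 : ℝ) (7 / 2) := fun q hq =>
        scale_notMem hR hq
      have hp2 : D.ε / 2 < D.x p := lt_of_lt_of_le (half_lt_self D.ε_pos) hxε
      rw [Fam.eq_zero hΨ (hs p hp2), laplacian_congr G (f' := fun _ => 0 * 0), laplacian_const_mul]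
      · simp only [hf.2 _ (hs p hp2)]
        simp
      · filter_upwards [(isOpen_Ioi.preimage D.x_continuous).mem_nhds hp2] with q hq
        simp only [hf.2 _ (hs q hq)]
        simp
  | @add Φ₁ Φ₂ h h' ih ih' =>
    obtain ⟨Ψ, hΨ, hΨe⟩ := ih
    obtain ⟨Ψ', hΨ', hΨe'⟩ := ih'
    refine ⟨_, hΨ.add hΨ', fun R hR p hp => ?_⟩
    have hR0 := scale_pos D hR
    simp only [mul_add]
    rw [laplacian_add G (smInt_wt _ (h.smInt hR0)) (smInt_wt _ (h'.smInt hR0)) hp,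
      hΨe R hR p hp, hΨe' R hR p hp]
    ring

theorem Fam.exists_iterate_laplacian [T2Space X] [CompactSpace X] (h : Fam D 0 Φ) (k : ℕ) :
    ∃ Ψ, Fam D 1 Ψ ∧ ∀ R, 2 / D.ε ≤ R → ∀ p, 0 < D.x p →
      G.laplacian^[k] (fun q => wt d Complex.I (D.x q) * Φ R q) p =
        wt d Complex.I (D.x p) * (Φ R p + Ψ R p) := by
  induction k with
  | zero =>
    -- The zero profile represents the vanishing error.
    refine ⟨_, .single (f := fun _ => 0) le_rfl ⟨contDiff_const, fun _ _ => rfl⟩ (Sm.const 0),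
      fun R _ p _ => by simp⟩
  | succ k ih =>
    obtain ⟨Ψ, hΨ, hΨe⟩ := ih
    obtain ⟨Ξ, hΞ, hΞe⟩ := (h.add (hΨ.mono zero_le_one)).exists_laplacian G
    refine ⟨_, hΨ.add hΞ, fun R hR p hp => ?_⟩
    rw [Function.iterate_succ_apply', laplacian_congr_int G (hΨe R hR) hp, hΞe R hR p hp]
    ring

theorem norm_wt_I (d : ℕ) {t : ℝ} (ht : 0 ≤ t) : ‖wt d Complex.I t‖ = t ^ ((d : ℝ) / 2) := by
  rw [wt, norm_mul, Complex.norm_exp, Complex.norm_real, Real.norm_of_nonneg (by positivity)]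
  have : (-Complex.I / (t : ℂ)).re = 0 := by
    rw [Complex.div_ofReal_re]
    simp
  rw [this, Real.exp_zero, one_mul]

/-- A profile that is equal to one on `[2, 3]`. -/
def bump : ContDiffBump (5 / 2 : ℝ) := ⟨1 / 2, 1, by norm_num, by norm_num⟩

theorem isProfile_bump : IsProfile fun s => (bump s : ℂ) := by
  refine ⟨Complex.ofRealCLM.contDiff.comp bump.contDiff, fun s hs => ?_⟩
  have : bump s = 0 := by
    refine bump.zero_of_le_dist ?_
    by_contra h
    push Not at h
    rw [Real.dist_eq, abs_lt] at h
    change -1 < _ ∧ _ < (1 : ℝ) at h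
    exact hs ⟨by linarith [h.1], by linarith [h.2]⟩
  simp [this]

theorem bump_eq_zero {s : ℝ} (hs : s ∉ Icc (3 / 2 : ℝ) (7 / 2)) : (bump s : ℂ) = 0 :=
  isProfile_bump.2 s hs

theorem bump_eq_one {s : ℝ} (h2 : 2 ≤ s) (h3 : s ≤ 3) : bump s = 1 := by
  refine bump.one_of_mem_closedBall ?_
  rw [Metric.mem_closedBall, Real.dist_eq, abs_le]
  change -(1 / 2) ≤ _ ∧ _ ≤ (1 / 2 : ℝ)
  exact ⟨by linarith, by linarith⟩

variable (D) in
/-- The approximate eigenfunctions. -/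
def quasimode (R : ℝ) (p : X) : ℂ := wt d Complex.I (D.x p) * (bump (1 / (D.x p * R)) : ℂ)

/-- The profile vanishes for x < 2/(7R), so division by any power of x remains smooth. -/
theorem schw_quasimode {R : ℝ} (hR : 0 < R) : D.Schw (quasimode D R) := fun N => by
  have hb := isProfile_bump
  refine ⟨fun p => wt d Complex.I (D.x p) * (bump (1 / (D.x p * R)) : ℂ) * ((D.x p : ℂ) ^ N)⁻¹,
    Sm.comp_x (φ := fun t : ℝ => wt d Complex.I t * (bump (1 / (t * R)) : ℂ) * ((t : ℂ) ^ N)⁻¹)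
      (contDiff_of_eq_zero (δ := 2 / (7 * R)) (by positivity) ?_ fun t ht => ?_), fun p => ?_⟩
  · exact ((contDiffOn_wt d _).mul (hb.contDiffOn_comp_scale hR)).mul (contDiffOn_inv_pow N)
  · rw [hb.eq_zero_of_lt hR ht, mul_zero, zero_mul]
  · rcases (D.x_nonneg p).eq_or_lt with h | h
    · have h0 := hb.eq_zero_of_lt hR (t := D.x p) (by rw [← h]; positivity)
      simp only [quasimode, h0]
      simp
    · have hx0 : (D.x p : ℂ) ≠ 0 := by exact_mod_cast h.ne'
      rw [quasimode]
      field_simp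

theorem quasimode_eq_zero {R : ℝ} {p : X} (hp : 1 / (D.x p * R) ∉ Icc (3 / 2 : ℝ) (7 / 2)) :
    quasimode D R p = 0 := by
  rw [quasimode, bump_eq_zero hp, mul_zero]

theorem mem_Ioc_of_scale {R t : ℝ} (hR : 0 < R) (ht : 0 < t)
    (h : 1 / (t * R) ∈ Icc (3 / 2 : ℝ) (7 / 2)) : t ∈ Ioc (1 / (4 * R)) (1 / R) := by
  have h1 := h.1
  have h2 := h.2
  rw [div_le_div_iff₀ two_pos (by positivity)] at h1
  rw [div_le_div_iff₀ (by positivity) two_pos] at h2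
  constructor
  · rw [div_lt_iff₀ (by positivity)]
    linarith
  · rw [le_div_iff₀ hR]
    linarith

variable [MeasurableSpace X] [BorelSpace X]

/-- On the support x is comparable with 1/R. There the error is at most a constant times x^(d/2)/R,
by the gain in the families and by writing v = x w. Its squared norm is therefore at most of order R
· R⁻², against a main term of order at least R. -/
theorem exists_quasimode_bounds [T2Space X] [CompactSpace X] [CompactSpace M] [Nonempty M]
    (hv : D.Schw v) (k : ℕ) : ∃ R₀ c C : ℝ, 0 < R₀ ∧ 0 < c ∧ 0 < C ∧ ∀ R, R₀ ≤ R →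
      ENNReal.ofReal (c * R) ≤ ∫⁻ p, ‖quasimode D R p‖ₑ ^ 2 ∂G.vol ∧
      ∫⁻ p, ‖G.laplacian^[k] (quasimode D R) p + v p * quasimode D R p - quasimode D R p‖ₑ ^ 2
        ∂G.vol ≤ ENNReal.ofReal (C / R) := by
  obtain ⟨c, hc, hlow⟩ := exists_le_lintegral_pow G (D := D)
  obtain ⟨C, hC, hup⟩ := exists_lintegral_pow_le G (D := D)
  have hΦ : Fam D 0 _ := .single (e := 0) le_rfl isProfile_bump (Sm.const 1)
  obtain ⟨Ψ, hΨ, hΨe⟩ := hΦ.exists_iterate_laplacian G k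
  obtain ⟨C₁, hC₁, hb₁⟩ := hΨ.exists_bound
  obtain ⟨C₂, hC₂, hb₂⟩ := isProfile_bump.exists_bound
  obtain ⟨w, hw, hwe⟩ := hv 1
  obtain ⟨C₃, hb₃⟩ := Sm.exists_bound hw
  have hq : ∀ R : ℝ, (fun q => wt d Complex.I (D.x q) * (((R : ℂ)⁻¹) ^ 0 *
      ((bump (1 / (D.x q * R)) : ℂ) * 1))) = quasimode D R := fun R => by
    funext q
    simp [quasimode]
  refine ⟨max 1 (2 / D.ε), c, C * (C₁ + |C₃| * C₂ + 1) ^ 2, by positivity, hc, by positivity,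
    fun R hR => ?_⟩
  have hR1 : 1 ≤ R := (le_max_left _ _).trans hR
  have hR2 : 2 / D.ε ≤ R := (le_max_right _ _).trans hR
  have hR0 : 0 < R := by linarith
  constructor
  · refine hlow R hR2 _ fun p hp => ?_
    have hp0 : 0 < D.x p := lt_trans (by positivity) hp.1
    have h1 : bump (1 / (D.x p * R)) = 1 := by
      refine bump_eq_one ?_ ?_
      · rw [le_div_iff₀ (by positivity)]
        have := hp.2
        rw [le_div_iff₀ (by positivity)] at this
        linarith
      · rw [div_le_iff₀ (by positivity)]
        have := hp.1
        rw [div_lt_iff₀ (by positivity)] at this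
        linarith
    rw [quasimode, h1, Complex.ofReal_one, mul_one, norm_wt_I d hp0.le]
  · have hE : ∀ p, 0 < D.x p →
        G.laplacian^[k] (quasimode D R) p + v p * quasimode D R p - quasimode D R p =
          wt d Complex.I (D.x p) * (Ψ R p + v p * (bump (1 / (D.x p * R)) : ℂ)) := by
      intro p hp
      have h1 := hΨe R hR2 p hp
      simp only [hq] at h1
      rw [h1, quasimode]
      ring
    refine (hup R hR2 _ ((C₁ + |C₃| * C₂ + 1) / R) (by positivity) (fun p hp => ?_)
      fun p hp hpR => ?_).trans_eq ?_
    · rw [hE p hp, norm_mul, norm_wt_I d hp.le, mul_comm]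
      refine mul_le_mul_of_nonneg_right ?_ (by positivity)
      by_cases hs : 1 / (D.x p * R) ∈ Icc (3 / 2 : ℝ) (7 / 2)
      · have h2 := mem_Ioc_of_scale hR0 hp hs
        have h3 := hb₁ R hR1 p
        have h4 : ‖v p * (bump (1 / (D.x p * R)) : ℂ)‖ ≤ 1 / R * |C₃| * C₂ := by
          rw [norm_mul, hwe p, norm_mul, pow_one, Complex.norm_real, Real.norm_of_nonneg hp.le]
          refine mul_le_mul ?_ (hb₂ _) (norm_nonneg _) (by positivity)
          exact mul_le_mul h2.2 ((hb₃ p).trans (le_abs_self _)) (norm_nonneg _) (by positivity)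
        refine (norm_add_le _ _).trans ((add_le_add h3 h4).trans ?_)
        rw [pow_one, add_div, add_div, div_eq_mul_inv C₁]
        have h5 : 0 ≤ 1 / R := by positivity
        have h6 : 1 / R * |C₃| * C₂ = |C₃| * C₂ / R := by ring
        linarith
      · rw [hΨ.eq_zero hs, bump_eq_zero hs, mul_zero, add_zero, norm_zero]
        positivity
    · have hs : 1 / (D.x p * R) ∉ Icc (3 / 2 : ℝ) (7 / 2) := fun hs =>
        hpR (mem_Ioc_of_scale hR0 hp hs)
      rw [hE p hp, hΨ.eq_zero hs, bump_eq_zero hs, mul_zero, add_zero, mul_zero]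
    · congr 1
      field_simp

end

/-! ### The short-range property and the two spectral conclusions. -/

section

open ProductDecomposition

variable {d : ℕ}
  {X : Type*} [TopologicalSpace X] [ChartedSpace (EuclideanHalfSpace (d + 1)) X]
  [IsManifold (𝓡∂ (d + 1)) ∞ X]
  {M : Type*} [TopologicalSpace M] [ChartedSpace (EuclideanSpace ℝ (Fin d)) M]
  [IsManifold (𝓡 d) ∞ M]
  {D : ProductDecomposition d X M} {a b v f e : X → ℂ}

/-- A Schwartz function, as an element of `C^∞(X)`. -/
def Schw.toSmooth (hf : D.Schw f) : ScatteringMetric.Smooth d X := ⟨f, hf.sm⟩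

theorem Schw.isSchwartz (hf : D.Schw f) : ScatteringMetric.IsSchwartz D (Schw.toSmooth hf) :=
  fun N => by
    obtain ⟨w, hw, hwe⟩ := hf N
    exact ⟨⟨w, hw⟩, hwe⟩

variable (G : ScatteringMetric D)

theorem iterate_laplacian_congr_int (h : ∀ q, 0 < D.x q → a q = b q) (k : ℕ) {p : X}
    (hp : 0 < D.x p) : G.laplacian^[k] a p = G.laplacian^[k] b p := by
  induction k generalizing p with
  | zero => exact h p hp
  | succ k ih =>
    rw [Function.iterate_succ_apply', Function.iterate_succ_apply']
    exact laplacian_congr_int G (fun q hq => ih hq) hp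

theorem iterate_laplacian_const_mul (c : ℂ) (a : X → ℂ) (k : ℕ) :
    G.laplacian^[k] (fun q => c * a q) = fun p => c * G.laplacian^[k] a p := by
  induction k with
  | zero => rfl
  | succ k ih =>
    rw [Function.iterate_succ_apply', ih]
    funext p
    rw [laplacian_const_mul, Function.iterate_succ_apply']

theorem SmInt.iterate_laplacian (ha : D.SmInt a) (k : ℕ) : D.SmInt (G.laplacian^[k] a) := by
  induction k with
  | zero => exact ha
  | succ k ih =>
    rw [Function.iterate_succ_apply']
    exact SmInt.laplacian G ih

variable [MeasurableSpace X] [BorelSpace X]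

/-- A Schwartz function is x² times a smooth one, and multiplication is an operator of order zero,
given by the empty product of vector fields. -/
theorem isShortRange_mulOp (hv : D.Schw v) (hreal : ∀ p, star (v p) = v p) (k : ℕ) :
    G.IsShortRange k (ScatteringMetric.mulOp (Schw.toSmooth hv)) where
  mem := by
    obtain ⟨w, hw, hwe⟩ := hv 2
    refine ⟨ScatteringMetric.mulOp ⟨w, hw⟩, Submodule.subset_span ⟨⟨w, hw⟩, [], by simp, by simp,
      by simp⟩, fun f p => ?_⟩
    change v p * f p = (D.x p : ℂ) ^ 2 * (w p * f p)
    rw [hwe]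
    ring
  symm f₁ f₂ _ _ := by
    refine integral_congr_ae (Eventually.of_forall fun p => ?_)
    change star (v p * f₁ p) * f₂ p = star (f₁ p) * (v p * f₂ p)
    rw [star_mul', hreal]
    ring

theorem mem_opGraph (hv : D.Schw v) (k : ℕ) (hf : D.Schw f) {α β : Lp ℂ 2 G.vol}
    (hα : α =ᵐ[G.vol] f) (hβ : β =ᵐ[G.vol] fun p => G.laplacian^[k] f p + v p * f p) :
    (α, β) ∈ G.opGraph k (ScatteringMetric.mulOp (Schw.toSmooth hv)) :=
  ⟨Schw.toSmooth hf, Schw.isSchwartz hf, hα, hβ⟩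

theorem smul_mem_opGraph (hv : D.Schw v) (k : ℕ) {α β : Lp ℂ 2 G.vol} (c : ℂ)
    (h : (α, β) ∈ G.opGraph k (ScatteringMetric.mulOp (Schw.toSmooth hv))) :
    (c • α, c • β) ∈ G.opGraph k (ScatteringMetric.mulOp (Schw.toSmooth hv)) := by
  obtain ⟨g, hg, h1, h2⟩ := h
  have hg' : D.Schw fun p => c * g p := fun N => by
    obtain ⟨w, hw⟩ := hg N
    exact ⟨_, (Sm.const c).mul w.contMDiff, fun p => by simp only [hw]; ring⟩
  refine mem_opGraph G hv k hg' ?_ ?_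
  · filter_upwards [Lp.coeFn_smul c α, h1] with p hp1 hp2
    rw [hp1, Pi.smul_apply, hp2, smul_eq_mul]
  · filter_upwards [Lp.coeFn_smul c β, h2] with p hp1 hp2
    rw [hp1, Pi.smul_apply, hp2, smul_eq_mul, iterate_laplacian_const_mul]
    change c * (_ + v p * g p) = _
    ring

variable [T2Space X] [CompactSpace X] [CompactSpace M] [Nonempty M]

/-- The eigenfunction is Schwartz, since the weight with γ = 1 is flat at the boundary, so the pair
lies in the graph before taking the closure. -/
theorem isClosureEigenvalue_one {k : ℕ} (hv : D.Schw v) (ha : D.Sm a) (ha0 : ∀ p, a p ≠ 0)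
    (hE : ∀ p, 0 < D.x p → G.laplacian^[k] (fun q => wt d 1 (D.x q) * a q) p +
      v p * (wt d 1 (D.x p) * a p) = wt d 1 (D.x p) * a p) :
    IsClosureEigenvalue (G.opGraph k (ScatteringMetric.mulOp (Schw.toSmooth hv))) 1 := by
  have hu : D.Schw fun p => (flatWt (d / 2) (D.x p) : ℂ) * a p := (Schw.flat _).mul ha
  have huw : ∀ p, 0 < D.x p → (flatWt (d / 2) (D.x p) : ℂ) * a p = wt d 1 (D.x p) * a p :=
    fun p hp => by rw [wt_one d hp]
  have hmem := Schw.memLp G hu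
  refine ⟨hmem.toLp _, fun h0 => ?_, subset_closure (mem_opGraph G hv k hu hmem.coeFn_toLp ?_)⟩
  -- The eigenfunction has no zeros in the interior, so it could vanish in L² only if the volume
  -- were zero; the lower bound for the approximate eigenfunctions excludes this.
  · obtain ⟨R₀, c, C, hR₀, hc, -, hb⟩ := exists_quasimode_bounds G hv k
    have h1 := (Lp.eq_zero_iff_ae_eq_zero.1 h0)
    have h2 : ∀ᵐ p ∂G.vol, False := by
      filter_upwards [h1, hmem.coeFn_toLp, ae_pos G] with p hp1 hp2 hp
      rw [hp1, huw p hp] at hp2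
      exact mul_ne_zero (wt_ne_zero d 1 hp) (ha0 p) hp2.symm
    have h3 : G.vol = 0 := by
      rw [← Measure.measure_univ_eq_zero]
      simpa [ae_iff] using h2
    have h4 := (hb R₀ le_rfl).1
    rw [h3, lintegral_zero_measure, nonpos_iff_eq_zero, ENNReal.ofReal_eq_zero] at h4
    have := mul_pos hc hR₀
    linarith
  · rw [Complex.ofReal_one, one_smul]
    filter_upwards [hmem.coeFn_toLp, ae_pos G] with p hp1 hp
    rw [hp1, iterate_laplacian_congr_int G huw k hp, huw p hp, hE p hp]

/-- The support of the bump spans a ratio (7/2)/(3/2) = 7/3 in 1/x, which is less than 5, so the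
supports are disjoint. -/
theorem quasimode_mul_eq_zero {R R' : ℝ} (hR : 0 < R) (hR' : 5 * R ≤ R') (p : X) :
    quasimode D R p = 0 ∨ quasimode D R' p = 0 := by
  by_contra h
  push Not at h
  have h1 : 1 / (D.x p * R) ∈ Icc (3 / 2 : ℝ) (7 / 2) := by
    by_contra h1
    exact h.1 (quasimode_eq_zero h1)
  have h2 : 1 / (D.x p * R') ∈ Icc (3 / 2 : ℝ) (7 / 2) := by
    by_contra h2
    exact h.2 (quasimode_eq_zero h2)
  have hx : 0 < D.x p := by
    refine (D.x_nonneg p).lt_of_ne fun h0 => ?_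
    have := h1.1
    rw [← h0] at this
    norm_num at this
  have h3 := h1.2
  have h4 := h2.1
  rw [div_le_div_iff₀ (by positivity) two_pos] at h3
  rw [div_le_div_iff₀ two_pos (mul_pos hx (by linarith))] at h4
  nlinarith

/-- The powers of 5 make the supports disjoint, hence the functions orthogonal. After normalization
the squared error is at most (C/R)/(cR), so the error is O(1/R) along a sequence with R → ∞. -/
theorem isClosureEssential_one (hv : D.Schw v) (k : ℕ) :
    IsClosureEssential (G.opGraph k (ScatteringMetric.mulOp (Schw.toSmooth hv))) 1 := by
  obtain ⟨R₀, c, C, hR₀, hc, hC, hb⟩ := exists_quasimode_bounds G hv k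
  let R : ℕ → ℝ := fun m => R₀ * 5 ^ m
  have hRR : ∀ m, R₀ ≤ R m := fun m => le_mul_of_one_le_right hR₀.le (one_le_pow₀ (by norm_num))
  have hR : ∀ m, 0 < R m := fun m => hR₀.trans_le (hRR m)
  let u : ℕ → X → ℂ := fun m => quasimode D (R m)
  let e : ℕ → X → ℂ := fun m p => G.laplacian^[k] (u m) p + v p * u m p - u m p
  have hu : ∀ m, D.Schw (u m) := fun m => schw_quasimode (hR m)
  have hum : ∀ m, MemLp (u m) 2 G.vol := fun m => Schw.memLp G (hu m)
  have hem : ∀ m, MemLp (e m) 2 G.vol := fun m =>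
    memLp_two_of_lintegral_lt_top (SmInt.aestronglyMeasurable G
      (((SmInt.iterate_laplacian G (hu m).sm.int k).add (hv.sm.mul (hu m).sm).int).sub
        (hu m).sm.int)) ((hb (R m) (hRR m)).2.trans_lt ENNReal.ofReal_lt_top)
  have hunorm : ∀ m, c * R m ≤ ‖(hum m).toLp (u m)‖ ^ 2 := fun m => by
    rw [norm_toLp_sq]
    have h1 : ∫⁻ p, ‖u m p‖ₑ ^ 2 ∂G.vol < ⊤ := by
      rw [← eLpNorm_two_sq]
      exact ENNReal.pow_lt_top (hum m).2
    exact (ENNReal.ofReal_le_iff_le_toReal h1.ne).1 (hb (R m) (hRR m)).1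
  have henorm : ∀ m, ‖(hem m).toLp (e m)‖ ^ 2 ≤ C / R m := fun m => by
    rw [norm_toLp_sq]
    exact ENNReal.toReal_le_of_le_ofReal (div_pos hC (hR m)).le (hb (R m) (hRR m)).2
  have hu0 : ∀ m, 0 < ‖(hum m).toLp (u m)‖ := fun m => by
    have h1 := (mul_pos hc (hR m)).trans_le (hunorm m)
    exact (norm_nonneg _).lt_of_ne fun h => by
      rw [← h] at h1
      norm_num at h1
  let κ : ℕ → ℂ := fun m => ((‖(hum m).toLp (u m)‖ : ℝ) : ℂ)⁻¹
  refine ⟨fun m => κ m • (hum m).toLp (u m),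
    fun m => κ m • ((hum m).toLp (u m) + (hem m).toLp (e m)), ⟨fun m => ?_, fun i j hij => ?_⟩,
    fun m => subset_closure (smul_mem_opGraph G hv k _ (mem_opGraph G hv k (hu m)
      (hum m).coeFn_toLp ?_)), ?_⟩
  · exact norm_smul_inv_norm (norm_pos_iff.1 (hu0 m))
  · beta_reduce
    rw [inner_smul_left, inner_smul_right, L2.inner_def, integral_eq_zero_of_ae, mul_zero, mul_zero]
    filter_upwards [(hum i).coeFn_toLp, (hum j).coeFn_toLp] with p hi hj
    rw [hi, hj, Pi.zero_apply]
    have hlt : ∀ m n, m < n → 5 * R m ≤ R n := fun m n hmn => by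
      have h1 : (5 : ℝ) ^ (m + 1) ≤ 5 ^ n := pow_le_pow_right₀ (by norm_num) hmn
      calc 5 * R m = R₀ * 5 ^ (m + 1) := by simp only [R]; ring
        _ ≤ R n := mul_le_mul_of_nonneg_left h1 hR₀.le
    have h0 : u i p = 0 ∨ u j p = 0 := by
      rcases lt_or_gt_of_ne hij with h | h
      · exact quasimode_mul_eq_zero (hR i) (hlt i j h) p
      · exact (quasimode_mul_eq_zero (hR j) (hlt j i h) p).symm
    rcases h0 with h0 | h0 <;> simp [h0]
  · filter_upwards [Lp.coeFn_add ((hum m).toLp (u m)) ((hem m).toLp (e m)), (hum m).coeFn_toLp,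
      (hem m).coeFn_toLp] with p h1 h2 h3
    rw [h1, Pi.add_apply, h2, h3]
    simp only [e]
    ring
  · have hlim : Tendsto (fun m => √(C / c) / R m) atTop (𝓝 0) :=
      tendsto_const_nhds.div_atTop
        ((tendsto_pow_atTop_atTop_of_one_lt (by norm_num)).const_mul_atTop hR₀)
    refine squeeze_zero_norm (fun m => ?_) hlim
    beta_reduce
    rw [Complex.ofReal_one, one_smul, smul_add, add_sub_cancel_left, norm_smul]
    have h1 : ‖κ m‖ = ‖(hum m).toLp (u m)‖⁻¹ := by
      simp only [κ]
      rw [norm_inv, Complex.norm_real, norm_norm]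
    rw [h1]
    refine le_of_sq_le_sq ?_ (by have := hR m; positivity)
    rw [mul_pow, div_pow, Real.sq_sqrt (by positivity), inv_pow]
    have h2 : C / c / R m ^ 2 = (c * R m)⁻¹ * (C / R m) := by
      have := (hR m).ne'
      field_simp
    rw [h2]
    exact mul_le_mul (inv_anti₀ (mul_pos hc (hR m)) (hunorm m)) (henorm m) (by positivity)
      (inv_nonneg.2 (mul_pos hc (hR m)).le)

end

end ScatteringGeometry

end

theorem mainTheorem8 {d : ℕ}
    {X : Type*} [TopologicalSpace X] [T2Space X] [CompactSpace X]
    [ChartedSpace (EuclideanHalfSpace (d + 1)) X] [IsManifold (𝓡∂ (d + 1)) ∞ X]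
    [MeasurableSpace X] [BorelSpace X]
    {M : Type*} [TopologicalSpace M] [T2Space M] [CompactSpace M] [Nonempty M]
    [ChartedSpace (EuclideanSpace ℝ (Fin d)) M] [IsManifold (𝓡 d) ∞ M]
    (D : ScatteringGeometry.ProductDecomposition d X M)
    (G : ScatteringGeometry.ScatteringMetric D)
    (k : ℕ) (hk : 1 < k) (hk_even : Even k) :
    ∃ v : ScatteringGeometry.ScatteringMetric.Smooth d X,
      ScatteringGeometry.ScatteringMetric.IsSchwartz D v ∧
      (∀ p, (v p).im = 0) ∧
      G.IsShortRange k (ScatteringGeometry.ScatteringMetric.mulOp v) ∧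
      ∃ E : ℝ, 0 < E ∧
        ScatteringGeometry.IsClosureEigenvalue
          (G.opGraph k (ScatteringGeometry.ScatteringMetric.mulOp v)) E ∧
        ScatteringGeometry.IsClosureEssential
          (G.opGraph k (ScatteringGeometry.ScatteringMetric.mulOp v)) E := by
  obtain ⟨v, a, hv, hreal, ha, ha0, hE⟩ := ScatteringGeometry.exists_potential G hk_even
  exact ⟨ScatteringGeometry.Schw.toSmooth hv, ScatteringGeometry.Schw.isSchwartz hv,
    fun p => Complex.conj_eq_iff_im.1 (hreal p), ScatteringGeometry.isShortRange_mulOp G hv hreal k,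
    1, one_pos, ScatteringGeometry.isClosureEigenvalue_one G hv ha ha0 hE,
    ScatteringGeometry.isClosureEssential_one G hv k⟩
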